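/- **Notation.** Let $\varpi(n)=\log n$ if $n$ is prime and $\varpi(n)=0$ otherwise. For real $x$, an integer $q\ge 1$ and $(a,q)=1$ put $$E(x;q,a)=\sum_{x<n\le 2x,\; n\equiv a\,(q)}\varpi(n)-\frac{x}{\phi(q)},\qquad E^*(N,q)=\sup_{0<x\le N}\ \max_{(a,q)=1}|E(x;q,a)|.$$ Hypothesis $BV(\theta)$ states that for all $A>0$ and $\epsilon>0$, $\sum_{q\le N^{\theta-\epsilon}}E^*(N,q)\ll_{A,\epsilon}N(\log N)^{-A}$ for $N\ge 2$. For a finite set $\mathcal H$ of $k$ distinct integers let $P(n;\mathcal H)=\prod_{h\in\mathcal H}(n+h)$. For a prime $p$ let $\nu_p(\mathcal H)$ be the number of residue classes mod $p$ that occur in $\mathcal H$, and for any $d\ge1$ let $\nu_d(\mathcal H)$ be the number of residue classes $a$ mod $d$ with $P(a;\mathcal H)\equiv 0 \pmod d$ (for prime $d$ the two agree). The set $\mathcal H$ is admissible if $\nu_p(\mathcal H)<p$ for all primes $p$. Let $$\mathfrak S(\mathcal H)=\prod_p\Bigl(1-\frac{\nu_p(\mathcal H)}p\Bigr)\Bigl(1-\frac1p\Bigr)^{-k},\qquad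 \beta(\mathcal H)=\sum_p\frac{(k-\nu_p(\mathcal H))\log p}{p}.$$ Let $f(d)=d/\nu_d(\mathcal H)$ and $f_1=f*\mu$ (Dirichlet convolution with the Möbius function). For real $R$ and an integer $\ell\ge 0$ let $\lambda_{d,\ell}=0$ for $d\ge R$ and $$\lambda_{d,\ell}=\mu(d)\frac{f(d)}{f_1(d)}\frac{\mathfrak S(\mathcal H)}{\ell!}\sum_{r<R/d,\;(r,d)=1}\frac{\mu^2(r)}{f_1(r)}\Bigl(\log\frac{R}{rd}\Bigr)^{\ell}\qquad(d<R),$$ and let $\Lambda_R(n;\mathcal H,\ell)=\sum_{d\mid P(n;\mathcal H)}\lambda_{d,\ell}$. **Theorem.** For every integer $k\ge 2$ there is a constant $C>0$ depending only on $k$ with the following property. Let $0<\theta\le 1$ be such that $BV(\theta)$ is true, and let $\epsilon>0$. Then there is $N_0$ (depending on $k,\theta,\epsilon$) such that for all real $N\ge N_0$, all real $R$ with $2\le R\le N^{(\theta-\epsilon)/2}$, all sets $\mathcal H$ of $k$ distinct integers and all integers $h_0$ such that $|h|\le\log N$ for every $h\in\mathcal H\cup\{h_0\}$, and all integers $0\le\ell_1,\ell_2\le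 k$: (1) If $h_0\in\mathcal H$ and $\mathcal H$ is admissible, then $$\sum_{N<n\le 2N}\varpi(n+h_0)\Lambda_R(n;\mathcal H,\ell_1)\Lambda_R(n;\mathcal H,\ell_2)=\binom{\ell_1+\ell_2+2}{\ell_1+1}N\,\mathfrak S(\mathcal H)\frac{(\log R)^{k+\ell_1+\ell_2+1}}{(k+\ell_1+\ell_2+1)!}\,(1+\delta)$$ for some real $\delta$ with $|\delta|\le C\,\beta(\mathcal H)\mathfrak S(\mathcal H)/\log R$. (2) If $h_0\notin\mathcal H$, $\mathcal H^0=\mathcal H\cup\{h_0\}$ is admissible, and $\ell_1,\ell_2\ge 1$, then $$\sum_{N<n\le 2N}\varpi(n+h_0)\Lambda_R(n;\mathcal H,\ell_1)\Lambda_R(n;\mathcal H,\ell_2)=\binom{\ell_1+\ell_2}{\ell_1}N\,\mathfrak S(\mathcal H^0)\frac{(\log R)^{k+\ell_1+\ell_2}}{(k+\ell_1+\ell_2)!}\,(1+\delta)$$ for some real $\delta$ with $|\delta|\le C\,\beta(\mathcal H^0)\mathfrak S(\mathcal H^0)/\log R$. -/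

import Mathlib

open scoped BigOperators

noncomputable section

namespace SmallGaps

/-- The weight `ϖ`: `ϖ(n) = log n` if `n` is prime, and `0` otherwise. -/
def varpi (n : ℕ) : ℝ :=
  open Classical in if n.Prime then Real.log n else 0

/-- `ϖ` at an integer (an integer that is not positive is not a prime). -/
def varpiInt (m : ℤ) : ℝ := varpi m.toNat

/-! ### The level of distribution of the primes -/

/-- `E(x; q, a) = ∑_{x < n ≤ 2x, n ≡ a mod q} ϖ(n) - x / φ(q)`. -/
def primeError (x : ℝ) (q : ℕ) (a : ZMod q) : ℝ :=
  open Classical in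
  (∑ n ∈ (Finset.Ioc ⌊x⌋₊ ⌊2 * x⌋₊).filter (fun n : ℕ => (n : ZMod q) = a), varpi n)
    - x / (Nat.totient q : ℝ)

/-- `E(x, q)`: the maximum of `|E(x; q, a)|` over the reduced residue classes `a` mod `q`. -/
def primeErrorMax (x : ℝ) (q : ℕ) : ℝ :=
  ⨆ a : (ZMod q)ˣ, |primeError x q (a : ZMod q)|

/-- `E*(N, q)`: the supremum of `E(x, q)` over real `x` with `0 < x ≤ N`. -/
def primeErrorStar (N : ℝ) (q : ℕ) : ℝ :=
  sSup ((fun x : ℝ => primeErrorMax x q) '' Set.Ioc 0 N)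

/-- Hypothesis `BV(θ)`: for all `A > 0` and `ε > 0`,
`∑_{q ≤ N ^ (θ - ε)} E*(N, q) ≪_{A, ε} N (log N) ^ (-A)`. -/
def HypothesisBV (θ : ℝ) : Prop :=
  ∀ A : ℝ, 0 < A → ∀ ε : ℝ, 0 < ε → ∃ C : ℝ, ∀ N : ℝ, 2 ≤ N →
    ∑ q ∈ Finset.Icc 1 ⌊N ^ (θ - ε)⌋₊, primeErrorStar N q ≤ C * (N * (Real.log N) ^ (-A))

/-! ### Local densities, the singular series and `β` -/

/-- `P(n; H) = ∏_{h ∈ H} (n + h)`. -/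
def tuplePoly (H : Finset ℤ) (n : ℤ) : ℤ := ∏ h ∈ H, (n + h)

/-- `ν_p(H)`: the number of distinct residue classes mod `p` that occur in `H`. -/
def nuPrime (H : Finset ℤ) (p : ℕ) : ℕ :=
  (H.image (fun h : ℤ => (h : ZMod p))).card

/-- `ν_d(H)`: the number of residue classes `a` mod `d` with `P(a; H) ≡ 0 mod d`. -/
def nu (H : Finset ℤ) (d : ℕ) : ℕ :=
  ((Finset.range d).filter (fun a : ℕ => (d : ℤ) ∣ tuplePoly H (a : ℤ))).card

/-- At a prime the two counts agree: `a ↦ -a` maps the classes of `H` to the roots. -/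
theorem nu_prime (H : Finset ℤ) (p : ℕ) (hp : p.Prime) :
    nu H p = nuPrime H p := by
  have := Fact.mk hp
  unfold nu nuPrime
  symm
  apply Finset.card_bij (fun (b : ZMod p) _ => (-b).val)
  · intro b hb
    simp only [Finset.mem_image] at hb
    obtain ⟨h, hh, rfl⟩ := hb
    simp only [Finset.mem_filter, Finset.mem_range]
    refine ⟨ZMod.val_lt _, ?_⟩
    unfold tuplePoly
    rw [← ZMod.intCast_zmod_eq_zero_iff_dvd, Int.cast_prod]
    apply Finset.prod_eq_zero hh
    simp
  · intro a _ b _ hab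
    exact neg_injective (ZMod.val_injective _ hab)
  · intro a ha
    obtain ⟨hl, hd⟩ := Finset.mem_filter.mp ha
    rw [Finset.mem_range] at hl
    unfold tuplePoly at hd
    rw [← ZMod.intCast_zmod_eq_zero_iff_dvd, Int.cast_prod, Finset.prod_eq_zero_iff] at hd
    obtain ⟨h, hh, he⟩ := hd
    refine ⟨(h : ZMod p), Finset.mem_image_of_mem _ hh, ?_⟩
    push_cast at he
    have : -(h : ZMod p) = (a : ZMod p) := by linear_combination -he
    rw [this, ZMod.val_natCast, Nat.mod_eq_of_lt hl]

/-- `H` is admissible: `ν_p(H) < p` for every prime `p`. -/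
def Admissible (H : Finset ℤ) : Prop :=
  ∀ p : ℕ, p.Prime → nuPrime H p < p

/-- The singular series `𝔖(H) = ∏_p (1 - ν_p(H) / p) (1 - 1 / p) ^ (-k)` with `k = |H|`. -/
def singularSeries (H : Finset ℤ) : ℝ :=
  ∏' p : Nat.Primes,
    (1 - (nuPrime H (p : ℕ) : ℝ) / ((p : ℕ) : ℝ)) * ((1 - 1 / ((p : ℕ) : ℝ)) ^ H.card)⁻¹

/-- `β(H) = ∑_p (k - ν_p(H)) log p / p` with `k = |H|`; only finitely many terms are nonzero. -/
def beta (H : Finset ℤ) : ℝ :=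
  ∑' p : Nat.Primes,
    ((H.card : ℝ) - (nuPrime H (p : ℕ) : ℝ)) * Real.log ((p : ℕ) : ℝ) / ((p : ℕ) : ℝ)

/-! ### The sieve weights -/

/-- `f(d) = d / ν_d(H)`. -/
def sieveF (H : Finset ℤ) (d : ℕ) : ℝ := (d : ℝ) / (nu H d : ℝ)

/-- `f₁ = f * μ` (Dirichlet convolution). -/
def sieveF1 (H : Finset ℤ) (d : ℕ) : ℝ :=
  ∑ x ∈ d.divisorsAntidiagonal, sieveF H x.1 * (ArithmeticFunction.moebius x.2 : ℝ)

/-- The sieve coefficients `λ_{d,ℓ}`: for `d < R`,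
`λ_{d,ℓ} = μ(d) (f(d) / f₁(d)) (𝔖(H) / ℓ!) ∑_{r < R/d, (r,d) = 1} (μ²(r) / f₁(r)) (log (R/(rd)))^ℓ`,
and `λ_{d,ℓ} = 0` for `d ≥ R`. -/
def sieveLambda (H : Finset ℤ) (R : ℝ) (ℓ d : ℕ) : ℝ :=
  open Classical in
  if (d : ℝ) < R then
    (ArithmeticFunction.moebius d : ℝ) * (sieveF H d / sieveF1 H d)
      * (singularSeries H / (Nat.factorial ℓ : ℝ))
      * ∑ r ∈ (Finset.Ico 1 ⌈R / (d : ℝ)⌉₊).filter (fun r : ℕ => Nat.Coprime r d),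
          (ArithmeticFunction.moebius r : ℝ) ^ 2 / sieveF1 H r
            * (Real.log (R / ((r : ℝ) * (d : ℝ)))) ^ ℓ
  else 0

/-- `Λ_R(n; H, ℓ) = ∑_{d ∣ P(n; H)} λ_{d,ℓ}`, over positive integers `d`; the terms with `d ≥ R`
vanish, so the sum is restricted to `d < R`. -/
def LambdaR (H : Finset ℤ) (R : ℝ) (ℓ : ℕ) (n : ℤ) : ℝ :=
  ∑ d ∈ (Finset.Ico 1 ⌈R⌉₊).filter (fun d : ℕ => (d : ℤ) ∣ tuplePoly H n), sieveLambda H R ℓ d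

/-- The sum `∑_{N < n ≤ 2N} ϖ(n + h₀) Λ_R(n; H, ℓ₁) Λ_R(n; H, ℓ₂)`. -/
def weightedPrimeSum (H : Finset ℤ) (h₀ : ℤ) (N R : ℝ) (ℓ₁ ℓ₂ : ℕ) : ℝ :=
  ∑ n ∈ Finset.Ioc ⌊N⌋₊ ⌊2 * N⌋₊,
    varpiInt ((n : ℤ) + h₀) * LambdaR H R ℓ₁ (n : ℤ) * LambdaR H R ℓ₂ (n : ℤ)

end SmallGaps

end

noncomputable section

namespace SmallGaps

open Filter Topology

/-! Write H⁰ for `insert h₀ H`, and ν_p, ν⁰_p for the local counts of H and H⁰. At each prime f/f₁ =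
p/(p - ν_p) and 1/f₁ = ν_p/(p - ν_p), so the λ_{d,ℓ} are 𝔖(H) times Selberg coefficients built from
a logarithmic cutoff (`sieveLambda_eq`). Opening both Λ_R leaves, for each pair d₁, d₂, the sum of
ϖ(n + h₀) over n with q = [d₁, d₂] dividing P(n; H). Classes a mod q with a + h₀ not coprime to q
contain no primes in the range; by the Chinese remainder theorem the other classes number ∏_{p ∣ q}
(ν⁰_p - 1). The expected value is therefore N g(q) with g(p) = (ν⁰_p - 1)/(p - 1). Since q ≤ R² ≤
N^(θ-ε), BV(θ) keeps the total error below 𝔖(H)² N (`exists_forall_abs_weightedPrimeSum_sub_le`).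

The main quadratic form is diagonalised as in Selberg's sieve (`sum_selbergCoeff_lcm`): it equals
∑_r h(r) y_r y'_r, where h(p) = g/(1 - g) = (ν⁰_p - 1)/(p - ν⁰_p), the factor y_r is a(r)
∑_{(n,r)=1} (a - 1)(n) (log(R/(rn)))^ℓ/ℓ!, and a(p) = (1 - g(p)) p/(p - ν_p). Here (a - 1)(n) means
the product of a(p) - 1 over p ∣ n, n squarefree. The two cases differ only in a.

If h₀ ∈ H, then a = p/(p - 1) and a - 1 = 1/(p - 1): the inner sum has dimension one and y_r ≈
(log(R/r))^(ℓ+1)/(ℓ+1)! (`exists_diagonalForm_mem`). If h₀ ∉ H, then a - 1 is O(1/p²) apart from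
finitely many primes: the inner sum converges and y_r ≈ B (log(R/r))^ℓ/ℓ! with B = ∏ a(p) =
𝔖(H⁰)/𝔖(H) (`abs_diagonalForm_sub_le`, `singularSeries_insert`).

It remains to sum h(r) (log(R/r))^m, where h is close to κ/p with κ = |H⁰| - 1. Mertens' theorem
gives a first order differential relation for the summatory function in u = log x, hence an
asymptotic with some constant and an error linear in the discrepancy of h, which is O(β)
(`exists_sum_mul_log_bound`, `exists_rieszMean_zero_asymptotic`). The constant is identified as ∏_p
(1 + h(p))(1 - 1/p)^κ = 1/𝔖(H⁰) by computing the limit of s^κ ∑ h(n) n^(-s) in two ways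
(`IsSieveWeight.eulerConst_eq`). Multiplying by 𝔖(H)², and by B² in the second case, gives a main
term with one factor 𝔖(H⁰) and an error with two, whence the relative error β 𝔖/log R. -/

/-! ### Squarefree-supported multiplicative functions and upper bounds for their sums. -/

/-- The function supported on squarefree `n` with value `∏_{p ∣ n} w p`. -/
def sqf (w : ℕ → ℝ) (n : ℕ) : ℝ := if Squarefree n then ∏ p ∈ n.primeFactors, w p else 0

theorem sqf_zero (w : ℕ → ℝ) : sqf w 0 = 0 := by simp [sqf]

theorem sqf_one (w : ℕ → ℝ) : sqf w 1 = 1 := by simp [sqf]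

theorem sqf_prime (w : ℕ → ℝ) {p : ℕ} (hp : p.Prime) : sqf w p = w p := by
  simp [sqf, hp.prime.squarefree, hp.primeFactors]

theorem sqf_of_squarefree (w : ℕ → ℝ) {n : ℕ} (hn : Squarefree n) :
    sqf w n = ∏ p ∈ n.primeFactors, w p := by simp [sqf, hn]

theorem sqf_of_not_squarefree (w : ℕ → ℝ) {n : ℕ} (hn : ¬ Squarefree n) : sqf w n = 0 := by
  simp [sqf, hn]

theorem sqf_congr {w v : ℕ → ℝ} {n : ℕ} (h : ∀ p, p.Prime → p ∣ n → w p = v p) :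
    sqf w n = sqf v n := by
  unfold sqf
  split_ifs
  · exact Finset.prod_congr rfl fun p hp =>
      h p (Nat.prime_of_mem_primeFactors hp) (Nat.dvd_of_mem_primeFactors hp)
  · rfl

theorem sqf_nonneg {w : ℕ → ℝ} (hw : ∀ p, p.Prime → 0 ≤ w p) (n : ℕ) : 0 ≤ sqf w n := by
  unfold sqf
  split_ifs
  · exact Finset.prod_nonneg fun p hp => hw p (Nat.prime_of_mem_primeFactors hp)
  · exact le_rfl

theorem sqf_le_sqf {w v : ℕ → ℝ} (hw : ∀ p, p.Prime → 0 ≤ w p)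
    (hv : ∀ p, p.Prime → w p ≤ v p) (n : ℕ) : sqf w n ≤ sqf v n := by
  unfold sqf
  split_ifs
  · exact Finset.prod_le_prod (fun p hp => hw p (Nat.prime_of_mem_primeFactors hp))
      fun p hp => hv p (Nat.prime_of_mem_primeFactors hp)
  · exact le_rfl

theorem abs_sqf (w : ℕ → ℝ) (n : ℕ) : |sqf w n| = sqf (fun p => |w p|) n := by
  unfold sqf
  split_ifs
  · rw [Finset.abs_prod]
  · simp

theorem sqf_mul_sqf (w v : ℕ → ℝ) (n : ℕ) :
    sqf w n * sqf v n = sqf (fun p => w p * v p) n := by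
  unfold sqf
  split_ifs
  · rw [Finset.prod_mul_distrib]
  · simp

theorem sqf_mul_of_coprime (w : ℕ → ℝ) {m n : ℕ} (h : m.Coprime n) :
    sqf w (m * n) = sqf w m * sqf w n := by
  unfold sqf
  simp only [Nat.squarefree_mul h]
  by_cases hm : Squarefree m <;> by_cases hn : Squarefree n <;> simp [hm, hn]
  rw [Nat.Coprime.primeFactors_mul h, Finset.prod_union h.disjoint_primeFactors]

theorem sqf_inv_le (n : ℕ) : sqf (fun p => 1 / (p : ℝ)) n ≤ 1 / (n : ℝ) := by
  unfold sqf
  split_ifs with h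
  · rw [Finset.prod_div_distrib, Finset.prod_const_one, ← Nat.cast_prod,
      Nat.prod_primeFactors_of_squarefree h]
  · positivity

/-- `sqf w` as an arithmetic function. -/
def sqfFun (w : ℕ → ℝ) : ArithmeticFunction ℝ := ⟨sqf w, sqf_zero w⟩

theorem sqfFun_apply (w : ℕ → ℝ) (n : ℕ) : sqfFun w n = sqf w n := rfl

theorem isMultiplicative_sqfFun (w : ℕ → ℝ) : (sqfFun w).IsMultiplicative :=
  ⟨sqf_one w, fun h => sqf_mul_of_coprime w h⟩

theorem sqf_add (w v : ℕ → ℝ) {n : ℕ} (hn : Squarefree n) :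
    sqf (fun p => w p + v p) n = ∑ x ∈ n.divisorsAntidiagonal, sqf w x.1 * sqf v x.2 := by
  have h := ArithmeticFunction.IsMultiplicative.prodPrimeFactors_add_of_squarefree
    (isMultiplicative_sqfFun w) (isMultiplicative_sqfFun v) hn
  rw [ArithmeticFunction.mul_apply, ArithmeticFunction.prodPrimeFactors_apply hn.ne_zero] at h
  simp only [sqfFun_apply, ArithmeticFunction.add_apply] at h
  rw [← h, sqf_of_squarefree _ hn]
  refine Finset.prod_congr rfl fun p hp => ?_
  have := Nat.prime_of_mem_primeFactors hp
  rw [sqf_prime _ this, sqf_prime _ this]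

/-- Restricting a weight to the primes not dividing `r`. -/
def awayFrom (r : ℕ) (w : ℕ → ℝ) (p : ℕ) : ℝ := if p ∣ r then 0 else w p

theorem sqf_awayFrom (r : ℕ) (w : ℕ → ℝ) (n : ℕ) :
    sqf (awayFrom r w) n = if n.Coprime r then sqf w n else 0 := by
  by_cases hn : Squarefree n
  · split_ifs with h
    · refine sqf_congr fun p hp hpn => ?_
      have : ¬ p ∣ r := fun hpr => hp.one_lt.ne' (Nat.eq_one_of_dvd_coprimes h hpn hpr)
      simp [awayFrom, this]
    · obtain ⟨p, hp, h1, h2⟩ := Nat.Prime.not_coprime_iff_dvd.1 h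
      rw [sqf_of_squarefree _ hn]
      exact Finset.prod_eq_zero (Nat.mem_primeFactors.2 ⟨hp, h1, hn.ne_zero⟩) (by simp [awayFrom, h2])
  · simp [sqf_of_not_squarefree _ hn]

theorem awayFrom_nonneg {r : ℕ} {w : ℕ → ℝ} {p : ℕ} (h : 0 ≤ w p) : 0 ≤ awayFrom r w p := by
  unfold awayFrom; split_ifs <;> simp [h]

theorem awayFrom_le {r : ℕ} {w : ℕ → ℝ} {p : ℕ} (h : 0 ≤ w p) : awayFrom r w p ≤ w p := by
  unfold awayFrom; split_ifs <;> simp [h]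

/-- The cutoff at `M` is carried by `F` itself, so both factors may range freely over the same
interval. -/
theorem sum_divisorsAntidiagonal_Ico (M : ℕ) (F : ℕ → ℕ → ℝ)
    (hF : ∀ e t, M ≤ e * t → F e t = 0) :
    ∑ n ∈ Finset.Ico 1 M, ∑ x ∈ n.divisorsAntidiagonal, F x.1 x.2
      = ∑ e ∈ Finset.Ico 1 M, ∑ t ∈ Finset.Ico 1 M, F e t := by
  rw [← Finset.sum_product', Finset.sum_sigma']
  symm
  rw [← Finset.sum_filter_of_ne (p := fun x : ℕ × ℕ => x.1 * x.2 < M)]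
  · refine Finset.sum_bij' (fun x _ => ⟨x.1 * x.2, x⟩) (fun y _ => y.2) ?_ ?_ ?_ ?_ ?_
    · rintro ⟨e, t⟩ h
      simp only [Finset.mem_filter, Finset.mem_product, Finset.mem_Ico] at h
      simp only [Finset.mem_sigma, Finset.mem_Ico, Nat.mem_divisorsAntidiagonal, true_and]
      have : 0 < e * t := Nat.mul_pos h.1.1.1 h.1.2.1
      exact ⟨⟨this, h.2⟩, this.ne'⟩
    · rintro ⟨n, e, t⟩ h
      simp only [Finset.mem_sigma, Finset.mem_Ico, Nat.mem_divisorsAntidiagonal] at h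
      obtain ⟨⟨h1, h2⟩, rfl, h3⟩ := h
      simp only [Finset.mem_filter, Finset.mem_product, Finset.mem_Ico]
      have he : 0 < e := Nat.pos_of_ne_zero fun h => h3 (by simp [h])
      have ht : 0 < t := Nat.pos_of_ne_zero fun h => h3 (by simp [h])
      exact ⟨⟨⟨he, lt_of_le_of_lt (Nat.le_mul_of_pos_right e ht) h2⟩, ht,
        lt_of_le_of_lt (Nat.le_mul_of_pos_left t he) h2⟩, h2⟩
    · rintro ⟨e, t⟩ _; rfl
    · rintro ⟨n, e, t⟩ h
      simp only [Finset.mem_sigma, Finset.mem_Ico, Nat.mem_divisorsAntidiagonal] at h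
      obtain ⟨_, rfl, _⟩ := h
      rfl
    · rintro ⟨e, t⟩ _; rfl
  · rintro ⟨e, t⟩ _ h
    by_contra h'
    exact h (hF e t (not_lt.1 h'))

theorem sqf_mul (w : ℕ → ℝ) (e t : ℕ) :
    sqf w (e * t) = sqf w e * sqf (awayFrom e w) t := by
  rw [sqf_awayFrom]
  split_ifs with h
  · rw [mul_comm e t, sqf_mul_of_coprime w h, mul_comm]
  · rw [mul_zero, sqf_of_not_squarefree]
    exact fun h' => h (Nat.coprime_of_squarefree_mul h').symm

/-- Expanding ∏ (w p + v p) chooses `w` or `v` at each prime of n, that is, a coprime factorisation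
n = e t. Coprimality is stored in `awayFrom e v`, which leaves a free double sum. -/
theorem sum_sqf_add (M : ℕ) (w v : ℕ → ℝ) (Φ : ℕ → ℝ) (hΦ : ∀ n, M ≤ n → Φ n = 0) :
    ∑ n ∈ Finset.Ico 1 M, sqf (fun p => w p + v p) n * Φ n
      = ∑ e ∈ Finset.Ico 1 M, ∑ t ∈ Finset.Ico 1 M,
          sqf w e * sqf (awayFrom e v) t * Φ (e * t) := by
  rw [← sum_divisorsAntidiagonal_Ico M (fun e t => sqf w e * sqf (awayFrom e v) t * Φ (e * t))
    (fun e t h => by simp [hΦ _ h])]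
  refine Finset.sum_congr rfl fun n _ => ?_
  by_cases hn : Squarefree n
  · rw [sqf_add _ _ hn, Finset.sum_mul]
    refine Finset.sum_congr rfl fun x hx => ?_
    obtain ⟨rfl, _⟩ := Nat.mem_divisorsAntidiagonal.1 hx
    rw [sqf_awayFrom, if_pos (Nat.coprime_of_squarefree_mul hn).symm]
  · rw [sqf_of_not_squarefree _ hn, zero_mul]
    symm
    refine Finset.sum_eq_zero fun x hx => ?_
    obtain ⟨rfl, _⟩ := Nat.mem_divisorsAntidiagonal.1 hx
    rw [sqf_awayFrom]
    split_ifs with h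
    · by_cases h1 : Squarefree x.1
      · by_cases h2 : Squarefree x.2
        · exact absurd ((Nat.squarefree_mul h.symm).2 ⟨h1, h2⟩) hn
        · simp [sqf_of_not_squarefree _ h2]
      · simp [sqf_of_not_squarefree _ h1]
    · simp

/-- Summation over the multiples of `r`. -/
theorem sum_multiples (M r : ℕ) (hr : 0 < r) (F : ℕ → ℝ) (hF : ∀ n, M ≤ n → F n = 0) :
    ∑ d ∈ (Finset.Ico 1 M).filter (fun d => r ∣ d), F d = ∑ e ∈ Finset.Ico 1 M, F (r * e) := by
  symm
  rw [← Finset.sum_filter_of_ne (p := fun e : ℕ => r * e < M)]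
  · refine Finset.sum_bij (fun e _ => r * e) ?_ ?_ ?_ ?_
    · intro e he
      simp only [Finset.mem_filter, Finset.mem_Ico] at he ⊢
      exact ⟨⟨Nat.mul_pos hr he.1.1, he.2⟩, dvd_mul_right _ _⟩
    · intro a _ b _ h
      exact Nat.eq_of_mul_eq_mul_left hr h
    · intro d hd
      simp only [Finset.mem_filter, Finset.mem_Ico] at hd
      obtain ⟨⟨h1, h2⟩, e, rfl⟩ := hd
      have he : 0 < e := Nat.pos_of_ne_zero fun h => by simp [h] at h1
      refine ⟨e, ?_, rfl⟩
      simp only [Finset.mem_filter, Finset.mem_Ico]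
      exact ⟨⟨he, lt_of_le_of_lt (Nat.le_mul_of_pos_left e hr) h2⟩, h2⟩
    · intros; rfl
  · intro e _ h
    by_contra h'
    exact h (hF _ (not_lt.1 h'))

theorem sum_sqf_add_le (M : ℕ) {w v : ℕ → ℝ} (hw : ∀ p, p.Prime → 0 ≤ w p)
    (hv : ∀ p, p.Prime → 0 ≤ v p) :
    ∑ n ∈ Finset.Ico 1 M, sqf (fun p => w p + v p) n
      ≤ (∑ n ∈ Finset.Ico 1 M, sqf w n) * ∑ n ∈ Finset.Ico 1 M, sqf v n := by
  have := sum_sqf_add M w v (fun n => if n < M then 1 else 0)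
    (fun n h => by simp [not_lt.2 h])
  have h2 : ∑ n ∈ Finset.Ico 1 M, sqf (fun p => w p + v p) n
      = ∑ n ∈ Finset.Ico 1 M, sqf (fun p => w p + v p) n * (if n < M then 1 else 0) :=
    Finset.sum_congr rfl fun n hn => by simp [(Finset.mem_Ico.1 hn).2]
  rw [h2, this, Finset.sum_mul_sum]
  refine Finset.sum_le_sum fun e _ => Finset.sum_le_sum fun t _ => ?_
  have h3 : sqf (awayFrom e v) t ≤ sqf v t :=
    sqf_le_sqf (fun p hp => awayFrom_nonneg (hv p hp)) (fun p hp => awayFrom_le (hv p hp)) t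
  have h4 := sqf_nonneg hw e
  have h5 : 0 ≤ sqf (awayFrom e v) t := sqf_nonneg (fun p hp => awayFrom_nonneg (hv p hp)) t
  have h6 := mul_le_mul_of_nonneg_left h3 h4
  split_ifs
  · simpa using h6
  · simpa using (mul_nonneg h4 h5).trans h6

/-- A squarefree number is determined by its set of primes, so the sum is part of the expansion of
the product over subsets of `T`. -/
theorem sum_sqf_le_prod (S T : Finset ℕ) {w : ℕ → ℝ} (hw : ∀ p, p.Prime → 0 ≤ w p)
    (hT : ∀ p ∈ T, p.Prime) (hST : ∀ n ∈ S, Squarefree n → n.primeFactors ⊆ T) :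
    ∑ n ∈ S, sqf w n ≤ ∏ p ∈ T, (1 + w p) := by
  rw [Finset.prod_one_add]
  rw [← Finset.sum_filter_of_ne (p := fun n : ℕ => Squarefree n)
    (fun n _ h => by by_contra h'; exact h (sqf_of_not_squarefree _ h'))]
  have : ∀ n ∈ S.filter (fun n : ℕ => Squarefree n), sqf w n = ∏ p ∈ n.primeFactors, w p :=
    fun n hn => sqf_of_squarefree _ (Finset.mem_filter.1 hn).2
  rw [Finset.sum_congr rfl this]
  rw [← Finset.sum_image (g := fun n : ℕ => n.primeFactors) (f := fun t => ∏ p ∈ t, w p)]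
  · refine Finset.sum_le_sum_of_subset_of_nonneg ?_ ?_
    · intro t ht
      obtain ⟨n, hn, rfl⟩ := Finset.mem_image.1 ht
      exact Finset.mem_powerset.2 (hST n (Finset.mem_filter.1 hn).1 (Finset.mem_filter.1 hn).2)
    · intro t ht _
      exact Finset.prod_nonneg fun p hp => hw p (hT p (Finset.mem_powerset.1 ht hp))
  · intro a ha b hb hab
    have ha' := (Finset.mem_filter.1 ha).2
    have hb' := (Finset.mem_filter.1 hb).2
    rw [← Nat.prod_primeFactors_of_squarefree ha', ← Nat.prod_primeFactors_of_squarefree hb']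
    simp only at hab
    rw [hab]

theorem prod_one_add_le_exp (T : Finset ℕ) {w : ℕ → ℝ} (hw : ∀ p ∈ T, 0 ≤ w p) :
    ∏ p ∈ T, (1 + w p) ≤ Real.exp (∑ p ∈ T, w p) := by
  rw [Real.exp_sum]
  exact Finset.prod_le_prod (fun p hp => by linarith [hw p hp])
    fun p _ => by linarith [Real.add_one_le_exp (w p)]

theorem summable_three_halves : Summable (fun n : ℕ => (n : ℝ) ^ (-(3 / 2) : ℝ)) :=
  Real.summable_nat_rpow.2 (by norm_num)

/-- The majorant is κ copies of 1/p plus a weight with a convergent sum. By `sum_sqf_add_le` each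
copy costs one harmonic sum, at most 1 + log x, and the convergent part costs the constant. -/
theorem sum_sqf_le (κ : ℕ) (A : ℝ) (hA : 0 ≤ A) : ∃ C : ℝ, 1 ≤ C ∧ ∀ w : ℕ → ℝ,
    (∀ p, p.Prime → 0 ≤ w p) →
    (∀ p, p.Prime → w p ≤ κ / p + A * (p : ℝ) ^ (-(3 / 2) : ℝ)) →
    ∀ x : ℝ, 1 ≤ x → ∀ S : Finset ℕ, (∀ n ∈ S, 1 ≤ n ∧ (n : ℝ) ≤ x) →
    ∑ n ∈ S, sqf w n ≤ C * (1 + Real.log x) ^ κ := by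
  refine ⟨Real.exp (A * ∑' n : ℕ, (n : ℝ) ^ (-(3 / 2) : ℝ)), Real.one_le_exp
    (mul_nonneg hA (tsum_nonneg fun n => by positivity)), ?_⟩
  intro w hw hw' x hx S hS
  set B : ℕ → ℝ := fun p => A * (p : ℝ) ^ (-(3 / 2) : ℝ)
  have hB : ∀ p, 0 ≤ B p := fun p => by positivity
  set M := ⌊x⌋₊ + 1
  have hSM : S ⊆ Finset.Ico 1 M := fun n hn => by
    rw [Finset.mem_Ico]
    exact ⟨(hS n hn).1, Nat.lt_succ_of_le (Nat.le_floor (hS n hn).2)⟩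
  have hharm : ∑ n ∈ Finset.Ico 1 M, 1 / (n : ℝ) ≤ 1 + Real.log x := by
    have := harmonic_floor_le_one_add_log x hx
    rw [harmonic_eq_sum_Icc] at this
    push_cast at this
    simpa [M, Finset.Ico_add_one_right_eq_Icc] using this
  have key : ∀ j : ℕ, ∑ n ∈ Finset.Ico 1 M, sqf (fun p => j / (p : ℝ) + B p) n
      ≤ (1 + Real.log x) ^ j * Real.exp (A * ∑' n : ℕ, (n : ℝ) ^ (-(3 / 2) : ℝ)) := by
    intro j
    induction j with
    | zero =>
      simp only [Nat.cast_zero, zero_div, zero_add, pow_zero, one_mul]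
      refine (sum_sqf_le_prod _ ((Finset.Ico 1 M).filter Nat.Prime) (fun p _ => hB p)
        (fun p hp => (Finset.mem_filter.1 hp).2) ?_).trans
        ((prod_one_add_le_exp _ fun p _ => hB p).trans ?_)
      · intro n hn _ p hp
        rw [Finset.mem_Ico] at hn
        rw [Finset.mem_filter, Finset.mem_Ico]
        have h1 := Nat.prime_of_mem_primeFactors hp
        exact ⟨⟨h1.one_le, lt_of_le_of_lt
          (Nat.le_of_dvd hn.1 (Nat.dvd_of_mem_primeFactors hp)) hn.2⟩, h1⟩
      · refine Real.exp_le_exp.2 ?_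
        rw [← Finset.mul_sum]
        exact mul_le_mul_of_nonneg_left
          (summable_three_halves.sum_le_tsum _ fun n _ => by positivity) hA
    | succ j ih =>
      have h1 : (fun p : ℕ => ((j + 1 : ℕ) : ℝ) / (p : ℝ) + B p)
          = fun p : ℕ => 1 / (p : ℝ) + (j / (p : ℝ) + B p) := by
        funext p; push_cast; ring
      rw [h1]
      refine (sum_sqf_add_le M (w := fun p => 1 / (p : ℝ)) (v := fun p => j / (p : ℝ) + B p)
        (fun p _ => by positivity) (fun p _ => add_nonneg (by positivity) (hB p))).trans ?_
      rw [pow_succ', mul_assoc]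
      refine mul_le_mul ((Finset.sum_le_sum fun n _ => sqf_inv_le n).trans hharm) ih ?_ ?_
      · exact Finset.sum_nonneg fun n _ => sqf_nonneg
          (fun p _ => add_nonneg (by positivity) (hB p)) n
      · have := Real.log_nonneg hx; linarith
  calc ∑ n ∈ S, sqf w n ≤ ∑ n ∈ Finset.Ico 1 M, sqf w n :=
        Finset.sum_le_sum_of_subset_of_nonneg hSM fun n _ _ => sqf_nonneg hw n
    _ ≤ ∑ n ∈ Finset.Ico 1 M, sqf (fun p => κ / (p : ℝ) + B p) n :=
        Finset.sum_le_sum fun n _ => sqf_le_sqf hw hw' n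
    _ ≤ _ := by rw [mul_comm]; exact key κ

/-! ### Mertens' first theorem. -/

theorem log_div_sq_le (n : ℕ) : Real.log n / (n : ℝ) ^ 2 ≤ 2 * (n : ℝ) ^ (-(3 / 2) : ℝ) := by
  rcases Nat.eq_zero_or_pos n with rfl | hn
  · simp
  have hn' : (0 : ℝ) < n := by exact_mod_cast hn
  rw [div_le_iff₀ (by positivity)]
  have h := Real.log_le_rpow_div hn'.le (ε := 1 / 2) (by norm_num)
  have : (n : ℝ) ^ (-(3 / 2) : ℝ) * (n : ℝ) ^ 2 = (n : ℝ) ^ (1 / 2 : ℝ) := by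
    rw [← Real.rpow_natCast (n : ℝ) 2, ← Real.rpow_add hn']
    norm_num
  rw [mul_assoc, this]
  linarith

theorem sum_log_div_sq_le (S : Finset ℕ) :
    ∑ n ∈ S, Real.log n / (n : ℝ) ^ 2 ≤ 2 * ∑' n : ℕ, (n : ℝ) ^ (-(3 / 2) : ℝ) :=
  calc _ ≤ ∑ n ∈ S, 2 * (n : ℝ) ^ (-(3 / 2) : ℝ) := Finset.sum_le_sum fun n _ => log_div_sq_le n
    _ = 2 * ∑ n ∈ S, (n : ℝ) ^ (-(3 / 2) : ℝ) := by rw [Finset.mul_sum]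
    _ ≤ _ := by
      refine mul_le_mul_of_nonneg_left ?_ (by norm_num)
      exact summable_three_halves.sum_le_tsum _ fun n _ => by positivity

theorem log_factorial_eq (n : ℕ) : Real.log (n.factorial : ℝ)
    = ∑ p ∈ (Finset.Icc 1 n).filter Nat.Prime, (n.factorial.factorization p : ℝ) * Real.log p := by
  have hn := Nat.factorial_ne_zero n
  conv_lhs => rw [← Nat.prod_factorization_pow_eq_self hn]
  rw [Finsupp.prod, Nat.cast_prod, Real.log_prod]
  · rw [Nat.support_factorization]
    have : n.factorial.primeFactors ⊆ (Finset.Icc 1 n).filter Nat.Prime := fun p hp => by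
      have hp' := Nat.prime_of_mem_primeFactors hp
      rw [Finset.mem_filter, Finset.mem_Icc]
      exact ⟨⟨hp'.one_le, (hp'.dvd_factorial).1 (Nat.dvd_of_mem_primeFactors hp)⟩, hp'⟩
    rw [← Finset.sum_subset this]
    · refine Finset.sum_congr rfl fun p _ => ?_
      rw [Nat.cast_pow, Real.log_pow]
    · intro p _ hp
      rw [← Nat.support_factorization, Finsupp.notMem_support_iff] at hp
      simp [hp]
  · intro p hp
    have := (Nat.prime_of_mem_primeFactors (by rwa [Nat.support_factorization] at hp)).pos
    positivity

theorem factorization_factorial_bounds {p : ℕ} (hp : p.Prime) (n : ℕ) :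
    (n : ℝ) / p - 1 ≤ n.factorial.factorization p ∧
      (n.factorial.factorization p : ℝ) ≤ n / (p - 1) := by
  have := Fact.mk hp
  have hp1 : (1 : ℝ) < p := by exact_mod_cast hp.one_lt
  constructor
  · have h1 : n / p ≤ n.factorial.factorization p := by
      rw [← hp.pow_dvd_iff_le_factorization (Nat.factorial_ne_zero n)]
      -- Only the multiples of p itself are counted; higher powers are not needed for the lower
      -- bound.
      have h2 : p ^ (n / p) ∣ (p * (n / p)).factorial := by
        have := (hp.pow_dvd_factorial_iff (n := p * (n / p)) (r := n / p)
          (b := Nat.log p (p * (n / p)) + 2) (by omega)).2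
        refine this ?_
        refine (le_of_eq ?_).trans (Finset.single_le_sum (f := fun i => p * (n / p) / p ^ i)
          (fun i _ => Nat.zero_le _) (Finset.mem_Ico.2 ⟨le_refl 1, by omega⟩))
        simp [Nat.mul_div_cancel_left _ hp.pos]
      exact h2.trans (Nat.factorial_dvd_factorial (Nat.mul_div_le n p))
    have h3 : (n : ℝ) / p < (n / p : ℕ) + 1 := by
      rw [div_lt_iff₀ (by linarith), mul_comm]
      exact_mod_cast Nat.lt_mul_div_succ n hp.pos
    have h4 : ((n / p : ℕ) : ℝ) ≤ n.factorial.factorization p := by exact_mod_cast h1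
    linarith
  · rw [le_div_iff₀ (by linarith), Nat.factorization_def _ hp]
    have h := sub_one_mul_padicValNat_factorial (p := p) n
    have h5 : (p - 1) * padicValNat p n.factorial ≤ n := by rw [h]; exact Nat.sub_le _ _
    have h6 : (((p - 1) * padicValNat p n.factorial : ℕ) : ℝ) ≤ n := by exact_mod_cast h5
    push_cast [Nat.cast_sub hp.one_le] at h6
    linarith

/-- Mertens' first theorem. -/
theorem exists_mertens : ∃ C : ℝ, 0 ≤ C ∧ ∀ y : ℝ, 1 ≤ y →
    |∑ p ∈ (Finset.Icc 1 ⌊y⌋₊).filter Nat.Prime, Real.log p / p - Real.log y| ≤ C := by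
  set D : ℝ := 2 * ∑' n : ℕ, (n : ℝ) ^ (-(3 / 2) : ℝ)
  have hD : 0 ≤ D := mul_nonneg (by norm_num) (tsum_nonneg fun n => by positivity)
  have hl4 : 0 ≤ Real.log 4 := Real.log_nonneg (by norm_num)
  have hl2 : 0 ≤ Real.log 2 := Real.log_nonneg (by norm_num)
  refine ⟨Real.log 4 + 1 + 2 * D + Real.log 2, by linarith, ?_⟩
  intro y hy
  set n := ⌊y⌋₊
  have hn1 : 1 ≤ n := Nat.le_floor (by simpa using hy)
  have hn : (1 : ℝ) ≤ n := by exact_mod_cast hn1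
  have hn0 : (0 : ℝ) < n := by linarith
  set P := (Finset.Icc 1 n).filter Nat.Prime
  have hP : ∀ p ∈ P, p.Prime := fun p hp => (Finset.mem_filter.1 hp).2
  set s := ∑ p ∈ P, Real.log p / p
  have hny : (n : ℝ) ≤ y := Nat.floor_le (by linarith)
  have hyn : y ≤ 2 * n := by have := Nat.lt_floor_add_one y; linarith
  have hlog1 : Real.log n ≤ Real.log y := Real.log_le_log hn0 hny
  have hlog2 : Real.log y ≤ Real.log n + Real.log 2 := by
    rw [add_comm, ← Real.log_mul (by norm_num) hn0.ne']
    exact Real.log_le_log (by linarith) hyn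
  -- Each exponent of p in n! is at least n/p - 1. The loss is θ(n), which Chebyshev's bound
  -- controls, and log n! ≤ n log n.
  have hup : n * s - Real.log 4 * n ≤ n * Real.log n := by
    have h1 : Real.log (n.factorial : ℝ) ≤ n * Real.log n := by
      rw [← Real.log_pow]
      refine Real.log_le_log (by exact_mod_cast Nat.factorial_pos n) ?_
      exact_mod_cast Nat.factorial_le_pow n
    have h2 : ∑ p ∈ P, Real.log p ≤ Real.log 4 * n := by
      have := Chebyshev.theta_le_log4_mul_x hn0.le
      rw [Chebyshev.theta_eq_sum_Icc, Nat.floor_natCast] at this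
      refine le_trans (Finset.sum_le_sum_of_subset_of_nonneg ?_ ?_) this
      · intro p hp
        simp only [P, Finset.mem_filter, Finset.mem_Icc] at hp ⊢
        exact ⟨⟨by omega, hp.1.2⟩, hp.2⟩
      · intro p _ _; exact Real.log_natCast_nonneg p
    rw [log_factorial_eq] at h1
    have h3 : n * s - ∑ p ∈ P, Real.log p
        ≤ ∑ p ∈ P, (n.factorial.factorization p : ℝ) * Real.log p := by
      rw [Finset.mul_sum, ← Finset.sum_sub_distrib]
      refine Finset.sum_le_sum fun p hp => ?_
      have := mul_le_mul_of_nonneg_right (factorization_factorial_bounds (hP p hp) n).1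
        (Real.log_natCast_nonneg p)
      refine le_trans (le_of_eq ?_) this
      ring
    linarith
  -- The term n^n/n! of the exponential series is at most e^n, and each exponent is at most n/(p -
  -- 1), where 1/(p - 1) ≤ 1/p + 2/p².
  have hlow : n * Real.log n - n ≤ n * (s + 2 * D) := by
    have h1 : n * Real.log n - n ≤ Real.log (n.factorial : ℝ) := by
      have := Real.pow_div_factorial_le_exp (n : ℝ) hn0.le n
      have hf : (0 : ℝ) < n.factorial := by exact_mod_cast Nat.factorial_pos n
      have h2 := Real.log_le_log (by positivity) this
      rw [Real.log_exp, Real.log_div (by positivity) hf.ne', Real.log_pow] at h2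
      linarith
    rw [log_factorial_eq] at h1
    refine h1.trans ?_
    have h3 : ∑ p ∈ P, Real.log p / (p : ℝ) ^ 2 ≤ D := sum_log_div_sq_le P
    have h4 : ∑ p ∈ P, (n.factorial.factorization p : ℝ) * Real.log p
        ≤ ∑ p ∈ P, n * (Real.log p / p + 2 * (Real.log p / (p : ℝ) ^ 2)) := by
      refine Finset.sum_le_sum fun p hp => ?_
      have h5 := mul_le_mul_of_nonneg_right (factorization_factorial_bounds (hP p hp) n).2
        (Real.log_natCast_nonneg p)
      refine h5.trans ?_
      have hp2 : (2 : ℝ) ≤ p := by exact_mod_cast (hP p hp).two_le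
      have h6 : (1 : ℝ) / (p - 1) ≤ 1 / p + 2 / (p : ℝ) ^ 2 := by
        rw [div_add_div _ _ (by positivity) (by positivity), div_le_div_iff₀ (by linarith) (by positivity)]
        nlinarith
      have h7 := mul_le_mul_of_nonneg_left h6
        (mul_nonneg hn0.le (Real.log_natCast_nonneg p))
      refine le_trans (le_of_eq ?_) (h7.trans (le_of_eq ?_)) <;> ring
    refine h4.trans ?_
    rw [← Finset.mul_sum, Finset.sum_add_distrib, ← Finset.mul_sum]
    refine mul_le_mul_of_nonneg_left ?_ hn0.le
    linarith
  have h1 : s ≤ Real.log n + Real.log 4 := by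
    refine le_of_mul_le_mul_left ?_ hn0
    linarith
  have h2 : Real.log n - 1 ≤ s + 2 * D := by
    refine le_of_mul_le_mul_left ?_ hn0
    linarith
  rw [abs_le]
  constructor <;> linarith

/-! ### Sieve weights of dimension κ and a relation for their summatory functions. -/

/-- A nonnegative weight on the primes that is close to `κ / p`, with discrepancy at most `L`. -/
structure IsSieveWeight (κ : ℕ) (A L : ℝ) (h : ℕ → ℝ) : Prop where
  nonneg : ∀ p, p.Prime → 0 ≤ h p
  le : ∀ p, p.Prime → h p ≤ κ / p + A * (p : ℝ) ^ (-(3 / 2) : ℝ)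
  sum_le : ∀ S : Finset ℕ, (∀ p ∈ S, p.Prime) → ∑ p ∈ S, |h p - κ / p| * Real.log p ≤ L
  one_le : 1 ≤ L

/-- Mertens' theorem for κ/p, plus the discrepancy. Here and below constants are fixed before `L`
and `h`: `A` will be uniform over tuples of a given size, and finer dependence on the tuple enters
only as a factor `L`. -/
theorem exists_sum_weight_mul_log (κ : ℕ) : ∃ C : ℝ, 1 ≤ C ∧ ∀ (A L : ℝ) (h : ℕ → ℝ),
    IsSieveWeight κ A L h → ∀ y : ℝ, 1 ≤ y →
    |∑ p ∈ (Finset.Icc 1 ⌊y⌋₊).filter Nat.Prime, h p * Real.log p - κ * Real.log y| ≤ C * L := by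
  obtain ⟨D, hD, hM⟩ := exists_mertens
  refine ⟨1 + κ * D, by nlinarith [Nat.cast_nonneg (α := ℝ) κ], ?_⟩
  intro A L h hh y hy
  set P := (Finset.Icc 1 ⌊y⌋₊).filter Nat.Prime
  have h1 : ∑ p ∈ P, h p * Real.log p - κ * Real.log y
      = ∑ p ∈ P, (h p - κ / p) * Real.log p
        + κ * (∑ p ∈ P, Real.log p / p - Real.log y) := by
    rw [mul_sub, Finset.mul_sum, add_sub_assoc', ← Finset.sum_add_distrib]
    congr 1
    exact Finset.sum_congr rfl fun p _ => by ring
  have h2 : |∑ p ∈ P, (h p - κ / p) * Real.log p| ≤ L := by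
    refine (Finset.abs_sum_le_sum_abs _ _).trans
      (le_trans (le_of_eq ?_) (hh.sum_le P fun p hp => (Finset.mem_filter.1 hp).2))
    refine Finset.sum_congr rfl fun p _ => ?_
    rw [abs_mul, abs_of_nonneg (Real.log_natCast_nonneg p)]
  have h3 : |(κ : ℝ) * (∑ p ∈ P, Real.log p / p - Real.log y)| ≤ κ * D := by
    rw [abs_mul, Nat.abs_cast]
    exact mul_le_mul_of_nonneg_left (hM y hy) (Nat.cast_nonneg _)
  rw [h1]
  refine (abs_add_le _ _).trans ?_
  have h4 : (κ : ℝ) * D ≤ κ * D * L :=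
    le_mul_of_one_le_right (mul_nonneg (Nat.cast_nonneg _) hD) hh.one_le
  linarith

theorem IsSieveWeight.le_div {κ : ℕ} {A L : ℝ} {h : ℕ → ℝ} (hh : IsSieveWeight κ A L h)
    (hA : 0 ≤ A) {p : ℕ} (hp : p.Prime) : h p ≤ (κ + A) / p := by
  refine (hh.le p hp).trans ?_
  rw [add_div]
  have hp1 : (1 : ℝ) ≤ p := by exact_mod_cast hp.one_le
  have : (p : ℝ) ^ (-(3 / 2) : ℝ) ≤ (p : ℝ) ^ (-1 : ℝ) :=
    Real.rpow_le_rpow_of_exponent_le hp1 (by norm_num)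
  rw [Real.rpow_neg_one] at this
  have := mul_le_mul_of_nonneg_left this hA
  rw [div_eq_mul_inv A]
  linarith

theorem log_eq_sum_primeFactors {n : ℕ} (hn : Squarefree n) :
    Real.log n = ∑ d ∈ n.divisors, if d.Prime then Real.log d else 0 := by
  rw [← Finset.sum_filter]
  have : n.divisors.filter Nat.Prime = n.primeFactors := by
    ext p
    simp only [Finset.mem_filter, Nat.mem_divisors, Nat.mem_primeFactors]
    tauto
  rw [this]
  conv_lhs => rw [← Nat.prod_primeFactors_of_squarefree hn]
  rw [Nat.cast_prod, Real.log_prod]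
  intro p hp
  exact_mod_cast (Nat.prime_of_mem_primeFactors hp).ne_zero

/-- For squarefree n, log n is the sum of log p over p ∣ n; splitting off p leaves a cofactor prime
to p. -/
theorem sqf_mul_log (h : ℕ → ℝ) (n : ℕ) :
    sqf h n * Real.log n = ∑ x ∈ n.divisorsAntidiagonal,
      (if x.1.Prime then h x.1 * Real.log x.1 else 0) * sqf (awayFrom x.1 h) x.2 := by
  have h1 : ∀ x ∈ n.divisorsAntidiagonal,
      (if x.1.Prime then h x.1 * Real.log x.1 else 0) * sqf (awayFrom x.1 h) x.2
        = sqf h n * if x.1.Prime then Real.log x.1 else 0 := by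
    intro x hx
    obtain ⟨rfl, _⟩ := Nat.mem_divisorsAntidiagonal.1 hx
    split_ifs with hp
    · rw [sqf_mul, sqf_prime _ hp]; ring
    · simp
  rw [Finset.sum_congr rfl h1, ← Finset.mul_sum,
    Nat.sum_divisorsAntidiagonal (f := fun d _ => if d.Prime then Real.log d else 0)]
  by_cases hn : Squarefree n
  · rw [← log_eq_sum_primeFactors hn]
  · simp [sqf_of_not_squarefree _ hn]

/-- With G(x) = ∑ h(n) and T(x) = ∑ h(n) log(x/n), evaluate ∑ h(n) log n twice. It is G log x - T.
It is also ∑_m h(m) ∑_{p ≤ x/m, p ∤ m} h(p) log p, where weighted Mertens gives κ log(x/m) + O(L)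
for the inner sum once the condition p ∤ m is dropped. As T is the integral of G in log x, this is a
differential relation. -/
theorem exists_sum_mul_log_bound (κ : ℕ) (A : ℝ) (hA : 0 ≤ A) : ∃ C : ℝ, 1 ≤ C ∧
    ∀ (L : ℝ) (h : ℕ → ℝ), IsSieveWeight κ A L h → ∀ x : ℝ, 1 ≤ x →
    |(∑ n ∈ Finset.Icc 1 ⌊x⌋₊, sqf h n) * Real.log x
      - (κ + 1) * ∑ n ∈ Finset.Icc 1 ⌊x⌋₊, sqf h n * Real.log (x / n)|
      ≤ C * L * ∑ n ∈ Finset.Icc 1 ⌊x⌋₊, sqf h n := by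
  obtain ⟨C₁, hC₁, hlog⟩ := exists_sum_weight_mul_log κ
  set Z : ℝ := 2 * ∑' n : ℕ, (n : ℝ) ^ (-(3 / 2) : ℝ)
  have hZ : 0 ≤ Z := mul_nonneg (by norm_num) (tsum_nonneg fun n => by positivity)
  refine ⟨C₁ + (κ + A) ^ 2 * Z, by nlinarith [sq_nonneg ((κ : ℝ) + A), mul_nonneg (sq_nonneg ((κ : ℝ) + A)) hZ], ?_⟩
  intro L h hh x hx
  set M := ⌊x⌋₊ + 1
  have hIcc : Finset.Icc 1 ⌊x⌋₊ = Finset.Ico 1 M := by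
    simp [M, Finset.Ico_add_one_right_eq_Icc]
  rw [hIcc]
  set S := Finset.Ico 1 M
  set G := ∑ n ∈ S, sqf h n
  have hsq : ∀ n, 0 ≤ sqf h n := sqf_nonneg hh.nonneg
  have hG : 0 ≤ G := Finset.sum_nonneg fun n _ => hsq n
  set q : ℕ → ℝ := fun p => if p.Prime then h p * Real.log p else 0
  have hq : ∀ p, 0 ≤ q p := fun p => by
    simp only [q]
    split_ifs with hp
    · exact mul_nonneg (hh.nonneg p hp) (Real.log_natCast_nonneg p)
    · exact le_rfl
  have hx0 : (0 : ℝ) < x := by linarith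
  have hS : ∀ n ∈ S, 1 ≤ n ∧ (n : ℝ) ≤ x := fun n hn => by
    have := Finset.mem_Ico.1 hn
    exact ⟨this.1, (Nat.le_floor_iff hx0.le).1 (Nat.lt_succ_iff.1 this.2)⟩
  have e1 : ∑ n ∈ S, sqf h n * Real.log n
      = ∑ m ∈ S, ∑ p ∈ S, if p * m < M then q p * sqf (awayFrom p h) m else 0 := by
    rw [Finset.sum_comm, ← sum_divisorsAntidiagonal_Ico M
      (fun p m => if p * m < M then q p * sqf (awayFrom p h) m else 0)
      (fun e t het => by simp [not_lt.2 het])]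
    refine Finset.sum_congr rfl fun n hn => ?_
    rw [sqf_mul_log]
    refine Finset.sum_congr rfl fun y hy => ?_
    obtain ⟨hy1, _⟩ := Nat.mem_divisorsAntidiagonal.1 hy
    rw [hy1, if_pos (Finset.mem_Ico.1 hn).2]
  -- The contribution of p ∣ m, added when the coprimality condition is dropped.
  set E₂ := ∑ m ∈ S, ∑ p ∈ S, if p * m < M ∧ p ∣ m then q p * sqf h m else 0
  have e2 : ∑ n ∈ S, sqf h n * Real.log n
      = (∑ m ∈ S, sqf h m * ∑ p ∈ S, if p * m < M then q p else 0) - E₂ := by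
    rw [e1, ← Finset.sum_sub_distrib]
    refine Finset.sum_congr rfl fun m _ => ?_
    rw [Finset.mul_sum, ← Finset.sum_sub_distrib]
    refine Finset.sum_congr rfl fun p _ => ?_
    by_cases hp : p.Prime
    · have hc : m.Coprime p ↔ ¬ p ∣ m := by rw [Nat.coprime_comm, hp.coprime_iff_not_dvd]
      rw [sqf_awayFrom]
      by_cases h1 : p * m < M <;> by_cases h2 : p ∣ m <;> simp [h2, hc, mul_comm]
    · simp [q, hp]
  have e3 : ∀ m ∈ S, |(∑ p ∈ S, if p * m < M then q p else 0) - κ * Real.log (x / m)|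
      ≤ C₁ * L := by
    intro m hm
    have hm0 : (0 : ℝ) < m := by exact_mod_cast (hS m hm).1
    have h1 : 1 ≤ x / m := by rw [one_le_div hm0]; exact (hS m hm).2
    have := hlog A L h hh (x / m) h1
    convert this using 3
    rw [← Finset.sum_filter]
    simp only [q]
    rw [← Finset.sum_filter]
    refine Finset.sum_congr ?_ fun _ _ => rfl
    ext p
    simp only [Finset.mem_filter, S, Finset.mem_Ico, Finset.mem_Icc]
    rw [Nat.floor_div_natCast, Nat.le_div_iff_mul_le (by exact_mod_cast hm0), Nat.lt_succ_iff,
      Nat.lt_succ_iff]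
    constructor
    · rintro ⟨⟨⟨h1, _⟩, h2⟩, h3⟩; exact ⟨⟨h1, h2⟩, h3⟩
    · rintro ⟨⟨h1, h2⟩, h3⟩
      exact ⟨⟨⟨h1, le_trans (Nat.le_mul_of_pos_right p (by exact_mod_cast hm0)) h2⟩, h2⟩, h3⟩
  have hE₂0 : 0 ≤ E₂ := Finset.sum_nonneg fun m _ => Finset.sum_nonneg fun p _ => by
    split_ifs
    · exact mul_nonneg (hq p) (hsq m)
    · exact le_rfl
  have hE₂ : E₂ ≤ (κ + A) ^ 2 * Z * G := by
    -- Putting m = p e gives h(p) log p · h(p e) ≤ h(p)² log p · h(e), and h(p)² = O(1/p²) makes the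
    -- sum over p converge.
    have h1 : E₂ ≤ ∑ p ∈ S.filter Nat.Prime, (h p ^ 2 * Real.log p) * G := by
      simp only [E₂]
      rw [Finset.sum_comm, Finset.sum_filter]
      refine Finset.sum_le_sum fun p hp => ?_
      split_ifs with hpp
      · have hp0 : 0 < p := hpp.pos
        calc _ ≤ ∑ m ∈ S, if p ∣ m then q p * (if m < M then sqf h m else 0) else 0 := by
              refine Finset.sum_le_sum fun m hm => ?_
              have := (Finset.mem_Ico.1 hm).2
              by_cases h2 : p ∣ m
              · by_cases h3 : p * m < M
                · simp [h2, h3, this]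
                · simp only [h3, h2, this, false_and, if_false, if_true]
                  exact mul_nonneg (hq p) (hsq m)
              · simp [h2]
          _ = q p * ∑ e ∈ S, (if p * e < M then sqf h (p * e) else 0) := by
              rw [← Finset.sum_filter, ← Finset.mul_sum,
                sum_multiples M p hp0 _ (fun n hn => by simp [not_lt.2 hn])]
          _ ≤ q p * (h p * G) := by
              refine mul_le_mul_of_nonneg_left ?_ (hq p)
              rw [Finset.mul_sum]
              refine Finset.sum_le_sum fun e _ => ?_
              have h4 : sqf h (p * e) ≤ h p * sqf h e := by
                rw [sqf_mul, sqf_prime _ hpp]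
                refine mul_le_mul_of_nonneg_left ?_ (hh.nonneg p hpp)
                exact sqf_le_sqf (fun r hr => awayFrom_nonneg (hh.nonneg r hr))
                  (fun r hr => awayFrom_le (hh.nonneg r hr)) e
              split_ifs
              · exact h4
              · exact mul_nonneg (hh.nonneg p hpp) (hsq e)
          _ = _ := by simp only [q, if_pos hpp]; ring
      · refine le_of_eq (Finset.sum_eq_zero fun m _ => ?_)
        simp [q, hpp]
    refine h1.trans ?_
    rw [← Finset.sum_mul]
    refine mul_le_mul_of_nonneg_right ?_ hG
    calc _ ≤ ∑ p ∈ S.filter Nat.Prime, (κ + A) ^ 2 * (Real.log p / (p : ℝ) ^ 2) := by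
          refine Finset.sum_le_sum fun p hp => ?_
          have hpp := (Finset.mem_filter.1 hp).2
          have h2 := pow_le_pow_left₀ (hh.nonneg p hpp) (hh.le_div hA hpp) 2
          have h3 := mul_le_mul_of_nonneg_right h2 (Real.log_natCast_nonneg p)
          refine h3.trans (le_of_eq ?_)
          ring
      _ = (κ + A) ^ 2 * ∑ p ∈ S.filter Nat.Prime, Real.log p / (p : ℝ) ^ 2 := by
          rw [Finset.mul_sum]
      _ ≤ _ := mul_le_mul_of_nonneg_left (sum_log_div_sq_le _) (sq_nonneg _)
  have e4 : G * Real.log x - (κ + 1) * ∑ n ∈ S, sqf h n * Real.log (x / n)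
      = (∑ m ∈ S, sqf h m * ((∑ p ∈ S, if p * m < M then q p else 0) - κ * Real.log (x / m)))
        - E₂ := by
    have h1 : ∑ n ∈ S, sqf h n * Real.log (x / n)
        = G * Real.log x - ∑ n ∈ S, sqf h n * Real.log n := by
      rw [Finset.sum_mul, ← Finset.sum_sub_distrib]
      refine Finset.sum_congr rfl fun n hn => ?_
      have : (n : ℝ) ≠ 0 := by
        have := (hS n hn).1
        positivity
      rw [Real.log_div hx0.ne' this]; ring
    have h2 : ∑ m ∈ S, sqf h m * ((∑ p ∈ S, if p * m < M then q p else 0) - κ * Real.log (x / m))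
        = (∑ m ∈ S, sqf h m * ∑ p ∈ S, if p * m < M then q p else 0)
          - κ * ∑ n ∈ S, sqf h n * Real.log (x / n) := by
      rw [Finset.mul_sum, ← Finset.sum_sub_distrib]
      exact Finset.sum_congr rfl fun n hn => by ring
    rw [h2, sub_right_comm, ← e2]
    linear_combination (-1 : ℝ) * h1
  rw [e4]
  refine (abs_sub _ _).trans ?_
  rw [abs_of_nonneg hE₂0]
  have h5 : |∑ m ∈ S, sqf h m
      * ((∑ p ∈ S, if p * m < M then q p else 0) - κ * Real.log (x / m))| ≤ C₁ * L * G := by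
    refine (Finset.abs_sum_le_sum_abs _ _).trans ?_
    rw [Finset.mul_sum]
    refine Finset.sum_le_sum fun m hm => ?_
    rw [abs_mul, abs_of_nonneg (hsq m), mul_comm]
    exact mul_le_mul_of_nonneg_right (e3 m hm) (hsq m)
  have h6 : (κ + A) ^ 2 * Z * G ≤ (κ + A) ^ 2 * Z * L * G := by
    refine mul_le_mul_of_nonneg_right ?_ hG
    exact le_mul_of_one_le_right (mul_nonneg (sq_nonneg _) hZ) hh.one_le
  linarith

/-! ### Riesz means and their asymptotics with an unspecified constant. -/

/-- The hypothesis says that the derivative of t/u^(κ+1) is O(1/u²), which is integrable at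
infinity, so the quotient converges at rate O(1/u). Right derivatives are used because `g` will be a
step function. -/
theorem exists_limit_of_right_deriv {t g : ℝ → ℝ} {κ : ℕ} {E : ℝ}
    (ht : ContinuousOn t (Set.Ici 1))
    (ht' : ∀ u, 1 ≤ u → HasDerivWithinAt t (g u) (Set.Ici u) u)
    (hE : ∀ u, 1 ≤ u → |u * g u - (κ + 1) * t u| ≤ E * (1 + u) ^ κ) :
    ∃ c : ℝ, ∀ u, 1 ≤ u → |t u - c * u ^ (κ + 1)| ≤ E * 2 ^ κ * u ^ κ := by
  set K := E * 2 ^ κ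
  have hK : 0 ≤ K := by
    have h1 := (abs_nonneg _).trans (hE 1 le_rfl)
    norm_num at h1
    exact mul_nonneg h1 (by positivity)
  set F : ℝ → ℝ := fun u => t u / u ^ (κ + 1)
  set F' : ℝ → ℝ := fun u => (g u * u ^ (κ + 1) - t u * ((κ + 1 : ℕ) * u ^ κ)) / (u ^ (κ + 1)) ^ 2
  have hF' : ∀ u, 1 ≤ u → HasDerivWithinAt F (F' u) (Set.Ici u) u := by
    intro u hu
    have h1 : u ≠ 0 := by positivity
    have h2 := (hasDerivAt_pow (κ + 1) u).hasDerivWithinAt (s := Set.Ici u)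
    exact (ht' u hu).div h2 (pow_ne_zero _ h1)
  have hbd : ∀ u, 1 ≤ u → |F' u| ≤ K / u ^ 2 := by
    intro u hu
    have hu0 : 0 < u := by linarith
    have h1 : F' u = (u * g u - (κ + 1) * t u) / u ^ (κ + 2) := by
      simp only [F']
      rw [div_eq_div_iff (by positivity) (by positivity)]
      push_cast
      ring
    rw [h1, abs_div, abs_of_pos (pow_pos hu0 (κ + 2)), div_le_div_iff₀ (by positivity) (by positivity)]
    have hE0 : 0 ≤ E := by
      have h2 := (abs_nonneg _).trans (hE u hu)
      exact nonneg_of_mul_nonneg_left h2 (by positivity)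
    have h3 : E * (1 + u) ^ κ ≤ K * u ^ κ := by
      have : (1 + u) ^ κ ≤ (2 * u) ^ κ := pow_le_pow_left₀ (by linarith) (by linarith) κ
      rw [mul_pow] at this
      calc _ ≤ E * (2 ^ κ * u ^ κ) := mul_le_mul_of_nonneg_left this hE0
        _ = _ := by ring
    calc _ ≤ (K * u ^ κ) * u ^ 2 := mul_le_mul_of_nonneg_right ((hE u hu).trans h3) (by positivity)
      _ = _ := by ring
  have hmain : ∀ a b, 1 ≤ a → a ≤ b → |F b - F a| ≤ K / a := by
    intro a b ha hab
    have ha0 : 0 < a := by linarith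
    have hcont : ContinuousOn F (Set.Icc a b) := by
      refine ContinuousOn.div (ht.mono fun x hx => le_trans ha hx.1) (continuousOn_pow _) ?_
      intro x hx
      have : 0 < x := lt_of_lt_of_le ha0 hx.1
      positivity
    -- The comparison function K(1/a - 1/x) is the integral of the derivative bound K/x² from a.
    have hB : ∀ x, 0 < x → HasDerivAt (fun x => K * (1 / a - x⁻¹)) (K / x ^ 2) x := by
      intro x hx
      have h1 := ((hasDerivAt_inv hx.ne').const_sub (1 / a)).const_mul K
      refine h1.congr_deriv ?_
      field_simp
    have h2 := image_norm_le_of_norm_deriv_right_le_deriv_boundary'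
      (f := fun x => F x - F a) (f' := F') (a := a) (b := b)
      (B := fun x => K * (1 / a - x⁻¹)) (B' := fun x => K / x ^ 2)
      (hcont.sub continuousOn_const)
      (fun x hx => (hF' x (le_trans ha hx.1)).sub_const _)
      (by simp)
      (fun x hx => (hB x (lt_of_lt_of_le ha0 hx.1)).continuousAt.continuousWithinAt)
      (fun x hx => (hB x (lt_of_lt_of_le ha0 hx.1)).hasDerivWithinAt)
      (fun x hx => by rw [Real.norm_eq_abs]; exact hbd x (le_trans ha hx.1))
      (Set.right_mem_Icc.2 hab)
    rw [Real.norm_eq_abs] at h2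
    refine h2.trans ?_
    have : 0 < b := by linarith
    have h3 : 0 ≤ K * b⁻¹ := by positivity
    have h4 : K / a = K * (1 / a) := by ring
    rw [h4, mul_sub]
    linarith
  have hcauchy : CauchySeq F := by
    rw [Metric.cauchySeq_iff']
    intro ε hε
    refine ⟨max 1 (K / ε + 1), fun n hn => ?_⟩
    set a := max 1 (K / ε + 1)
    have ha : 1 ≤ a := le_max_left _ _
    have ha2 : K / ε + 1 ≤ a := le_max_right _ _
    rw [Real.dist_eq]
    refine (hmain a n ha hn).trans_lt ?_
    rw [div_lt_iff₀ (by linarith)]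
    have : K < a * ε := by
      rw [← div_lt_iff₀ hε]; linarith
    linarith
  obtain ⟨c, hc⟩ := cauchySeq_tendsto_of_complete hcauchy
  refine ⟨c, fun u hu => ?_⟩
  have hu0 : 0 < u := by linarith
  have h1 : |c - F u| ≤ K / u := by
    have h2 : Tendsto (fun b => |F b - F u|) atTop (𝓝 |c - F u|) := (hc.sub_const _).abs
    exact le_of_tendsto h2 ((eventually_ge_atTop u).mono fun b hb => hmain u b hu hb)
  have h3 : t u - c * u ^ (κ + 1) = (F u - c) * u ^ (κ + 1) := by
    simp only [F]
    field_simp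
  rw [h3, abs_mul, abs_sub_comm, abs_of_pos (pow_pos hu0 _)]
  calc _ ≤ K / u * u ^ (κ + 1) := mul_le_mul_of_nonneg_right h1 (by positivity)
    _ = _ := by rw [pow_succ]; field_simp

/-- The truncated monomial `(u - c)₊ ^ M / M!` (right-continuous for `M = 0`). -/
def truncMonomial (M : ℕ) (c u : ℝ) : ℝ := if c ≤ u then (u - c) ^ M / (M.factorial : ℝ) else 0

theorem hasDerivWithinAt_truncMonomial (M : ℕ) (c u : ℝ) :
    HasDerivWithinAt (truncMonomial (M + 1) c) (truncMonomial M c u) (Set.Ici u) u := by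
  by_cases h : c ≤ u
  · have h1 : HasDerivWithinAt (fun u => (u - c) ^ (M + 1) / ((M + 1).factorial : ℝ))
        (truncMonomial M c u) (Set.Ici u) u := by
      have h2 := (((hasDerivAt_id u).sub_const c).pow (M + 1)).div_const ((M + 1).factorial : ℝ)
      refine (h2.congr_deriv ?_).hasDerivWithinAt
      have : (M.factorial : ℝ) ≠ 0 := by positivity
      rw [truncMonomial, if_pos h, Nat.factorial_succ]
      push_cast
      simp
      field_simp
    refine h1.congr (fun v hv => ?_) ?_
    · rw [truncMonomial, if_pos (h.trans hv)]
    · rw [truncMonomial, if_pos h]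
  · have h1 : truncMonomial (M + 1) c =ᶠ[𝓝 u] fun _ => 0 := by
      filter_upwards [Iio_mem_nhds (not_le.1 h)] with v hv
      rw [truncMonomial, if_neg (not_le.2 hv)]
    have h2 : truncMonomial M c u = 0 := by rw [truncMonomial, if_neg h]
    rw [h2]
    exact ((hasDerivAt_const u (0 : ℝ)).congr_of_eventuallyEq h1).hasDerivWithinAt

theorem continuous_truncMonomial (M : ℕ) (c : ℝ) : Continuous (truncMonomial (M + 1) c) := by
  have : truncMonomial (M + 1) c = fun u => (max (u - c) 0) ^ (M + 1) / ((M + 1).factorial : ℝ) := by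
    funext u
    unfold truncMonomial
    split_ifs with h
    · rw [max_eq_left (by linarith)]
    · rw [max_eq_right (by linarith)]; simp
  rw [this]
  fun_prop

/-- The Riesz mean `∑_{n ≤ e ^ u} a n (u - log n) ^ M / M!`. -/
def rieszMean (a : ℕ → ℝ) (M : ℕ) (u : ℝ) : ℝ :=
  ∑ n ∈ Finset.Icc 1 ⌊Real.exp u⌋₊, a n * ((u - Real.log n) ^ M / (M.factorial : ℝ))

/-- Moving the truncation into the summands fixes the index set for all u ≤ U, so limits and
derivatives can be taken term by term. -/
theorem rieszMean_eq (a : ℕ → ℝ) (M : ℕ) {u U : ℝ} (h : u ≤ U) :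
    rieszMean a M u = ∑ n ∈ Finset.Icc 1 ⌊Real.exp U⌋₊, a n * truncMonomial M (Real.log n) u := by
  unfold rieszMean truncMonomial
  have h1 : ∀ n : ℕ, 1 ≤ n → (n ≤ ⌊Real.exp u⌋₊ ↔ Real.log n ≤ u) := fun n hn => by
    rw [Nat.le_floor_iff (Real.exp_pos u).le, Real.log_le_iff_le_exp (by exact_mod_cast hn)]
  have h2 : Finset.Icc 1 ⌊Real.exp u⌋₊ ⊆ Finset.Icc 1 ⌊Real.exp U⌋₊ :=
    Finset.Icc_subset_Icc_right (Nat.floor_le_floor (Real.exp_le_exp.2 h))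
  rw [← Finset.sum_subset h2]
  · refine Finset.sum_congr rfl fun n hn => ?_
    rw [Finset.mem_Icc] at hn
    rw [if_pos ((h1 n hn.1).1 hn.2)]
  · intro n hn hn'
    rw [Finset.mem_Icc] at hn hn'
    rw [if_neg, mul_zero]
    exact fun h3 => hn' ⟨hn.1, (h1 n hn.1).2 h3⟩

theorem hasDerivWithinAt_rieszMean (a : ℕ → ℝ) (M : ℕ) (u : ℝ) :
    HasDerivWithinAt (rieszMean a (M + 1)) (rieszMean a M u) (Set.Ici u) u := by
  have h1 : HasDerivWithinAt
      (fun v => ∑ n ∈ Finset.Icc 1 ⌊Real.exp (u + 1)⌋₊, a n * truncMonomial (M + 1) (Real.log n) v)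
      (rieszMean a M u) (Set.Ici u) u := by
    rw [rieszMean_eq a M (show u ≤ u + 1 by linarith)]
    exact HasDerivWithinAt.fun_sum fun n _ =>
      (hasDerivWithinAt_truncMonomial M (Real.log n) u).const_mul (a n)
  refine h1.congr_of_eventuallyEq ?_ (rieszMean_eq a (M + 1) (by linarith))
  filter_upwards [mem_nhdsWithin_of_mem_nhds (Iio_mem_nhds (show u < u + 1 by linarith))] with v hv
  exact rieszMean_eq a (M + 1) (le_of_lt hv)

theorem continuous_rieszMean (a : ℕ → ℝ) (M : ℕ) : Continuous (rieszMean a (M + 1)) := by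
  rw [continuous_iff_continuousAt]
  intro u
  have h1 : Continuous (fun v => ∑ n ∈ Finset.Icc 1 ⌊Real.exp (u + 1)⌋₊,
      a n * truncMonomial (M + 1) (Real.log n) v) :=
    continuous_finsetSum _ fun n _ => (continuous_truncMonomial M _).const_smul (a n)
  refine h1.continuousAt.congr ?_
  filter_upwards [Iio_mem_nhds (show u < u + 1 by linarith)] with v hv
  exact (rieszMean_eq a (M + 1) (le_of_lt hv)).symm

theorem rieszMean_zero (a : ℕ → ℝ) (u : ℝ) :
    rieszMean a 0 u = ∑ n ∈ Finset.Icc 1 ⌊Real.exp u⌋₊, a n := by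
  simp [rieszMean]

theorem rieszMean_at_zero (a : ℕ → ℝ) (M : ℕ) : rieszMean a (M + 1) 0 = 0 := by
  simp [rieszMean]

theorem exists_rieszMean_le (κ : ℕ) (A : ℝ) (hA : 0 ≤ A) : ∃ C : ℝ, 1 ≤ C ∧
    ∀ (L : ℝ) (h : ℕ → ℝ), IsSieveWeight κ A L h → ∀ u : ℝ, 0 ≤ u →
      0 ≤ rieszMean (sqf h) 0 u ∧ rieszMean (sqf h) 0 u ≤ C * (1 + u) ^ κ := by
  obtain ⟨C, hC, h1⟩ := sum_sqf_le κ A hA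
  refine ⟨C, hC, fun L h hh u hu => ?_⟩
  rw [rieszMean_zero]
  refine ⟨Finset.sum_nonneg fun n _ => sqf_nonneg hh.nonneg n, ?_⟩
  have := h1 h hh.nonneg hh.le (Real.exp u) (Real.one_le_exp hu) (Finset.Icc 1 ⌊Real.exp u⌋₊)
    fun n hn => ?_
  · rwa [Real.log_exp] at this
  · rw [Finset.mem_Icc] at hn
    exact ⟨hn.1, (Nat.le_floor_iff (Real.exp_pos u).le).1 hn.2⟩

/-- In u = log x, `exists_sum_mul_log_bound` reads u g = (κ+1) t + O(L (1+u)^κ) with t' = g. The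
asymptotic for t follows from `exists_limit_of_right_deriv`, and dividing the relation by u
transfers it to g. The range u ≤ 1 is covered by the upper bound for g. -/
theorem exists_rieszMean_zero_asymptotic (κ : ℕ) (hκ : 1 ≤ κ) (A : ℝ) (hA : 0 ≤ A) :
    ∃ C : ℝ, 1 ≤ C ∧ ∀ (L : ℝ) (h : ℕ → ℝ), IsSieveWeight κ A L h → ∃ c : ℝ, ∀ u : ℝ, 0 ≤ u →
      |rieszMean (sqf h) 0 u - c * u ^ κ| ≤ C * L * (1 + u) ^ (κ - 1) := by
  obtain ⟨C₁, hC₁, hub⟩ := exists_rieszMean_le κ A hA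
  obtain ⟨C₂, hC₂, hrel⟩ := exists_sum_mul_log_bound κ A hA
  obtain ⟨j, rfl⟩ : ∃ j, κ = j + 1 := ⟨κ - 1, by omega⟩
  set D := C₂ * C₁ * 2 ^ (j + 1) * (j + 3)
  have hD : 0 ≤ D := by positivity
  refine ⟨D + C₁ * 2 ^ (j + 1) + (D + C₁ * 2 ^ (j + 1)), ?_, ?_⟩
  · have : (1 : ℝ) ≤ C₁ * 2 ^ (j + 1) := one_le_mul_of_one_le_of_one_le hC₁ (one_le_pow₀ (by norm_num))
    linarith
  intro L h hh
  have hL := hh.one_le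
  set g := rieszMean (sqf h) 0
  set t := rieszMean (sqf h) 1
  have h1 : ∀ u, 0 ≤ u → |u * g u - ((j + 1 : ℕ) + 1) * t u| ≤ C₂ * L * C₁ * (1 + u) ^ (j + 1) := by
    intro u hu
    have h2 := hrel L h hh (Real.exp u) (Real.one_le_exp hu)
    have h3 : t u = ∑ n ∈ Finset.Icc 1 ⌊Real.exp u⌋₊, sqf h n * Real.log (Real.exp u / n) := by
      refine Finset.sum_congr rfl fun n hn => ?_
      have : (n : ℝ) ≠ 0 := by
        have := (Finset.mem_Icc.1 hn).1
        positivity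
      rw [Real.log_div (Real.exp_ne_zero u) this, Real.log_exp]
      simp
    rw [← h3, Real.log_exp, ← rieszMean_zero, mul_comm _ u] at h2
    refine h2.trans ?_
    rw [mul_assoc (C₂ * L)]
    exact mul_le_mul_of_nonneg_left (hub L h hh u hu).2 (by positivity)
  obtain ⟨c, hc⟩ := exists_limit_of_right_deriv (t := t) (g := g) (κ := j + 1)
    (E := C₂ * L * C₁) (continuous_rieszMean _ 0).continuousOn
    (fun u _ => hasDerivWithinAt_rieszMean _ 0 u) (fun u hu => h1 u (by linarith))
  set c' : ℝ := ((j + 1 : ℕ) + 1) * c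
  have hlarge : ∀ u, 1 ≤ u → |g u - c' * u ^ (j + 1)| ≤ D * L * u ^ j := by
    intro u hu
    have hu0 : 0 < u := by linarith
    have h2 : u * (g u - c' * u ^ (j + 1)) = (u * g u - ((j + 1 : ℕ) + 1) * t u)
        + ((j + 1 : ℕ) + 1) * (t u - c * u ^ (j + 1 + 1)) := by
      simp only [c']; ring
    have h3 : |u * (g u - c' * u ^ (j + 1))| ≤ C₂ * L * C₁ * (2 * u) ^ (j + 1)
        + ((j + 1 : ℕ) + 1) * (C₂ * L * C₁ * 2 ^ (j + 1) * u ^ (j + 1)) := by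
      rw [h2]
      refine (abs_add_le _ _).trans (add_le_add ?_ ?_)
      · refine (h1 u hu0.le).trans ?_
        exact mul_le_mul_of_nonneg_left
          (pow_le_pow_left₀ (by linarith) (by linarith) _) (by positivity)
      · rw [abs_mul, abs_of_nonneg (by positivity : (0 : ℝ) ≤ ((j + 1 : ℕ) : ℝ) + 1)]
        exact mul_le_mul_of_nonneg_left (hc u hu) (by positivity)
    rw [abs_mul, abs_of_pos hu0] at h3
    refine le_of_mul_le_mul_left (h3.trans (le_of_eq ?_)) hu0
    simp only [D]
    push_cast
    ring
  -- The constant is bounded by evaluating the asymptotic at u = 1.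
  have hc' : |c'| ≤ D * L + C₁ * 2 ^ (j + 1) := by
    have h2 := hlarge 1 le_rfl
    have h3 := hub L h hh 1 zero_le_one
    have h4 : c' = g 1 - (g 1 - c' * 1 ^ (j + 1)) := by ring
    rw [h4]
    refine (abs_sub _ _).trans ?_
    rw [abs_of_nonneg h3.1]
    have h5 : g 1 ≤ C₁ * 2 ^ (j + 1) := by
      have := h3.2
      norm_num at this
      exact this
    simp only [one_pow, mul_one] at h2 ⊢
    linarith
  refine ⟨c', fun u hu => ?_⟩
  have hCL : C₁ * 2 ^ (j + 1) ≤ C₁ * 2 ^ (j + 1) * L :=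
    le_mul_of_one_le_right (by positivity) hL
  have hpos : 0 ≤ C₁ * 2 ^ (j + 1) := by positivity
  have hDL : 0 ≤ D * L := by positivity
  simp only [Nat.add_sub_cancel]
  rcases le_total 1 u with hu1 | hu1
  · refine (hlarge u hu1).trans ?_
    refine mul_le_mul ?_ (pow_le_pow_left₀ hu (by linarith) j) (by positivity) (by positivity)
    exact mul_le_mul_of_nonneg_right (by linarith) (by linarith)
  · refine (abs_sub _ _).trans ?_
    have h3 := hub L h hh u hu
    rw [abs_of_nonneg h3.1, abs_mul, abs_of_nonneg (pow_nonneg hu _)]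
    have h4 : (1 + u) ^ (j + 1) ≤ 2 ^ (j + 1) := pow_le_pow_left₀ (by linarith) (by linarith) _
    have h5 := mul_le_mul_of_nonneg_left h4 (by linarith : 0 ≤ C₁)
    have h6 : |c'| * u ^ (j + 1) ≤ |c'| := mul_le_of_le_one_right (abs_nonneg _)
      (pow_le_one₀ hu hu1)
    have h7 : (1 : ℝ) ≤ (1 + u) ^ j := one_le_pow₀ (by linarith)
    have h8 : 0 ≤ (D + C₁ * 2 ^ (j + 1) + (D + C₁ * 2 ^ (j + 1))) * L := by positivity
    refine le_trans ?_ (le_mul_of_one_le_right h8 h7)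
    nlinarith [h3.2]

/-! ### The Dirichlet series of a sieve weight as s tends to 0. -/

/-- Bernoulli's inequality bounds (1 - q)^κ below by 1 - κq. Applied to (1 + q)^κ, together with (1
- q)^κ (1 + q)^κ ≤ 1, it also bounds it above to second order. -/
theorem abs_one_add_mul_one_sub_pow_sub_one_le {w q : ℝ} (κ : ℕ) (hw : 0 ≤ w) (hq : 0 ≤ q)
    (hq1 : q ≤ 1) : |(1 + w) * (1 - q) ^ κ - 1| ≤ |w - κ * q| + κ ^ 2 * q ^ 2 + κ * q * w := by
  have h1 : 1 - κ * q ≤ (1 - q) ^ κ := by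
    have := one_add_mul_le_pow (a := -q) (by linarith) κ
    rw [← sub_eq_add_neg] at this
    linarith
  have hx : 0 ≤ κ * q := by positivity
  have h0 : 0 ≤ (1 - q) ^ κ := pow_nonneg (by linarith) κ
  have h2 : (1 - q) ^ κ ≤ 1 - κ * q + (κ * q) ^ 2 := by
    have h3 : 1 + κ * q ≤ (1 + q) ^ κ := one_add_mul_le_pow (by linarith) κ
    have h4 : (1 - q) ^ κ * (1 + q) ^ κ ≤ 1 := by
      rw [← mul_pow]
      exact pow_le_one₀ (mul_nonneg (by linarith) (by linarith)) (by nlinarith)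
    have h5 : (1 - q) ^ κ * (1 + κ * q) ≤ 1 := (mul_le_mul_of_nonneg_left h3 h0).trans h4
    have h6 : 1 ≤ (1 - κ * q + (κ * q) ^ 2) * (1 + κ * q) := by
      nlinarith [pow_nonneg hx 3]
    exact le_of_mul_le_mul_right (h5.trans h6) (by linarith)
  have h7 : (1 - q) ^ κ ≤ 1 := pow_le_one₀ (by linarith) (by linarith)
  have h8 : (1 + w) * (1 - q) ^ κ - 1
      = (w - κ * q) + ((1 - q) ^ κ - (1 - κ * q)) + -(w * (1 - (1 - q) ^ κ)) := by ring
  rw [h8]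
  refine (abs_add_le _ _).trans (add_le_add ((abs_add_le _ _).trans (add_le_add le_rfl ?_)) ?_)
  · rw [abs_of_nonneg (by linarith)]; nlinarith
  · rw [abs_neg, abs_of_nonneg (mul_nonneg hw (by linarith))]
    nlinarith

/-- The constant `∏_p (1 + h(p)) (1 - 1/p) ^ κ`. -/
def eulerConst (κ : ℕ) (h : ℕ → ℝ) : ℝ :=
  ∏' p : Nat.Primes, (1 + h p) * (1 - 1 / (p : ℝ)) ^ κ

theorem hasProd_of_eq {ι : Type*} {f g : ι → ℝ} {a : ℝ} (hf : HasProd f a)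
    (hfg : ∀ i, g i = f i) : HasProd g a := by
  rwa [show g = f from funext hfg]

theorem summable_primes_inv_sq : Summable (fun p : Nat.Primes => 1 / ((p : ℕ) : ℝ) ^ 2) :=
  (Real.summable_one_div_nat_pow.2 one_lt_two).comp_injective Subtype.val_injective

theorem IsSieveWeight.summable {κ : ℕ} {A L : ℝ} {h : ℕ → ℝ} (hh : IsSieveWeight κ A L h) :
    Summable (fun p : Nat.Primes => |h p - κ / (p : ℕ)|) := by
  have hl : 0 < Real.log 2 := Real.log_pos (by norm_num)
  refine summable_of_sum_le (c := L / Real.log 2) (fun p => abs_nonneg _) fun u => ?_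
  rw [le_div_iff₀ hl, Finset.sum_mul]
  have h1 := hh.sum_le (u.image fun p : Nat.Primes => (p : ℕ)) (by
    intro p hp
    obtain ⟨q, _, rfl⟩ := Finset.mem_image.1 hp
    exact q.2)
  rw [Finset.sum_image (g := fun p : Nat.Primes => (p : ℕ)) (fun a _ b _ hab => Subtype.ext hab)] at h1
  refine (Finset.sum_le_sum fun p _ => ?_).trans h1
  refine mul_le_mul_of_nonneg_left ?_ (abs_nonneg _)
  exact Real.log_le_log (by norm_num) (by exact_mod_cast p.2.two_le)

section Dirichlet

variable {κ : ℕ} {A L : ℝ} {h : ℕ → ℝ}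

theorem IsSieveWeight.summable_eulerFactor_bound (hh : IsSieveWeight κ A L h) :
    Summable (fun p : Nat.Primes => |h p - κ / (p : ℕ)|
      + (κ ^ 2 + κ * (κ + A)) * (1 / ((p : ℕ) : ℝ) ^ 2)) :=
  hh.summable.add (summable_primes_inv_sq.mul_left _)

/-- Applied with t = p^(-s). The bound does not depend on t, so it serves as the dominating series
when s → 0⁺. -/
theorem IsSieveWeight.abs_eulerFactor_sub_one_le (hh : IsSieveWeight κ A L h) (hA : 0 ≤ A)
    (p : Nat.Primes) {t : ℝ} (ht : 0 ≤ t) (ht1 : t ≤ 1) :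
    |(1 + h p * t) * (1 - t / (p : ℕ)) ^ κ - 1| ≤ |h p - κ / (p : ℕ)|
      + (κ ^ 2 + κ * (κ + A)) * (1 / ((p : ℕ) : ℝ) ^ 2) := by
  have hp0 : (0 : ℝ) < (p : ℕ) := by exact_mod_cast p.2.pos
  have hp1 : (1 : ℝ) ≤ (p : ℕ) := by exact_mod_cast p.2.one_le
  have hh0 := hh.nonneg p p.2
  have hle := hh.le_div hA p.2
  have hq1 : t / (p : ℕ) ≤ 1 := by rw [div_le_one hp0]; linarith
  refine (abs_one_add_mul_one_sub_pow_sub_one_le κ (mul_nonneg hh0 ht) (by positivity) hq1).trans ?_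
  have h1 : |h p * t - κ * (t / (p : ℕ))| ≤ |h p - κ / (p : ℕ)| := by
    have : h p * t - κ * (t / (p : ℕ)) = (h p - κ / (p : ℕ)) * t := by ring
    rw [this, abs_mul, abs_of_nonneg ht]
    exact mul_le_of_le_one_right (abs_nonneg _) ht1
  have ht2 : t ^ 2 ≤ 1 := pow_le_one₀ ht ht1
  have h2 : (κ : ℝ) ^ 2 * (t / (p : ℕ)) ^ 2 ≤ κ ^ 2 * (1 / ((p : ℕ) : ℝ) ^ 2) := by
    rw [div_pow]
    gcongr
  have h3 : κ * (t / (p : ℕ)) * (h p * t) ≤ κ * (κ + A) * (1 / ((p : ℕ) : ℝ) ^ 2) := by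
    calc κ * (t / (p : ℕ)) * (h p * t) = κ * (t ^ 2) / (p : ℕ) * h p := by ring
      _ ≤ κ * 1 / (p : ℕ) * ((κ + A) / (p : ℕ)) := by gcongr
      _ = _ := by ring
  linarith

theorem IsSieveWeight.multipliable_eulerConst (hh : IsSieveWeight κ A L h) (hA : 0 ≤ A) :
    Multipliable (fun p : Nat.Primes => (1 + h p) * (1 - 1 / ((p : ℕ) : ℝ)) ^ κ) := by
  have h1 : Summable (fun p : Nat.Primes => ‖(1 + h p) * (1 - 1 / ((p : ℕ) : ℝ)) ^ κ - 1‖) := by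
    refine Summable.of_nonneg_of_le (fun _ => norm_nonneg _) (fun p => ?_)
      hh.summable_eulerFactor_bound
    have := hh.abs_eulerFactor_sub_one_le hA p zero_le_one le_rfl
    rwa [mul_one] at this
  have := multipliable_one_add_of_summable h1
  simpa using this

theorem IsSieveWeight.summable_sqf_rpow (hh : IsSieveWeight κ A L h) (hA : 0 ≤ A) {s : ℝ}
    (hs : 0 < s) : Summable (sqf (fun p => h p * (p : ℝ) ^ (-s))) := by
  have hw : ∀ p : ℕ, p.Prime → 0 ≤ h p * (p : ℝ) ^ (-s) := fun p hp =>
    mul_nonneg (hh.nonneg p hp) (by positivity)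
  have hsum : Summable (fun n : ℕ => (n : ℝ) ^ (-(1 + s))) :=
    Real.summable_nat_rpow.2 (by linarith)
  refine summable_of_sum_le (c := Real.exp ((κ + A) * ∑' n : ℕ, (n : ℝ) ^ (-(1 + s))))
    (fun n => sqf_nonneg hw n) fun S => ?_
  refine (sum_sqf_le_prod S (S.biUnion fun n => n.primeFactors) hw ?_ ?_).trans
    ((prod_one_add_le_exp _ ?_).trans ?_)
  · intro p hp
    obtain ⟨n, _, hn⟩ := Finset.mem_biUnion.1 hp
    exact Nat.prime_of_mem_primeFactors hn
  · intro n hn _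
    exact Finset.subset_biUnion_of_mem (fun n : ℕ => n.primeFactors) hn
  · intro p hp
    obtain ⟨n, _, hn⟩ := Finset.mem_biUnion.1 hp
    exact hw p (Nat.prime_of_mem_primeFactors hn)
  · refine Real.exp_le_exp.2 ?_
    calc _ ≤ ∑ p ∈ S.biUnion fun n => n.primeFactors, (κ + A) * (p : ℝ) ^ (-(1 + s)) := by
          refine Finset.sum_le_sum fun p hp => ?_
          obtain ⟨n, _, hn⟩ := Finset.mem_biUnion.1 hp
          have hp := Nat.prime_of_mem_primeFactors hn
          have hp0 : (0 : ℝ) < p := by exact_mod_cast hp.pos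
          refine (mul_le_mul_of_nonneg_right (hh.le_div hA hp) (by positivity)).trans (le_of_eq ?_)
          rw [neg_add, Real.rpow_add hp0, Real.rpow_neg_one]
          ring
      _ ≤ _ := by
          rw [← Finset.mul_sum]
          refine mul_le_mul_of_nonneg_left ?_ (by positivity)
          exact hsum.sum_le_tsum _ fun n _ => by positivity

theorem IsSieveWeight.hasProd_sqf_rpow (hh : IsSieveWeight κ A L h) (hA : 0 ≤ A) {s : ℝ}
    (hs : 0 < s) : HasProd (fun p : Nat.Primes => 1 + h p * ((p : ℕ) : ℝ) ^ (-s))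
      (∑' n : ℕ, sqf (fun p => h p * (p : ℝ) ^ (-s)) n) := by
  set w : ℕ → ℝ := fun p => h p * (p : ℝ) ^ (-s)
  have h1 := EulerProduct.eulerProduct_hasProd (f := sqf w) (sqf_one w)
    (fun hmn => sqf_mul_of_coprime w hmn) (hh.summable_sqf_rpow hA hs).norm (sqf_zero w)
  refine hasProd_of_eq h1 fun p => ?_
  rw [tsum_eq_sum (s := Finset.range 2)]
  · simp [Finset.sum_range_succ, sqf_one, sqf_prime w p.2, w]
  · intro e he
    have he2 : 2 ≤ e := not_lt.1 fun h => he (Finset.mem_range.2 h)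
    refine sqf_of_not_squarefree _ fun hsq => ?_
    have : (p : ℕ) * p ∣ (p : ℕ) ^ e := by rw [← sq]; exact pow_dvd_pow _ he2
    have := hsq _ this
    exact p.2.one_lt.ne' (Nat.isUnit_iff.1 this)

theorem hasProd_zeta {s : ℝ} (hs : 0 < s) :
    HasProd (fun p : Nat.Primes => (1 - ((p : ℕ) : ℝ) ^ (-s) / (p : ℕ))⁻¹)
      (∑' n : ℕ, 1 / (n : ℝ) ^ (1 + s)) := by
  set f : ℕ →*₀ ℝ :=
    { toFun := fun n => 1 / (n : ℝ) ^ (1 + s)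
      map_zero' := by simp [Real.zero_rpow (by linarith : (1 + s) ≠ 0)]
      map_one' := by simp
      map_mul' := fun m n => by
        push_cast
        rw [Real.mul_rpow (by positivity) (by positivity)]
        ring }
  have hsum : Summable (fun n : ℕ => ‖f n‖) :=
    (Real.summable_one_div_nat_rpow.2 (by linarith : 1 < 1 + s)).norm
  have h1 := EulerProduct.eulerProduct_completely_multiplicative_hasProd hsum
  refine hasProd_of_eq h1 fun p => ?_
  congr 2
  have hp0 : (0 : ℝ) < (p : ℕ) := by exact_mod_cast p.2.pos
  change _ = 1 / ((p : ℕ) : ℝ) ^ (1 + s)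
  rw [Real.rpow_add hp0, Real.rpow_neg hp0.le, Real.rpow_one]
  field_simp

/-- Compare Euler products: dividing out ζ(1+s)^κ leaves a product that converges absolutely,
uniformly in s. Its factors are written as 1 + (… - 1) for the dominated convergence theorem for
products. -/
theorem IsSieveWeight.tsum_eq_zeta_pow_mul (hh : IsSieveWeight κ A L h) (hA : 0 ≤ A) {s : ℝ}
    (hs : 0 < s) : (∑' n : ℕ, sqf (fun p => h p * (p : ℝ) ^ (-s)) n)
      = (∑' n : ℕ, 1 / (n : ℝ) ^ (1 + s)) ^ κ
        * ∏' p : Nat.Primes, (1 + ((1 + h p * ((p : ℕ) : ℝ) ^ (-s))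
            * (1 - ((p : ℕ) : ℝ) ^ (-s) / (p : ℕ)) ^ κ - 1)) := by
  have ht : ∀ p : Nat.Primes, ((p : ℕ) : ℝ) ^ (-s) ≤ 1 := fun p =>
    Real.rpow_le_one_of_one_le_of_nonpos (by exact_mod_cast p.2.one_le) (by linarith)
  have ht0 : ∀ p : Nat.Primes, 0 ≤ ((p : ℕ) : ℝ) ^ (-s) := fun p => by positivity
  have h1 : Multipliable (fun p : Nat.Primes => 1 + ((1 + h p * ((p : ℕ) : ℝ) ^ (-s))
            * (1 - ((p : ℕ) : ℝ) ^ (-s) / (p : ℕ)) ^ κ - 1)) := by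
    refine multipliable_one_add_of_summable ?_
    exact Summable.of_nonneg_of_le (fun _ => norm_nonneg _)
      (fun p => hh.abs_eulerFactor_sub_one_le hA p (ht0 p) (ht p)) hh.summable_eulerFactor_bound
  have h2 := ((hasProd_zeta hs).pow κ).mul h1.hasProd
  refine (hh.hasProd_sqf_rpow hA hs).unique ?_
  refine hasProd_of_eq h2 fun p => ?_
  have hp1 : (1 : ℝ) < (p : ℕ) := by exact_mod_cast p.2.one_lt
  have h3 : (1 - ((p : ℕ) : ℝ) ^ (-s) / (p : ℕ)) ≠ 0 := by
    have : ((p : ℕ) : ℝ) ^ (-s) / (p : ℕ) < 1 := by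
      rw [div_lt_one (by linarith)]
      exact (ht p).trans_lt hp1
    linarith
  have key : ∀ a b : ℝ, b ≠ 0 → a = b⁻¹ ^ κ * (1 + (a * b ^ κ - 1)) := fun a b hb => by
    rw [add_sub_cancel, inv_pow, mul_comm, mul_assoc, mul_inv_cancel₀ (pow_ne_zero _ hb), mul_one]
  exact key _ _ h3

theorem tendsto_mul_zeta :
    Tendsto (fun s : ℝ => s * ∑' n : ℕ, 1 / (n : ℝ) ^ (1 + s)) (𝓝[>] 0) (𝓝 1) := by
  have h1 : Tendsto (fun s : ℝ => 1 + s) (𝓝[>] 0) (𝓝[>] 1) := by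
    refine tendsto_nhdsWithin_iff.2 ⟨?_, ?_⟩
    · have : Tendsto (fun s : ℝ => 1 + s) (𝓝 0) (𝓝 (1 + 0)) :=
        (continuous_const.add continuous_id).tendsto 0
      rw [add_zero] at this
      exact this.mono_left nhdsWithin_le_nhds
    · filter_upwards [self_mem_nhdsWithin] with s hs
      have : (0 : ℝ) < s := hs
      exact Set.mem_Ioi.2 (by linarith)
  refine (tendsto_sub_mul_tsum_nat_rpow.comp h1).congr fun s => ?_
  simp

/-- The simple pole of ζ with residue 1 absorbs s^κ, and dominated convergence passes to the limit
in the remaining product. -/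
theorem IsSieveWeight.tendsto_pow_mul_tsum (hh : IsSieveWeight κ A L h) (hA : 0 ≤ A) :
    Tendsto (fun s : ℝ => s ^ κ * ∑' n : ℕ, sqf (fun p => h p * (p : ℝ) ^ (-s)) n) (𝓝[>] 0)
      (𝓝 (eulerConst κ h)) := by
  have h1 : Tendsto (fun s : ℝ => ∏' p : Nat.Primes, (1 + ((1 + h p * ((p : ℕ) : ℝ) ^ (-s))
            * (1 - ((p : ℕ) : ℝ) ^ (-s) / (p : ℕ)) ^ κ - 1))) (𝓝[>] 0)
      (𝓝 (∏' p : Nat.Primes, (1 + ((1 + h p) * (1 - 1 / ((p : ℕ) : ℝ)) ^ κ - 1)))) := by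
    refine tendsto_tprod_one_add_of_dominated_convergence hh.summable_eulerFactor_bound ?_ ?_
    · intro p
      have hp0 : (0 : ℝ) < (p : ℕ) := by exact_mod_cast p.2.pos
      have h2 : Tendsto (fun s : ℝ => ((p : ℕ) : ℝ) ^ (-s)) (𝓝[>] 0) (𝓝 1) := by
        have : ContinuousAt (fun s : ℝ => ((p : ℕ) : ℝ) ^ (-s)) 0 :=
          ContinuousAt.rpow continuousAt_const continuousAt_id.neg (Or.inl hp0.ne')
        have h3 : Tendsto (fun s : ℝ => ((p : ℕ) : ℝ) ^ (-s)) (𝓝 0) (𝓝 (((p : ℕ) : ℝ) ^ (-(0:ℝ)))) := this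
        rw [neg_zero, Real.rpow_zero] at h3
        exact h3.mono_left nhdsWithin_le_nhds
      have h3 := (((h2.const_mul (h p)).const_add 1).mul
        (((h2.div_const ((p : ℕ) : ℝ)).const_sub 1).pow κ)).sub_const 1
      rwa [mul_one] at h3
    · filter_upwards [self_mem_nhdsWithin] with s hs p
      have hs0 : (0 : ℝ) < s := hs
      exact hh.abs_eulerFactor_sub_one_le hA p (by positivity)
        (Real.rpow_le_one_of_one_le_of_nonpos (by exact_mod_cast p.2.one_le) (by linarith))
  have h2 := (tendsto_mul_zeta.pow κ).mul h1
  rw [one_pow, one_mul] at h2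
  have h3 : (∏' p : Nat.Primes, (1 + ((1 + h p) * (1 - 1 / ((p : ℕ) : ℝ)) ^ κ - 1)))
      = eulerConst κ h := by
    unfold eulerConst
    exact tprod_congr fun p => by ring
  rw [h3] at h2
  refine h2.congr' ?_
  filter_upwards [self_mem_nhdsWithin] with s hs
  rw [hh.tsum_eq_zeta_pow_mul hA hs]
  ring

end Dirichlet

theorem sqf_mul_rpow (h : ℕ → ℝ) (s : ℝ) (n : ℕ) :
    sqf (fun p => h p * (p : ℝ) ^ (-s)) n = sqf h n * (n : ℝ) ^ (-s) := by
  rw [← sqf_mul_sqf h (fun p => (p : ℝ) ^ (-s))]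
  by_cases hn : Squarefree n
  · congr 1
    rw [sqf_of_squarefree _ hn, Real.finsetProd_rpow _ _ (fun p _ => by positivity),
      ← Nat.cast_prod, Nat.prod_primeFactors_of_squarefree hn]
  · simp [sqf_of_not_squarefree _ hn]

/-! ### An Abelian theorem and the value of the constant. -/

section Abelian

open MeasureTheory

theorem integral_pow_mul_exp {s : ℝ} (hs : 0 < s) (j : ℕ) :
    ∫ u in Set.Ioi (0 : ℝ), u ^ j * Real.exp (-(s * u)) = j.factorial / s ^ (j + 1) := by
  have := Real.integral_rpow_mul_exp_neg_mul_Ioi (a := j + 1) (by positivity) hs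
  rw [Real.Gamma_nat_eq_factorial] at this
  simp only [add_sub_cancel_right, Real.rpow_natCast] at this
  rw [this, show ((j : ℝ) + 1) = ((j + 1 : ℕ) : ℝ) by push_cast; ring, Real.rpow_natCast,
    one_div, inv_pow, div_eq_inv_mul]

theorem integrableOn_pow_mul_exp {s : ℝ} (hs : 0 < s) (j : ℕ) :
    IntegrableOn (fun u : ℝ => u ^ j * Real.exp (-(s * u))) (Set.Ioi 0) := by
  have := integrableOn_rpow_mul_exp_neg_mul_rpow (p := 1) (s := j) (b := s)
    (by have := Nat.cast_nonneg (α := ℝ) j; linarith) one_pos hs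
  simpa using this

/-- For n ≥ 1, n^(-s) is the integral of s e^(-su) over u > log n. Since the coefficients are
nonnegative, sum and integral may be exchanged, and the Dirichlet series becomes a Laplace transform
of the summatory function. -/
theorem hasSum_mul_rpow {a : ℕ → ℝ} (ha : ∀ n, 0 ≤ a n) (ha0 : a 0 = 0) {s : ℝ} (hs : 0 < s)
    (hsum : Summable fun n => a n * (n : ℝ) ^ (-s)) :
    HasSum (fun n => a n * (n : ℝ) ^ (-s))
      (∫ u in Set.Ioi (0 : ℝ), s * Real.exp (-(s * u)) * rieszMean a 0 u) := by
  set F : ℕ → ℝ → ℝ := fun n u =>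
    a n * (Set.Ici (Real.log n)).indicator (fun u => s * Real.exp (-(s * u))) u
  have hexp : IntegrableOn (fun u : ℝ => s * Real.exp (-(s * u))) (Set.Ioi 0) := by
    have := (integrableOn_pow_mul_exp hs 0).const_mul s
    simpa [IntegrableOn] using this
  have hint : ∀ n : ℕ, ∫ u in Set.Ioi (0 : ℝ), F n u = a n * (n : ℝ) ^ (-s) := by
    intro n
    rcases Nat.eq_zero_or_pos n with rfl | hn
    · simp [F, ha0]
    have hn1 : (1 : ℝ) ≤ n := by exact_mod_cast hn
    simp only [F]
    rw [integral_const_mul, integral_indicator measurableSet_Ici,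
      Measure.restrict_restrict measurableSet_Ici]
    congr 1
    have h1 : ∫ u in Set.Ici (Real.log n) ∩ Set.Ioi 0, s * Real.exp (-(s * u))
        = ∫ u in Set.Ioi (Real.log n), s * Real.exp (-(s * u)) := by
      refine setIntegral_congr_set ?_
      have h2 : (Set.Ioi (Real.log n) : Set ℝ) = Set.Ioi (Real.log n) ∩ Set.Ioi 0 := by
        rw [Set.Ioi_inter_Ioi, sup_eq_left.2 (Real.log_nonneg hn1)]
      rw [h2]
      exact (Ioi_ae_eq_Ici.symm).inter (ae_eq_refl _)
    rw [h1, integral_const_mul]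
    have h3 := integral_exp_mul_Ioi (a := -s) (by linarith) (Real.log n)
    simp only [neg_mul] at h3
    rw [h3, Real.rpow_def_of_pos (by linarith), neg_div_neg_eq, mul_neg, mul_comm s (Real.log n)]
    field_simp
  have hFint : ∀ n, Integrable (F n) (volume.restrict (Set.Ioi 0)) := fun n =>
    (hexp.integrable.indicator measurableSet_Ici).const_mul _
  have hF0 : ∀ n u, 0 ≤ F n u := fun n u =>
    mul_nonneg (ha n) (Set.indicator_nonneg (fun u _ => by positivity) u)
  have h1 := hasSum_integral_of_summable_integral_norm hFint (by
    have : (fun n => ∫ u in Set.Ioi (0 : ℝ), ‖F n u‖) = fun n => a n * (n : ℝ) ^ (-s) := by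
      funext n
      rw [← hint n]
      exact integral_congr_ae (ae_of_all _ fun u => Real.norm_of_nonneg (hF0 n u))
    rw [this]
    exact hsum)
  simp only [hint] at h1
  convert! h1 using 1
  refine integral_congr_ae ?_
  refine (ae_restrict_iff' measurableSet_Ioi).2 (ae_of_all _ fun u _ => ?_)
  simp only
  rw [tsum_eq_sum (s := Finset.Icc 1 ⌊Real.exp u⌋₊), rieszMean_zero, Finset.mul_sum]
  · refine Finset.sum_congr rfl fun n hn => ?_
    rw [Finset.mem_Icc, Nat.le_floor_iff (Real.exp_pos u).le] at hn
    have hn0 : (0 : ℝ) < n := by exact_mod_cast hn.1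
    have : u ∈ Set.Ici (Real.log n) := (Real.log_le_iff_le_exp hn0).2 hn.2
    simp only [F, Set.indicator_of_mem this]
    ring
  · intro n hn
    rw [Finset.mem_Icc, Nat.le_floor_iff (Real.exp_pos u).le] at hn
    rcases Nat.eq_zero_or_pos n with rfl | hn1
    · simp [F, ha0]
    have hn0 : (0 : ℝ) < n := by exact_mod_cast hn1
    have : u ∉ Set.Ici (Real.log n) := fun h => hn ⟨hn1, (Real.log_le_iff_le_exp hn0).1 h⟩
    simp only [F, Set.indicator_of_notMem this, mul_zero]

/-- Under the Laplace transform c u^κ becomes exactly c κ!/s^κ. The error term contributes O(s +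
s^κ) after multiplication by s^κ, which vanishes because κ ≥ 1. -/
theorem tendsto_pow_mul_tsum_of_rieszMean {a : ℕ → ℝ} (ha : ∀ n, 0 ≤ a n) (ha0 : a 0 = 0)
    (hsum : ∀ s : ℝ, 0 < s → Summable fun n => a n * (n : ℝ) ^ (-s)) {κ : ℕ} (hκ : 1 ≤ κ)
    {c D : ℝ}
    (hc : ∀ u : ℝ, 0 ≤ u → |rieszMean a 0 u - c * u ^ κ| ≤ D * (1 + u) ^ (κ - 1)) :
    Tendsto (fun s : ℝ => s ^ κ * ∑' n : ℕ, a n * (n : ℝ) ^ (-s)) (𝓝[>] 0)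
      (𝓝 (c * κ.factorial)) := by
  obtain ⟨j, rfl⟩ : ∃ j, κ = j + 1 := ⟨κ - 1, by omega⟩
  simp only [Nat.add_sub_cancel] at hc
  have hD : 0 ≤ D := by
    have := (abs_nonneg _).trans (hc 0 le_rfl)
    simpa using this
  have hmeas : Measurable (rieszMean a 0) := by
    have : rieszMean a 0 = (fun N : ℕ => ∑ n ∈ Finset.Icc 1 N, a n) ∘ fun u => ⌊Real.exp u⌋₊ := by
      funext u; rw [rieszMean_zero]; rfl
    rw [this]
    exact (measurable_from_top).comp (Nat.measurable_floor.comp Real.measurable_exp)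
  have key : ∀ s : ℝ, 0 < s →
      |s ^ (j + 1) * ∑' n : ℕ, a n * (n : ℝ) ^ (-s) - c * (j + 1).factorial|
        ≤ D * 2 ^ j * (s ^ (j + 1) + j.factorial * s) := by
    intro s hs
    have e1 := (hasSum_mul_rpow ha ha0 hs (hsum s hs)).tsum_eq
    have i1 : IntegrableOn (fun u : ℝ => c * (s * (u ^ (j + 1) * Real.exp (-(s * u))))) (Set.Ioi 0) :=
      ((integrableOn_pow_mul_exp hs (j + 1)).const_mul s).const_mul c
    have i2 : IntegrableOn (fun u : ℝ => D * 2 ^ j * (s * (u ^ 0 * Real.exp (-(s * u))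
        + u ^ j * Real.exp (-(s * u))))) (Set.Ioi 0) :=
      (((integrableOn_pow_mul_exp hs 0).add (integrableOn_pow_mul_exp hs j)).const_mul s).const_mul _
    have hb : ∀ u ∈ Set.Ioi (0 : ℝ), ‖s * Real.exp (-(s * u)) * rieszMean a 0 u
        - c * (s * (u ^ (j + 1) * Real.exp (-(s * u))))‖
        ≤ D * 2 ^ j * (s * (u ^ 0 * Real.exp (-(s * u)) + u ^ j * Real.exp (-(s * u)))) := by
      intro u hu
      have hu0 : (0 : ℝ) < u := hu
      have h1 : s * Real.exp (-(s * u)) * rieszMean a 0 u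
        - c * (s * (u ^ (j + 1) * Real.exp (-(s * u))))
        = s * Real.exp (-(s * u)) * (rieszMean a 0 u - c * u ^ (j + 1)) := by ring
      rw [h1, norm_mul, Real.norm_of_nonneg (by positivity), Real.norm_eq_abs]
      -- This splits the error into two gamma integrals.
      have h2 : (1 + u) ^ j ≤ 2 ^ j * (1 + u ^ j) := by
        have h3 : (1 + u) ^ j ≤ (2 * max 1 u) ^ j :=
          pow_le_pow_left₀ (by linarith) (by linarith [le_max_left 1 u, le_max_right 1 u]) j
        rw [mul_pow] at h3
        refine h3.trans (mul_le_mul_of_nonneg_left ?_ (by positivity))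
        rcases le_total 1 u with h | h
        · rw [max_eq_right h]; linarith
        · rw [max_eq_left h, one_pow]
          have := pow_nonneg hu0.le j
          linarith
      calc _ ≤ s * Real.exp (-(s * u)) * (D * (2 ^ j * (1 + u ^ j))) :=
            mul_le_mul_of_nonneg_left ((hc u hu0.le).trans (mul_le_mul_of_nonneg_left h2 hD))
              (by positivity)
        _ = _ := by ring
    have i3 : IntegrableOn (fun u : ℝ => s * Real.exp (-(s * u)) * rieszMean a 0 u
        - c * (s * (u ^ (j + 1) * Real.exp (-(s * u))))) (Set.Ioi 0) := by
      refine Integrable.mono' i2 ?_ ((ae_restrict_iff' measurableSet_Ioi).2 (ae_of_all _ hb))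
      exact Measurable.aestronglyMeasurable (by fun_prop)
    have i4 : IntegrableOn (fun u : ℝ => s * Real.exp (-(s * u)) * rieszMean a 0 u) (Set.Ioi 0) := by
      have := i3.add i1
      refine this.congr (ae_of_all _ fun u => ?_)
      simp
    have h1 : ∑' n : ℕ, a n * (n : ℝ) ^ (-s) - c * (s * ((j + 1).factorial / s ^ (j + 2)))
        = ∫ u in Set.Ioi (0 : ℝ), (s * Real.exp (-(s * u)) * rieszMean a 0 u
          - c * (s * (u ^ (j + 1) * Real.exp (-(s * u))))) := by
      rw [integral_sub i4 i1, e1, integral_const_mul, integral_const_mul, integral_pow_mul_exp hs]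
    have h2 : |∑' n : ℕ, a n * (n : ℝ) ^ (-s) - c * (s * ((j + 1).factorial / s ^ (j + 2)))|
        ≤ D * 2 ^ j * (s * (1 / s + j.factorial / s ^ (j + 1))) := by
      rw [h1, ← Real.norm_eq_abs]
      refine (norm_integral_le_of_norm_le i2
        ((ae_restrict_iff' measurableSet_Ioi).2 (ae_of_all _ hb))).trans (le_of_eq ?_)
      rw [integral_const_mul, integral_const_mul,
        integral_add (integrableOn_pow_mul_exp hs 0) (integrableOn_pow_mul_exp hs j),
        integral_pow_mul_exp hs, integral_pow_mul_exp hs]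
      simp
    have h3 : s ^ (j + 1) * ∑' n : ℕ, a n * (n : ℝ) ^ (-s) - c * (j + 1).factorial
        = s ^ (j + 1) * (∑' n : ℕ, a n * (n : ℝ) ^ (-s)
          - c * (s * ((j + 1).factorial / s ^ (j + 2)))) := by
      rw [pow_succ s (j + 1)]
      field_simp
    rw [h3, abs_mul, abs_of_pos (pow_pos hs _)]
    refine (mul_le_mul_of_nonneg_left h2 (by positivity)).trans (le_of_eq ?_)
    field_simp
  rw [tendsto_iff_norm_sub_tendsto_zero]
  have h0 : Tendsto (fun s : ℝ => D * 2 ^ j * (s ^ (j + 1) + j.factorial * s)) (𝓝[>] 0) (𝓝 0) := by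
    have : Continuous (fun s : ℝ => D * 2 ^ j * (s ^ (j + 1) + j.factorial * s)) := by fun_prop
    have h1 := this.tendsto 0
    simp at h1
    exact h1.mono_left nhdsWithin_le_nhds
  refine squeeze_zero' (Eventually.of_forall fun _ => norm_nonneg _) ?_ h0
  filter_upwards [self_mem_nhdsWithin] with s hs
  exact key s hs

end Abelian

/-- Both sides are the limit of s^κ ∑ h(n) n^(-s) as s → 0⁺: one from the Euler product, one from
the summatory function. -/
theorem IsSieveWeight.eulerConst_eq {κ : ℕ} {A L : ℝ} {h : ℕ → ℝ} (hh : IsSieveWeight κ A L h)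
    (hA : 0 ≤ A) (hκ : 1 ≤ κ) {c D : ℝ}
    (hc : ∀ u : ℝ, 0 ≤ u → |rieszMean (sqf h) 0 u - c * u ^ κ| ≤ D * (1 + u) ^ (κ - 1)) :
    eulerConst κ h = c * κ.factorial := by
  have h1 := tendsto_pow_mul_tsum_of_rieszMean (a := sqf h) (sqf_nonneg hh.nonneg) (sqf_zero h)
    (fun s hs => (hh.summable_sqf_rpow hA hs).congr fun n => sqf_mul_rpow h s n) hκ hc
  have h2 := hh.tendsto_pow_mul_tsum hA
  simp only [sqf_mul_rpow] at h2
  exact tendsto_nhds_unique h2 h1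

/-- Integrate the order zero asymptotic `M` times. The constant does not grow with `M`, because each
integration of (1+u)^i also divides by i + 1. -/
theorem exists_rieszMean_asymptotic (κ : ℕ) (hκ : 1 ≤ κ) (A : ℝ) (hA : 0 ≤ A) :
    ∃ C : ℝ, 1 ≤ C ∧ ∀ (L : ℝ) (h : ℕ → ℝ), IsSieveWeight κ A L h →
      ∀ M : ℕ, ∀ u : ℝ, 0 ≤ u →
      |rieszMean (sqf h) M u - eulerConst κ h * (u ^ (κ + M) / ((κ + M).factorial : ℝ))|
        ≤ C * L * (1 + u) ^ (κ + M - 1) := by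
  obtain ⟨C, hC, hmain⟩ := exists_rieszMean_zero_asymptotic κ hκ A hA
  refine ⟨C, hC, fun L h hh M => ?_⟩
  obtain ⟨c, hc⟩ := hmain L h hh
  have hfac : (κ.factorial : ℝ) ≠ 0 := by positivity
  have hc' : c = eulerConst κ h / κ.factorial := by
    rw [hh.eulerConst_eq hA hκ hc, mul_div_cancel_right₀ _ hfac]
  set e := eulerConst κ h
  have hCL : 0 ≤ C * L := by have := hh.one_le; positivity
  induction M with
  | zero =>
    intro u hu
    have := hc u hu
    rw [hc'] at this
    simpa [mul_div_assoc, div_mul_eq_mul_div] using this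
  | succ M ih =>
    intro u hu
    obtain ⟨i, hi⟩ : ∃ i, κ + M = i + 1 := ⟨κ + M - 1, by omega⟩
    rw [show κ + (M + 1) = i + 2 by omega]
    rw [hi] at ih
    simp only [Nat.add_sub_cancel, show i + 2 - 1 = i + 1 by omega] at ih ⊢
    have hd : ∀ x : ℝ, HasDerivAt (fun v : ℝ => e * (v ^ (i + 2) / ((i + 2).factorial : ℝ)))
        (e * (x ^ (i + 1) / ((i + 1).factorial : ℝ))) x := by
      intro x
      have h1 := ((hasDerivAt_pow (i + 2) x).div_const ((i + 2).factorial : ℝ)).const_mul e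
      refine h1.congr_deriv ?_
      rw [Nat.factorial_succ (i + 1)]
      have : ((i + 1).factorial : ℝ) ≠ 0 := by positivity
      push_cast
      field_simp
      ring
    have hB : ∀ x : ℝ, HasDerivAt (fun v : ℝ => C * L * ((1 + v) ^ (i + 1) / (i + 1)))
        (C * L * (1 + x) ^ i) x := by
      intro x
      have h1 := (((((hasDerivAt_id x).const_add 1).pow (i + 1)).div_const ((i : ℝ) + 1)).const_mul (C * L))
      refine h1.congr_deriv ?_
      have : (i : ℝ) + 1 ≠ 0 := by positivity
      push_cast
      simp only [id]
      field_simp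
    have h2 := image_norm_le_of_norm_deriv_right_le_deriv_boundary'
      (f := fun v => rieszMean (sqf h) (M + 1) v - e * (v ^ (i + 2) / ((i + 2).factorial : ℝ)))
      (f' := fun v => rieszMean (sqf h) M v - e * (v ^ (i + 1) / ((i + 1).factorial : ℝ)))
      (a := 0) (b := u)
      (B := fun v : ℝ => C * L * ((1 + v) ^ (i + 1) / (i + 1))) (B' := fun x => C * L * (1 + x) ^ i)
      (((continuous_rieszMean _ M).sub (by fun_prop)).continuousOn)
      (fun x _ => (hasDerivWithinAt_rieszMean _ M x).sub (hd x).hasDerivWithinAt)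
      (by
        rw [rieszMean_at_zero]
        simp
        positivity)
      (fun x _ => (hB x).continuousAt.continuousWithinAt)
      (fun x _ => (hB x).hasDerivWithinAt)
      (fun x hx => by rw [Real.norm_eq_abs]; exact ih x hx.1)
      (Set.right_mem_Icc.2 hu)
    rw [Real.norm_eq_abs] at h2
    refine h2.trans ?_
    refine mul_le_mul_of_nonneg_left ?_ hCL
    refine div_le_self (by positivity) ?_
    have := Nat.cast_nonneg (α := ℝ) i
    linarith

/-! ### Sums with logarithmic cutoffs. -/

/-- The cutoff `(log (R / t)) ^ ℓ / ℓ!`, supported on `t < R`. -/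
def logCut (R : ℝ) (ℓ t : ℕ) : ℝ :=
  open Classical in if (t : ℝ) < R then Real.log (R / t) ^ ℓ / (ℓ.factorial : ℝ) else 0

theorem logCut_of_lt {R : ℝ} {t : ℕ} (h : (t : ℝ) < R) (ℓ : ℕ) :
    logCut R ℓ t = Real.log (R / t) ^ ℓ / (ℓ.factorial : ℝ) := by rw [logCut, if_pos h]

theorem logCut_of_le {R : ℝ} {t : ℕ} (h : R ≤ t) (ℓ : ℕ) : logCut R ℓ t = 0 := by
  rw [logCut, if_neg (not_lt.2 h)]

theorem logCut_of_ceil_le {R : ℝ} {t : ℕ} (h : ⌈R⌉₊ ≤ t) (ℓ : ℕ) : logCut R ℓ t = 0 :=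
  logCut_of_le (Nat.ceil_le.1 h) ℓ

theorem logCut_nonneg (R : ℝ) (ℓ t : ℕ) : 0 ≤ logCut R ℓ t := by
  rcases lt_or_ge (t : ℝ) R with h | h
  · rw [logCut_of_lt h]
    rcases Nat.eq_zero_or_pos t with rfl | ht
    · simp only [Nat.cast_zero, div_zero, Real.log_zero]
      positivity
    have ht' : (0 : ℝ) < t := by exact_mod_cast ht
    have : 0 ≤ Real.log (R / t) := Real.log_nonneg (by rw [one_le_div ht']; exact h.le)
    positivity
  · rw [logCut_of_le h]

theorem logCut_le {R : ℝ} (hR : 1 ≤ R) {t : ℕ} (ht : 1 ≤ t) (ℓ : ℕ) :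
    logCut R ℓ t ≤ Real.log R ^ ℓ := by
  have hlog : 0 ≤ Real.log R := Real.log_nonneg hR
  rcases lt_or_ge (t : ℝ) R with h | h
  · rw [logCut_of_lt h]
    have ht' : (1 : ℝ) ≤ t := by exact_mod_cast ht
    have h0 : 0 ≤ Real.log (R / t) := Real.log_nonneg (by rw [one_le_div (by linarith)]; exact h.le)
    have h1 : Real.log (R / t) ≤ Real.log R :=
      Real.log_le_log (by positivity) (div_le_self (by linarith) ht')
    exact (div_le_self (by positivity) (by exact_mod_cast Nat.succ_le_of_lt (Nat.factorial_pos ℓ))).trans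
      (pow_le_pow_left₀ h0 h1 ℓ)
  · rw [logCut_of_le h]; positivity

/-- The normalisation by factorials makes this the source of the binomial coefficients in the
theorem. -/
theorem logCut_mul_logCut (R : ℝ) (m n t : ℕ) :
    logCut R m t * logCut R n t = (m + n).choose m * logCut R (m + n) t := by
  rcases lt_or_ge (t : ℝ) R with h | h
  · have h1 : (((m + n).choose m : ℕ) : ℝ) * m.factorial * n.factorial = (m + n).factorial := by
      have := Nat.choose_mul_factorial_mul_factorial (Nat.le_add_right m n)
      rw [Nat.add_sub_cancel_left] at this
      exact_mod_cast this
    have h2 : (((m + n).choose m : ℕ) : ℝ) ≠ 0 := by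
      exact_mod_cast (Nat.choose_pos (Nat.le_add_right m n)).ne'
    rw [logCut_of_lt h, logCut_of_lt h, logCut_of_lt h, pow_add, ← h1]
    field_simp
  · simp [logCut_of_le h]

/-- The cutoff is strict (t < R) while a Riesz mean includes its endpoint, which matters when `M` =
0. The sum is therefore the left limit of the Riesz mean at u = log(R/r), and the estimate survives
the limit because both its main term and its bound are continuous. -/
theorem exists_sum_sqf_logCut (κ : ℕ) (hκ : 1 ≤ κ) (A : ℝ) (hA : 0 ≤ A) :
    ∃ C : ℝ, 1 ≤ C ∧ ∀ (L : ℝ) (h : ℕ → ℝ), IsSieveWeight κ A L h →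
      ∀ (M : ℕ) (R : ℝ) (r : ℕ), 1 ≤ r → (r : ℝ) < R →
      |∑ n ∈ Finset.Ico 1 ⌈R⌉₊, sqf h n * logCut R M (r * n)
        - eulerConst κ h * (Real.log (R / r) ^ (κ + M) / ((κ + M).factorial : ℝ))|
        ≤ C * L * (1 + Real.log (R / r)) ^ (κ + M - 1) := by
  obtain ⟨C, hC, hmain⟩ := exists_rieszMean_asymptotic κ hκ A hA
  refine ⟨C, hC, fun L h hh M R r hr hrR => ?_⟩
  have hr0 : (0 : ℝ) < r := by exact_mod_cast hr
  have hR0 : (0 : ℝ) < R := by linarith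
  set u := Real.log (R / r)
  have hu : 0 < u := Real.log_pos (by rwa [one_lt_div hr0])
  have hexp : Real.exp u = R / r := Real.exp_log (by positivity)
  set lim : ℕ → ℝ := fun n => open Classical in
    if Real.log n < u then (u - Real.log n) ^ M / (M.factorial : ℝ) else 0
  have h1 : ∀ n ∈ Finset.Ico 1 ⌈R⌉₊, logCut R M (r * n) = lim n := by
    intro n hn
    have hn0 : (0 : ℝ) < n := by exact_mod_cast (Finset.mem_Ico.1 hn).1
    have h2 : Real.log n < u ↔ ((r * n : ℕ) : ℝ) < R := by
      rw [Real.log_lt_iff_lt_exp hn0, hexp, lt_div_iff₀ hr0]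
      push_cast
      rw [mul_comm]
    unfold logCut
    simp only [lim, h2]
    split_ifs with h3
    · have : Real.log (R / ((r * n : ℕ) : ℝ)) = u - Real.log n := by
        push_cast
        rw [← div_div, Real.log_div (by positivity) hn0.ne']
      rw [this]
    · rfl
  rw [Finset.sum_congr rfl fun n hn => by rw [h1 n hn]]
  have h3 : ∑ n ∈ Finset.Ico 1 ⌈R⌉₊, sqf h n * lim n
      = ∑ n ∈ Finset.Icc 1 ⌊Real.exp u⌋₊, sqf h n * lim n := by
    rw [← Finset.sum_filter_of_ne (p := fun n : ℕ => Real.log n < u)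
        (s := Finset.Ico 1 ⌈R⌉₊) (fun n _ hn => by
          by_contra h'
          exact hn (by simp only [lim, if_neg h', mul_zero])),
      ← Finset.sum_filter_of_ne (p := fun n : ℕ => Real.log n < u)
        (s := Finset.Icc 1 ⌊Real.exp u⌋₊) (fun n _ hn => by
          by_contra h'
          exact hn (by simp only [lim, if_neg h', mul_zero]))]
    refine Finset.sum_congr ?_ fun _ _ => rfl
    ext n
    simp only [Finset.mem_filter, Finset.mem_Ico, Finset.mem_Icc]
    constructor
    · rintro ⟨⟨h4, _⟩, h5⟩
      refine ⟨⟨h4, (Nat.le_floor_iff (Real.exp_pos u).le).2 ?_⟩, h5⟩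
      exact ((Real.log_lt_iff_lt_exp (by exact_mod_cast h4)).1 h5).le
    · rintro ⟨⟨h4, _⟩, h5⟩
      refine ⟨⟨h4, Nat.lt_ceil.2 ?_⟩, h5⟩
      have h6 := (Real.log_lt_iff_lt_exp (by exact_mod_cast h4)).1 h5
      rw [hexp] at h6
      exact h6.trans_le (div_le_self hR0.le (by exact_mod_cast hr))
  rw [h3]
  have htend : Tendsto (rieszMean (sqf h) M) (𝓝[<] u)
      (𝓝 (∑ n ∈ Finset.Icc 1 ⌊Real.exp u⌋₊, sqf h n * lim n)) := by
    have h4 : Tendsto (fun v => ∑ n ∈ Finset.Icc 1 ⌊Real.exp u⌋₊,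
        sqf h n * truncMonomial M (Real.log n) v) (𝓝[<] u)
        (𝓝 (∑ n ∈ Finset.Icc 1 ⌊Real.exp u⌋₊, sqf h n * lim n)) := by
      refine tendsto_finsetSum _ fun n _ => Tendsto.const_mul _ ?_
      by_cases h5 : Real.log n < u
      · simp only [lim, if_pos h5]
        have h6 : Continuous (fun v => (v - Real.log n) ^ M / (M.factorial : ℝ)) := by fun_prop
        refine ((h6.tendsto u).mono_left nhdsWithin_le_nhds).congr' ?_
        filter_upwards [mem_nhdsWithin_of_mem_nhds (Ioi_mem_nhds h5)] with v hv
        rw [truncMonomial, if_pos (le_of_lt hv)]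
      · simp only [lim, if_neg h5]
        refine tendsto_const_nhds.congr' ?_
        filter_upwards [self_mem_nhdsWithin] with v hv
        have hvu : v < u := hv
        rw [truncMonomial, if_neg (by linarith)]
    refine h4.congr' ?_
    filter_upwards [self_mem_nhdsWithin] with v hv
    exact (rieszMean_eq (sqf h) M (le_of_lt hv)).symm
  have hmainc : Continuous fun v : ℝ =>
    eulerConst κ h * (v ^ (κ + M) / ((κ + M).factorial : ℝ)) := by fun_prop
  have hbc : Continuous fun v : ℝ => C * L * (1 + v) ^ (κ + M - 1) := by fun_prop
  refine le_of_tendsto_of_tendsto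
    (htend.sub ((hmainc.tendsto u).mono_left nhdsWithin_le_nhds)).abs
    ((hbc.tendsto u).mono_left nhdsWithin_le_nhds) ?_
  filter_upwards [mem_nhdsWithin_of_mem_nhds (Ioi_mem_nhds hu)] with v hv
  exact hmain L h hh M v (le_of_lt hv)

/-- A sum of products of two quantities, each close to a power of the logarithm. -/
theorem exists_sum_sqf_mul_mul (κ : ℕ) (hκ : 1 ≤ κ) (A D : ℝ) (hA : 0 ≤ A) (hD : 0 ≤ D)
    (m₁ m₂ : ℕ) (hm₁ : 1 ≤ m₁) (hm₂ : 1 ≤ m₂) :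
    ∃ C : ℝ, 0 ≤ C ∧ ∀ (L : ℝ) (h W : ℕ → ℝ), IsSieveWeight κ A L h →
      (∀ p, p.Prime → 1 ≤ W p) →
      (∀ p, p.Prime → h p * W p ^ 2 ≤ κ / p + A * (p : ℝ) ^ (-(3 / 2) : ℝ)) →
      ∀ (R : ℝ) (Z₁ Z₂ : ℕ → ℝ), 1 < R →
      (∀ r : ℕ, Squarefree r → (r : ℝ) < R →
        |Z₁ r - logCut R m₁ r| ≤ D * L * sqf W r * (1 + Real.log R) ^ (m₁ - 1)) →
      (∀ r : ℕ, Squarefree r → (r : ℝ) < R →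
        |Z₂ r - logCut R m₂ r| ≤ D * L * sqf W r * (1 + Real.log R) ^ (m₂ - 1)) →
      (∀ r : ℕ, Squarefree r → (r : ℝ) < R → |Z₂ r| ≤ D * sqf W r * (1 + Real.log R) ^ m₂) →
      |∑ r ∈ Finset.Ico 1 ⌈R⌉₊, sqf h r * (Z₁ r * Z₂ r)
        - (m₁ + m₂).choose m₁ * (eulerConst κ h
          * (Real.log R ^ (κ + m₁ + m₂) / ((κ + m₁ + m₂).factorial : ℝ)))|
        ≤ C * L * (1 + Real.log R) ^ (κ + m₁ + m₂ - 1) := by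
  obtain ⟨C₁, hC₁, hG⟩ := sum_sqf_le κ A hA
  obtain ⟨C₂, hC₂, hT⟩ := exists_sum_sqf_logCut κ hκ A hA
  refine ⟨C₁ * (D * D + D) + (m₁ + m₂).choose m₁ * C₂, by positivity, ?_⟩
  intro L h W hh hW hhW R Z₁ Z₂ hR hZ₁ hZ₂ hZ₂'
  obtain ⟨i, rfl⟩ : ∃ i, m₁ = i + 1 := ⟨m₁ - 1, by omega⟩
  obtain ⟨j, rfl⟩ : ∃ j, m₂ = j + 1 := ⟨m₂ - 1, by omega⟩
  simp only [Nat.add_sub_cancel] at hZ₁ hZ₂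
  have hL : 1 ≤ L := hh.one_le
  have hlog : 0 < Real.log R := Real.log_pos hR
  set ρ := 1 + Real.log R
  have hρ : 1 ≤ ρ := by simp only [ρ]; linarith
  set S := Finset.Ico 1 ⌈R⌉₊
  have hS : ∀ r ∈ S, 1 ≤ r ∧ (r : ℝ) < R := fun r hr => by
    rw [Finset.mem_Ico, Nat.lt_ceil] at hr; exact hr
  -- The errors of the two factors may grow with the primes of r; since h W² satisfies the same
  -- upper bound as h, this costs nothing on average.
  have hWS : ∑ r ∈ S, sqf h r * sqf W r ^ 2 ≤ C₁ * ρ ^ κ := by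
    have h1 := hG (fun p => h p * W p ^ 2) (fun p hp => mul_nonneg (hh.nonneg p hp) (sq_nonneg _))
      hhW R hR.le S fun r hr => ⟨(hS r hr).1, (hS r hr).2.le⟩
    refine le_trans (le_of_eq (Finset.sum_congr rfl fun r _ => ?_)) h1
    rw [sq, sqf_mul_sqf W W, sqf_mul_sqf]
    exact sqf_congr fun p _ _ => by rw [sq]
  have hterm : ∀ r ∈ S, |sqf h r * (Z₁ r * Z₂ r)
      - sqf h r * (logCut R (i + 1) r * logCut R (j + 1) r)|
      ≤ sqf h r * sqf W r ^ 2 * ((D * D + D) * L * ρ ^ (i + j + 1)) := by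
    intro r hr
    obtain ⟨hr1, hrR⟩ := hS r hr
    by_cases hsq : Squarefree r
    swap
    · simp [sqf_of_not_squarefree _ hsq]
    have hh0 := sqf_nonneg hh.nonneg r
    have hW0 : 1 ≤ sqf W r := by
      rw [sqf_of_squarefree _ hsq]
      have : ∏ p ∈ r.primeFactors, (1 : ℝ) ≤ ∏ p ∈ r.primeFactors, W p :=
        Finset.prod_le_prod (fun _ _ => zero_le_one)
          fun p hp => hW p (Nat.prime_of_mem_primeFactors hp)
      simpa using this
    rw [← mul_sub, abs_mul, abs_of_nonneg hh0, mul_assoc]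
    refine mul_le_mul_of_nonneg_left ?_ hh0
    -- This asymmetric splitting is why a size bound is asked of `Z₂` only.
    have h1 : Z₁ r * Z₂ r - logCut R (i + 1) r * logCut R (j + 1) r
        = (Z₁ r - logCut R (i + 1) r) * Z₂ r
          + logCut R (i + 1) r * (Z₂ r - logCut R (j + 1) r) := by ring
    have hcut : logCut R (i + 1) r ≤ ρ ^ (i + 1) :=
      (logCut_le hR.le hr1 _).trans (pow_le_pow_left₀ hlog.le (by simp only [ρ]; linarith) _)
    rw [h1]
    refine (abs_add_le _ _).trans ?_
    rw [abs_mul, abs_mul, abs_of_nonneg (logCut_nonneg _ _ _)]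
    have h2 := mul_le_mul (hZ₁ r hsq hrR) (hZ₂' r hsq hrR) (abs_nonneg _) (by positivity)
    have h3 := mul_le_mul hcut (hZ₂ r hsq hrR) (abs_nonneg _) (by positivity)
    have h4 : ρ ^ (i + 1) * (D * L * sqf W r * ρ ^ j)
        ≤ ρ ^ (i + 1) * (D * L * (sqf W r ^ 2) * ρ ^ j) := by
      have : sqf W r ≤ sqf W r ^ 2 := by nlinarith
      gcongr
    refine (add_le_add h2 (h3.trans h4)).trans (le_of_eq ?_)
    ring
  have hsum : |∑ r ∈ S, sqf h r * (Z₁ r * Z₂ r)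
      - ∑ r ∈ S, sqf h r * (logCut R (i + 1) r * logCut R (j + 1) r)|
      ≤ C₁ * (D * D + D) * L * ρ ^ (κ + i + j + 1) := by
    rw [← Finset.sum_sub_distrib]
    refine (Finset.abs_sum_le_sum_abs _ _).trans ((Finset.sum_le_sum hterm).trans ?_)
    rw [← Finset.sum_mul]
    refine (mul_le_mul_of_nonneg_right hWS (by positivity)).trans (le_of_eq ?_)
    ring
  have hmain := hT L h hh (i + 1 + (j + 1)) R 1 le_rfl (by simpa using hR)
  simp only [one_mul, Nat.cast_one, div_one] at hmain
  have h5 : ∑ r ∈ S, sqf h r * (logCut R (i + 1) r * logCut R (j + 1) r)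
      = (i + 1 + (j + 1)).choose (i + 1) * ∑ r ∈ S, sqf h r * logCut R (i + 1 + (j + 1)) r := by
    rw [Finset.mul_sum]
    refine Finset.sum_congr rfl fun r _ => ?_
    rw [logCut_mul_logCut]; ring
  rw [h5] at hsum
  rw [show κ + (i + 1) + (j + 1) = κ + (i + 1 + (j + 1)) by ring]
  rw [show κ + (i + 1 + (j + 1)) - 1 = κ + i + j + 1 by omega] at hmain ⊢
  set b : ℝ := (((i + 1 + (j + 1)).choose (i + 1) : ℕ) : ℝ)
  have hb : 0 ≤ b := Nat.cast_nonneg _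
  have h6 := mul_le_mul_of_nonneg_left hmain hb
  rw [← abs_of_nonneg hb, ← abs_mul, abs_of_nonneg hb] at h6
  refine (abs_sub_le _ _ _).trans ((add_le_add hsum (le_trans (le_of_eq ?_) h6)).trans (le_of_eq ?_))
  · rw [mul_sub]
  · ring

/-! ### Counting residue classes by the Chinese remainder theorem. -/

section Count

open Classical in
/-- The number of residues `a` in `[0, q)` with property `P q a`. -/
def residueCount (P : ℕ → ℤ → Prop) (q : ℕ) : ℕ :=
  ((Finset.range q).filter (fun a : ℕ => P q (a : ℤ))).card

/-- A family of properties of residues that is compatible with the Chinese remainder theorem. -/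
structure IsResidueFamily (P : ℕ → ℤ → Prop) : Prop where
  one : P 1 0
  periodic : ∀ (q : ℕ) (a b : ℤ), (q : ℤ) ∣ a - b → P q a → P q b
  mul : ∀ (m n : ℕ) (a : ℤ), m.Coprime n → (P (m * n) a ↔ P m a ∧ P n a)

theorem residueCount_mul {P : ℕ → ℤ → Prop} (hP : IsResidueFamily P) {m n : ℕ}
    (h : m.Coprime n) : residueCount P (m * n) = residueCount P m * residueCount P n := by
  classical
  rcases Nat.eq_zero_or_pos m with rfl | hm
  · simp [residueCount]
  rcases Nat.eq_zero_or_pos n with rfl | hn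
  · simp [residueCount]
  have hmod : ∀ (q a : ℕ), P q ((a % q : ℕ) : ℤ) ↔ P q (a : ℤ) := fun q a => by
    have h1 : (q : ℤ) ∣ (a : ℤ) - ((a % q : ℕ) : ℤ) := by
      push_cast
      exact Int.dvd_self_sub_emod
    exact ⟨hP.periodic _ _ _ (by rw [← Int.dvd_neg, neg_sub]; exact h1), hP.periodic _ _ _ h1⟩
  unfold residueCount
  rw [← Finset.card_product]
  refine Finset.card_bij' (fun a _ => (a % m, a % n))
    (fun x _ => (Nat.chineseRemainder h x.1 x.2 : ℕ)) ?_ ?_ ?_ ?_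
  · intro a ha
    simp only [Finset.mem_filter, Finset.mem_range] at ha
    have h1 := (hP.mul m n a h).1 ha.2
    simp only [Finset.mem_product, Finset.mem_filter, Finset.mem_range]
    exact ⟨⟨Nat.mod_lt _ hm, (hmod m a).2 h1.1⟩, Nat.mod_lt _ hn, (hmod n a).2 h1.2⟩
  · rintro ⟨x, y⟩ hxy
    simp only [Finset.mem_product, Finset.mem_filter, Finset.mem_range] at hxy
    simp only [Finset.mem_filter, Finset.mem_range]
    refine ⟨Nat.chineseRemainder_lt_mul h x y hm.ne' hn.ne', (hP.mul m n _ h).2 ⟨?_, ?_⟩⟩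
    · have h1 := (Nat.chineseRemainder h x y).2.1
      rw [← hmod, h1, hmod]; exact hxy.1.2
    · have h1 := (Nat.chineseRemainder h x y).2.2
      rw [← hmod, h1, hmod]; exact hxy.2.2
  · intro a ha
    simp only [Finset.mem_filter, Finset.mem_range] at ha
    have h1 := Nat.chineseRemainder_modEq_unique h (a := a % m) (b := a % n) (z := a)
      (Nat.mod_modEq a m).symm (Nat.mod_modEq a n).symm
    have h2 := Nat.chineseRemainder_lt_mul h (a % m) (a % n) hm.ne' hn.ne'
    unfold Nat.ModEq at h1
    rw [Nat.mod_eq_of_lt ha.1, Nat.mod_eq_of_lt h2] at h1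
    exact h1.symm
  · rintro ⟨x, y⟩ hxy
    simp only [Finset.mem_product, Finset.mem_filter, Finset.mem_range] at hxy
    have h1 := (Nat.chineseRemainder h x y).2.1
    have h2 := (Nat.chineseRemainder h x y).2.2
    exact Prod.ext (Eq.trans (b := x % m) h1 (Nat.mod_eq_of_lt hxy.1.1))
      (Eq.trans (b := y % n) h2 (Nat.mod_eq_of_lt hxy.2.1))

theorem residueCount_squarefree {P : ℕ → ℤ → Prop} (hP : IsResidueFamily P) {q : ℕ}
    (hq : Squarefree q) : residueCount P q = ∏ p ∈ q.primeFactors, residueCount P p := by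
  classical
  have h1 : residueCount P 1 = 1 := by
    unfold residueCount
    rw [Finset.filter_true_of_mem]
    · simp
    · intro a ha
      have : a = 0 := by simpa using ha
      rw [this]; exact hP.one
  let f : ArithmeticFunction ℕ := ⟨residueCount P, by simp [residueCount]⟩
  have hf : f.IsMultiplicative := ⟨h1, fun hmn => residueCount_mul hP hmn⟩
  have h2 := hf.map_prod_of_subset_primeFactors q q.primeFactors subset_rfl
  rw [Nat.prod_primeFactors_of_squarefree hq] at h2
  exact h2

theorem tuplePoly_sub_dvd (H : Finset ℤ) (q a b : ℤ) (h : q ∣ a - b) :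
    q ∣ tuplePoly H a - tuplePoly H b := by
  unfold tuplePoly
  rw [← Int.modEq_iff_dvd] at *
  exact Int.ModEq.prod fun i _ => h.add_right i

theorem isResidueFamily_tuple (H : Finset ℤ) :
    IsResidueFamily (fun q a => (q : ℤ) ∣ tuplePoly H a) where
  one := by simp
  periodic := fun q a b h ha => by
    have := tuplePoly_sub_dvd H q a b h
    exact (Int.dvd_iff_dvd_of_dvd_sub this).1 ha
  mul := fun m n a h => by
    push_cast
    exact ⟨fun h1 => ⟨(dvd_mul_right _ _).trans h1, (dvd_mul_left _ _).trans h1⟩,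
      fun h1 => (Nat.isCoprime_iff_coprime.2 h).mul_dvd h1.1 h1.2⟩

theorem isResidueFamily_coprime (H : Finset ℤ) (h₀ : ℤ) :
    IsResidueFamily (fun q a => (q : ℤ) ∣ tuplePoly H a ∧ IsCoprime (a + h₀) (q : ℤ)) where
  one := by simpa using isCoprime_one_right
  periodic := fun q a b h ha => by
    refine ⟨(isResidueFamily_tuple H).periodic q a b h ha.1, ?_⟩
    obtain ⟨c, hc⟩ := h
    have : b + h₀ = (a + h₀) + (q : ℤ) * (-c) := by linear_combination -hc
    rw [this]
    exact IsCoprime.add_mul_left_left ha.2 _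
  mul := fun m n a h => by
    rw [(isResidueFamily_tuple H).mul m n a h]
    push_cast
    rw [IsCoprime.mul_right_iff]
    tauto

theorem nu_eq_residueCount (H : Finset ℤ) (q : ℕ) :
    nu H q = residueCount (fun q a => (q : ℤ) ∣ tuplePoly H a) q := by
  unfold nu residueCount
  congr

theorem nu_squarefree (H : Finset ℤ) {d : ℕ} (hd : Squarefree d) :
    nu H d = ∏ p ∈ d.primeFactors, nuPrime H p := by
  rw [nu_eq_residueCount, residueCount_squarefree (isResidueFamily_tuple H) hd]
  refine Finset.prod_congr rfl fun p hp => ?_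
  rw [← nu_eq_residueCount, nu_prime H p (Nat.prime_of_mem_primeFactors hp)]

/-- The number of residues `a` mod `q` with `q ∣ P(a; H)` and `a + h₀` coprime to `q`. -/
def coprimeCount (H : Finset ℤ) (h₀ : ℤ) (q : ℕ) : ℕ :=
  residueCount (fun q a => (q : ℤ) ∣ tuplePoly H a ∧ IsCoprime (a + h₀) (q : ℤ)) q

/-- The roots mod p of the polynomial of `insert h₀ H` are the admitted classes together with the
single class -h₀, whether or not h₀ already lies in H. -/
theorem coprimeCount_prime (H : Finset ℤ) (h₀ : ℤ) {p : ℕ} (hp : p.Prime) :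
    coprimeCount H h₀ p + 1 = nuPrime (insert h₀ H) p := by
  classical
  have := Fact.mk hp
  have hcop : ∀ a : ℤ, IsCoprime (a + h₀) (p : ℤ) ↔ ¬ (p : ℤ) ∣ a + h₀ := fun a => by
    rw [isCoprime_comm]
    exact (Nat.prime_iff_prime_int.1 hp).coprime_iff_not_dvd
  have hone : ((Finset.range p).filter (fun a : ℕ => (p : ℤ) ∣ (a : ℤ) + h₀)).card = 1 := by
    rw [Finset.card_eq_one]
    refine ⟨(-(h₀ : ZMod p)).val, ?_⟩
    ext a
    simp only [Finset.mem_filter, Finset.mem_range, Finset.mem_singleton]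
    rw [← ZMod.intCast_zmod_eq_zero_iff_dvd]
    push_cast
    constructor
    · rintro ⟨h1, h2⟩
      rw [← eq_neg_of_add_eq_zero_left h2, ZMod.val_natCast, Nat.mod_eq_of_lt h1]
    · rintro rfl
      exact ⟨ZMod.val_lt _, by simp⟩
  have hpoly : ∀ a : ℤ, (p : ℤ) ∣ tuplePoly (insert h₀ H) a
      ↔ ((p : ℤ) ∣ tuplePoly H a ∧ ¬ (p : ℤ) ∣ a + h₀) ∨ (p : ℤ) ∣ a + h₀ := fun a => by
    by_cases h : h₀ ∈ H
    · rw [Finset.insert_eq_of_mem h]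
      have : a + h₀ ∣ tuplePoly H a := Finset.dvd_prod_of_mem _ h
      by_cases h1 : (p : ℤ) ∣ a + h₀
      · simp [h1, h1.trans this]
      · simp [h1]
    · unfold tuplePoly
      rw [Finset.prod_insert h, (Nat.prime_iff_prime_int.1 hp).dvd_mul]
      tauto
  rw [← nu_prime _ p hp, ← hone]
  unfold coprimeCount residueCount nu
  rw [← Finset.card_union_of_disjoint]
  · congr 1
    ext a
    simp only [Finset.mem_union, Finset.mem_filter, Finset.mem_range, hpoly, hcop]
    tauto
  · rw [Finset.disjoint_left]
    intro a h1 h2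
    simp only [Finset.mem_filter] at h1 h2
    exact ((hcop _).1 h1.2.2) h2.2

theorem coprimeCount_squarefree (H : Finset ℤ) (h₀ : ℤ) {q : ℕ} (hq : Squarefree q) :
    (coprimeCount H h₀ q : ℝ) = sqf (fun p => (nuPrime (insert h₀ H) p : ℝ) - 1) q := by
  rw [coprimeCount, residueCount_squarefree (isResidueFamily_coprime H h₀) hq,
    sqf_of_squarefree _ hq, Nat.cast_prod]
  refine Finset.prod_congr rfl fun p hp => ?_
  have := coprimeCount_prime H h₀ (Nat.prime_of_mem_primeFactors hp)
  rw [← this]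
  push_cast
  rw [coprimeCount]
  ring

end Count

/-! ### The local counts ν_p and the sum β. -/

theorem nuPrime_le_card (H : Finset ℤ) (p : ℕ) : nuPrime H p ≤ H.card := Finset.card_image_le

theorem one_le_nuPrime {H : Finset ℤ} (hH : H.Nonempty) (p : ℕ) : 1 ≤ nuPrime H p :=
  Finset.card_pos.2 (hH.image _)

theorem nuPrime_le_insert (H : Finset ℤ) (h₀ : ℤ) (p : ℕ) :
    nuPrime H p ≤ nuPrime (insert h₀ H) p :=
  Finset.card_le_card (Finset.image_subset_image (Finset.subset_insert _ _))

theorem nuPrime_insert_le (H : Finset ℤ) (h₀ : ℤ) (p : ℕ) :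
    nuPrime (insert h₀ H) p ≤ nuPrime H p + 1 := by
  unfold nuPrime
  rw [Finset.image_insert]
  exact Finset.card_insert_le _ _

theorem Admissible.of_insert {H : Finset ℤ} {h₀ : ℤ} (h : Admissible (insert h₀ H)) :
    Admissible H := fun p hp => (nuPrime_le_insert H h₀ p).trans_lt (h p hp)

/-- If two elements of H collide mod p, then p divides their nonzero difference. -/
theorem finite_nuPrime_ne_card (H : Finset ℤ) :
    {p : Nat.Primes | nuPrime H p ≠ H.card}.Finite := by
  have h1 : {p : Nat.Primes | nuPrime H p ≠ H.card} ⊆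
      (fun p : Nat.Primes => (p : ℕ)) ⁻¹' (Set.Iic (∑ x ∈ H ×ˢ H, (x.1 - x.2).natAbs)) := by
    intro p hp
    have h2 : ¬ Set.InjOn (fun h : ℤ => (h : ZMod p)) H := fun h =>
      hp (Finset.card_image_of_injOn h)
    simp only [Set.InjOn, not_forall] at h2
    obtain ⟨a, ha, b, hb, hab, hne⟩ := h2
    have h3 : ((p : ℕ) : ℤ) ∣ a - b := by
      rw [← ZMod.intCast_zmod_eq_zero_iff_dvd]
      push_cast
      exact sub_eq_zero.2 hab
    have h4 : (p : ℕ) ≤ (a - b).natAbs :=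
      Nat.le_of_dvd (Int.natAbs_pos.2 (sub_ne_zero.2 hne)) (Int.natCast_dvd.1 h3)
    refine h4.trans ?_
    exact Finset.single_le_sum (f := fun x : ℤ × ℤ => (x.1 - x.2).natAbs) (fun _ _ => Nat.zero_le _)
      (Finset.mem_product.2 ⟨Finset.mem_coe.1 ha, Finset.mem_coe.1 hb⟩ : (a, b) ∈ H ×ˢ H)
  exact ((Set.finite_Iic _).preimage (Subtype.val_injective.injOn)).subset h1

section Beta

variable (H : Finset ℤ)

theorem beta_term_nonneg (p : ℕ) :
    0 ≤ ((H.card : ℝ) - (nuPrime H p : ℝ)) * Real.log p / p := by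
  have : (nuPrime H p : ℝ) ≤ H.card := by exact_mod_cast nuPrime_le_card H p
  have := Real.log_natCast_nonneg p
  exact div_nonneg (mul_nonneg (by linarith) this) (Nat.cast_nonneg _)

theorem summable_beta : Summable (fun p : Nat.Primes =>
    ((H.card : ℝ) - (nuPrime H (p : ℕ) : ℝ)) * Real.log ((p : ℕ) : ℝ) / ((p : ℕ) : ℝ)) := by
  refine summable_of_hasFiniteSupport ((finite_nuPrime_ne_card H).subset fun p hp h => hp ?_)
  simp only
  rw [h]; simp

theorem sum_le_beta (S : Finset ℕ) (hS : ∀ p ∈ S, p.Prime) :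
    ∑ p ∈ S, ((H.card : ℝ) - (nuPrime H p : ℝ)) * Real.log p / p ≤ beta H := by
  classical
  have h1 : ∑ p ∈ S.subtype Nat.Prime,
      ((H.card : ℝ) - (nuPrime H (p : ℕ) : ℝ)) * Real.log ((p : ℕ) : ℝ) / ((p : ℕ) : ℝ) ≤ beta H :=
    Summable.sum_le_tsum (ι := Nat.Primes) (S.subtype Nat.Prime)
      (fun p _ => beta_term_nonneg H p) (summable_beta H)
  rw [Finset.sum_subtype_of_mem (p := Nat.Prime)
    (fun p : ℕ => ((H.card : ℝ) - (nuPrime H p : ℝ)) * Real.log p / p) hS] at h1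
  exact h1

/-- The prime 2 alone suffices, since admissibility forces ν_2 ≤ 1. This lower bound lets constants
depending only on k be absorbed into β. -/
theorem le_beta (hH : Admissible H) (hc : 2 ≤ H.card) : Real.log 2 / 2 ≤ beta H := by
  have h1 := sum_le_beta H {2} (by simp [Nat.prime_two])
  have h2 : nuPrime H 2 ≤ 1 := Nat.lt_succ_iff.1 (hH 2 Nat.prime_two)
  have h3 : (nuPrime H 2 : ℝ) ≤ 1 := by exact_mod_cast h2
  have h4 : (2 : ℝ) ≤ H.card := by exact_mod_cast hc
  rw [Finset.sum_singleton] at h1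
  refine le_trans ?_ h1
  have := Real.log_pos (one_lt_two (α := ℝ))
  push_cast
  refine div_le_div_of_nonneg_right ?_ (by norm_num)
  exact le_mul_of_one_le_left this.le (by linarith)

end Beta

theorem hasProd_nonneg {ι : Type*} {f : ι → ℝ} {a : ℝ} (hf : HasProd f a)
    (h0 : ∀ i, 0 ≤ f i) : 0 ≤ a :=
  ge_of_tendsto' hf fun _ => Finset.prod_nonneg fun i _ => h0 i

/-! ### The density weight h and the singular series. -/

section Density

/-- The weight `(ν_p - 1) / (p - ν_p)`. -/
def densityWeight (H : Finset ℤ) (p : ℕ) : ℝ :=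
  ((nuPrime H p : ℝ) - 1) / ((p : ℝ) - nuPrime H p)

/-- From p - ν ≥ 1 and ν ≤ k one has ν ≤ k (p - ν). This compares p with p - ν uniformly, small
primes included. -/
theorem le_mul_sub_of_lt {p ν k : ℝ} (h1 : ν ≤ k) (h2 : ν + 1 ≤ p) (h0 : 0 ≤ ν) :
    p ≤ (p - ν) * (k + 1) := by nlinarith

theorem Admissible.add_one_le {H : Finset ℤ} (hH : Admissible H) {p : ℕ} (hp : p.Prime) :
    (nuPrime H p : ℝ) + 1 ≤ p := by exact_mod_cast hH p hp

variable {H : Finset ℤ}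

theorem densityWeight_nonneg (hH : Admissible H) (hne : H.Nonempty) {p : ℕ} (hp : p.Prime) :
    0 ≤ densityWeight H p := by
  have h1 : (1 : ℝ) ≤ nuPrime H p := by exact_mod_cast one_le_nuPrime hne p
  have := hH.add_one_le hp
  exact div_nonneg (by linarith) (by linarith)

theorem densityWeight_bounds (hH : Admissible H) (hne : H.Nonempty) {p : ℕ} (hp : p.Prime) :
    ((nuPrime H p : ℝ) - 1) / p ≤ densityWeight H p ∧
    densityWeight H p ≤ ((nuPrime H p : ℝ) - 1) / p
      + (H.card : ℝ) ^ 2 * (H.card + 1) * (1 / (p : ℝ) ^ 2) := by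
  have h1 : (1 : ℝ) ≤ nuPrime H p := by exact_mod_cast one_le_nuPrime hne p
  have h2 := hH.add_one_le hp
  have h3 : (nuPrime H p : ℝ) ≤ H.card := by exact_mod_cast nuPrime_le_card H p
  have hp0 : (0 : ℝ) < p := by exact_mod_cast hp.pos
  set ν : ℝ := (nuPrime H p : ℝ)
  set k : ℝ := (H.card : ℝ)
  have hd : 0 < (p : ℝ) - ν := by linarith
  have h4 : densityWeight H p = (ν - 1) / p + (ν - 1) * ν * (1 / (p * (p - ν))) := by
    change (ν - 1) / (p - ν) = _
    field_simp
    ring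
  rw [h4]
  constructor
  · have : 0 ≤ (ν - 1) * ν * (1 / (p * (p - ν))) :=
      mul_nonneg (mul_nonneg (by linarith) (by linarith)) (by positivity)
    linarith
  · have h5 : 1 / (p * (p - ν)) ≤ (k + 1) * (1 / (p : ℝ) ^ 2) := by
      rw [mul_one_div, div_le_div_iff₀ (by positivity) (by positivity)]
      have := le_mul_sub_of_lt h3 h2 (by linarith)
      nlinarith
    have h6 : (ν - 1) * ν ≤ k ^ 2 := by nlinarith
    have h7 : (ν - 1) * ν * (1 / (p * (p - ν))) ≤ k ^ 2 * ((k + 1) * (1 / (p : ℝ) ^ 2)) :=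
      mul_le_mul h6 h5 (by positivity) (by positivity)
    linarith

theorem inv_sq_le_rpow {p : ℕ} (hp : 1 ≤ p) : 1 / (p : ℝ) ^ 2 ≤ (p : ℝ) ^ (-(3 / 2) : ℝ) := by
  have hp1 : (1 : ℝ) ≤ p := by exact_mod_cast hp
  have : 1 / (p : ℝ) ^ 2 = (p : ℝ) ^ (-2 : ℝ) := by
    rw [Real.rpow_neg (by linarith), one_div]
    norm_num
  rw [this]
  exact Real.rpow_le_rpow_of_exponent_le hp1 (by norm_num)

/-- The discrepancy h(p) - (k-1)/p is -(k - ν_p)/p + O(1/p²). Against log p the first part sums to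
at most β and the second to a constant, which `le_beta` absorbs. -/
theorem exists_isSieveWeight_density (k : ℕ) (hk : 2 ≤ k) : ∃ A C : ℝ, 0 ≤ A ∧ 1 ≤ C ∧
    ∀ H : Finset ℤ, H.card = k → Admissible H →
      IsSieveWeight (k - 1) A (C * beta H) (densityWeight H) := by
  set B : ℝ := (k : ℝ) ^ 2 * (k + 1)
  have hB : 0 ≤ B := by positivity
  set Z : ℝ := 2 * ∑' n : ℕ, (n : ℝ) ^ (-(3 / 2) : ℝ)
  have hZ : 0 ≤ Z := mul_nonneg (by norm_num) (tsum_nonneg fun n => by positivity)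
  have hl : 0 < Real.log 2 := Real.log_pos (by norm_num)
  refine ⟨B, 1 + (1 + B * Z) * (2 / Real.log 2), hB, ?_, ?_⟩
  · have : 0 ≤ (1 + B * Z) * (2 / Real.log 2) := by positivity
    linarith
  intro H hHk hH
  have hne : H.Nonempty := Finset.card_pos.1 (by omega)
  have hβ := le_beta H hH (by omega)
  have hβ0 : 0 < beta H := lt_of_lt_of_le (by positivity) hβ
  have hk1 : ((k - 1 : ℕ) : ℝ) = (H.card : ℝ) - 1 := by
    rw [hHk, Nat.cast_sub (by omega), Nat.cast_one]
  have hb : 1 + B * Z ≤ (1 + B * Z) * (2 / Real.log 2) * beta H := by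
    have h1 : 1 ≤ 2 / Real.log 2 * beta H := by
      rw [div_mul_eq_mul_div, one_le_div hl]; linarith
    rw [mul_assoc (1 + B * Z)]
    exact le_mul_of_one_le_right (by positivity) h1
  refine ⟨fun p hp => densityWeight_nonneg hH hne hp, ?_, ?_, ?_⟩
  · intro p hp
    have h1 := (densityWeight_bounds hH hne hp).2
    have h2 : (nuPrime H p : ℝ) ≤ H.card := by exact_mod_cast nuPrime_le_card H p
    have hp0 : (0 : ℝ) < p := by exact_mod_cast hp.pos
    have h3 : ((nuPrime H p : ℝ) - 1) / p ≤ ((k - 1 : ℕ) : ℝ) / p := by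
      rw [hk1]; gcongr
    have h4 := mul_le_mul_of_nonneg_left (inv_sq_le_rpow hp.one_le) hB
    rw [hHk] at h1
    linarith
  · intro S hS
    have h1 : ∀ p ∈ S, |densityWeight H p - ((k - 1 : ℕ) : ℝ) / p| * Real.log p
        ≤ ((H.card : ℝ) - nuPrime H p) * Real.log p / p + B * (Real.log p / (p : ℝ) ^ 2) := by
      intro p hp
      have h1 := densityWeight_bounds hH hne (hS p hp)
      have h2 : (nuPrime H p : ℝ) ≤ H.card := by exact_mod_cast nuPrime_le_card H p
      have hp0 : (0 : ℝ) < p := by exact_mod_cast (hS p hp).pos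
      rw [hHk] at h1
      have h3 : |densityWeight H p - ((k - 1 : ℕ) : ℝ) / p|
          ≤ ((H.card : ℝ) - nuPrime H p) / p + B * (1 / (p : ℝ) ^ 2) := by
        have h4 : ((k - 1 : ℕ) : ℝ) / p
            = ((H.card : ℝ) - nuPrime H p) / p + ((nuPrime H p : ℝ) - 1) / p := by
          rw [hk1]; ring
        have h5 : 0 ≤ ((H.card : ℝ) - nuPrime H p) / p := div_nonneg (by linarith) hp0.le
        have h6 : 0 ≤ B * (1 / (p : ℝ) ^ 2) := by positivity
        rw [abs_le]
        constructor <;> linarith [h1.1, h1.2]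
      refine (mul_le_mul_of_nonneg_right h3 (Real.log_natCast_nonneg p)).trans (le_of_eq ?_)
      ring
    refine (Finset.sum_le_sum h1).trans ?_
    rw [Finset.sum_add_distrib, ← Finset.mul_sum]
    have h2 := sum_le_beta H S hS
    have h3 := mul_le_mul_of_nonneg_left (sum_log_div_sq_le S) hB
    nlinarith
  · nlinarith [mul_nonneg hB hZ]

/-- The Euler factor of the singular series. -/
def singularFactor (H : Finset ℤ) (p : ℕ) : ℝ :=
  (1 - (nuPrime H p : ℝ) / (p : ℝ)) * ((1 - 1 / (p : ℝ)) ^ H.card)⁻¹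

/-- Since 1 + h(p) = (p - 1)/(p - ν_p), each Euler factor of the constant is the reciprocal of the
one in 𝔖(H). -/
theorem singularFactor_mul (hH : Admissible H) (hne : H.Nonempty) {p : ℕ} (hp : p.Prime) :
    ((1 + densityWeight H p) * (1 - 1 / (p : ℝ)) ^ (H.card - 1)) * singularFactor H p = 1 := by
  obtain ⟨j, hj⟩ : ∃ j, H.card = j + 1 := ⟨H.card - 1, by have := Finset.card_pos.2 hne; omega⟩
  have h1 : (1 : ℝ) ≤ nuPrime H p := by exact_mod_cast one_le_nuPrime hne p
  have h2 := hH.add_one_le hp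
  have hp1 : (1 : ℝ) < p := by exact_mod_cast hp.one_lt
  have hq : (1 - 1 / (p : ℝ)) ≠ 0 := by
    have : 1 / (p : ℝ) < 1 := by rw [div_lt_one (by linarith)]; exact hp1
    linarith
  unfold singularFactor densityWeight
  rw [hj, Nat.add_sub_cancel, pow_succ, mul_inv]
  set x := (1 - 1 / (p : ℝ))
  have hx : x = (p - 1) / p := by simp only [x]; field_simp
  have hd : (p : ℝ) - nuPrime H p ≠ 0 := by linarith
  have h3 : (1 + ((nuPrime H p : ℝ) - 1) / ((p : ℝ) - nuPrime H p))
      * (1 - (nuPrime H p : ℝ) / (p : ℝ)) = x := by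
    rw [hx]
    field_simp
    ring
  have h4 : x ^ j ≠ 0 := pow_ne_zero _ hq
  calc _ = ((1 + ((nuPrime H p : ℝ) - 1) / ((p : ℝ) - nuPrime H p))
      * (1 - (nuPrime H p : ℝ) / (p : ℝ))) * x⁻¹ * (x ^ j * (x ^ j)⁻¹) := by ring
    _ = 1 := by rw [h3, mul_inv_cancel₀ hq, mul_inv_cancel₀ h4, one_mul]

theorem multipliable_singularFactor (hH : Admissible H) (hk : 2 ≤ H.card) :
    Multipliable (fun p : Nat.Primes => singularFactor H p) := by
  have hne : H.Nonempty := Finset.card_pos.1 (by omega)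
  obtain ⟨A, C, hA, hC, hw⟩ := exists_isSieveWeight_density H.card hk
  have hh := hw H rfl hH
  set κ := H.card - 1
  have h1 : Summable (fun p : Nat.Primes => ‖singularFactor H p - 1‖) := by
    refine Summable.of_nonneg_of_le (fun _ => norm_nonneg _) (fun p => ?_)
      (hh.summable_eulerFactor_bound.mul_left ((2 : ℝ) ^ κ))
    have h2 := hh.abs_eulerFactor_sub_one_le hA p zero_le_one le_rfl
    rw [mul_one] at h2
    have h3 := singularFactor_mul hH hne p.2
    set e := (1 + densityWeight H p) * (1 - 1 / ((p : ℕ) : ℝ)) ^ κ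
    have hp2 : (2 : ℝ) ≤ (p : ℕ) := by exact_mod_cast p.2.two_le
    -- Staying away from 0 lets the summability of e - 1 pass to e⁻¹ - 1.
    have h4 : (1 / 2 : ℝ) ^ κ ≤ e := by
      have h5 : (1 / 2 : ℝ) ≤ 1 - 1 / ((p : ℕ) : ℝ) := by
        have : 1 / ((p : ℕ) : ℝ) ≤ 1 / 2 := one_div_le_one_div_of_le (by norm_num) hp2
        linarith
      have h6 := pow_le_pow_left₀ (by norm_num) h5 κ
      have h7 := densityWeight_nonneg hH hne p.2
      refine h6.trans (le_mul_of_one_le_left ((by positivity : (0 : ℝ) ≤ (1 / 2) ^ κ).trans h6) ?_)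
      linarith
    have he : 0 < e := lt_of_lt_of_le (by positivity) h4
    have h5 : singularFactor H p = e⁻¹ := (inv_eq_of_mul_eq_one_right h3).symm
    have h6 : singularFactor H p - 1 = -(e⁻¹ * (e - 1)) := by
      rw [h5, mul_sub, inv_mul_cancel₀ he.ne']; ring
    rw [h6, norm_neg, norm_mul, Real.norm_eq_abs, Real.norm_eq_abs, abs_of_pos (inv_pos.2 he)]
    refine mul_le_mul ?_ h2 (abs_nonneg _) (by positivity)
    have h7 := inv_anti₀ (by positivity) h4
    simpa using h7
  have := multipliable_one_add_of_summable h1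
  simpa using this

theorem singularSeries_eq : singularSeries H = ∏' p : Nat.Primes, singularFactor H p := rfl

theorem eulerConst_mul_singularSeries (hH : Admissible H) (hk : 2 ≤ H.card) :
    eulerConst (H.card - 1) (densityWeight H) * singularSeries H = 1 := by
  have hne : H.Nonempty := Finset.card_pos.1 (by omega)
  obtain ⟨A, C, hA, hC, hw⟩ := exists_isSieveWeight_density H.card hk
  have hh := hw H rfl hH
  rw [singularSeries_eq, eulerConst,
    ← (hh.multipliable_eulerConst hA).tprod_mul (multipliable_singularFactor hH hk)]
  rw [tprod_congr fun p : Nat.Primes => singularFactor_mul hH hne p.2]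
  exact tprod_one

theorem singularSeries_pos (hH : Admissible H) (hk : 2 ≤ H.card) : 0 < singularSeries H := by
  have h1 := eulerConst_mul_singularSeries hH hk
  have h2 : 0 ≤ singularSeries H := by
    refine hasProd_nonneg (multipliable_singularFactor hH hk).hasProd fun p => ?_
    have h3 := hH.add_one_le p.2
    have hp1 : (1 : ℝ) < (p : ℕ) := by exact_mod_cast p.2.one_lt
    refine mul_nonneg ?_ (inv_nonneg.2 (pow_nonneg ?_ _))
    · rw [sub_nonneg, div_le_one (by linarith)]; linarith
    · rw [sub_nonneg, div_le_one (by linarith)]; linarith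
  refine lt_of_le_of_ne h2 fun h => ?_
  rw [← h, mul_zero] at h1
  exact zero_ne_one h1

theorem eulerConst_eq_inv (hH : Admissible H) (hk : 2 ≤ H.card) :
    eulerConst (H.card - 1) (densityWeight H) = (singularSeries H)⁻¹ :=
  eq_inv_of_mul_eq_one_left (eulerConst_mul_singularSeries hH hk)

end Density

/-! ### Selberg's diagonalisation. -/

/-- Selberg-type coefficients `sqf (-F) d * ∑_{(t, d) = 1} sqf q t * Φ (d * t)`. -/
def selbergCoeff (M : ℕ) (F q Φ : ℕ → ℝ) (d : ℕ) : ℝ :=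
  sqf (fun p => -F p) d * ∑ t ∈ Finset.Ico 1 M, sqf (awayFrom d q) t * Φ (d * t)

/-- A prime dividing both d₁ and d₂ should contribute g once, and g = g(1 - g) + g²: either it is
put in r, or it is left in both quotients. -/
theorem sqf_lcm (g : ℕ → ℝ) (M : ℕ) {d₁ d₂ : ℕ} (h₁ : Squarefree d₁) (h₂ : Squarefree d₂)
    (hM : d₁ < M) :
    sqf g (d₁.lcm d₂) = ∑ r ∈ (Finset.Ico 1 M).filter (fun r => r ∣ d₁ ∧ r ∣ d₂),
      sqf (fun p => g p * (1 - g p)) r * (sqf g (d₁ / r) * sqf g (d₂ / r)) := by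
  set e := d₁.gcd d₂
  have he : 0 < e := Nat.gcd_pos_of_pos_left _ (Nat.pos_of_ne_zero h₁.ne_zero)
  obtain ⟨x, hx⟩ : e ∣ d₁ := Nat.gcd_dvd_left _ _
  obtain ⟨y, hy⟩ : e ∣ d₂ := Nat.gcd_dvd_right _ _
  have hex : e.Coprime x := Nat.coprime_of_squarefree_mul (hx ▸ h₁)
  have hey : e.Coprime y := Nat.coprime_of_squarefree_mul (hy ▸ h₂)
  have hxy : x.Coprime y := by
    have := Nat.coprime_div_gcd_div_gcd (m := d₁) (n := d₂) he
    rwa [show d₁.gcd d₂ = e from rfl, Nat.div_eq_of_eq_mul_right he hx,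
      Nat.div_eq_of_eq_mul_right he hy] at this
  have hesq : Squarefree e := h₁.squarefree_of_dvd ⟨x, hx⟩
  have hlcm : d₁.lcm d₂ = e * (x * y) := by
    rw [Nat.lcm, show d₁.gcd d₂ = e from rfl]
    refine Nat.div_eq_of_eq_mul_right he ?_
    rw [hx, hy]; ring
  have hset : (Finset.Ico 1 M).filter (fun r => r ∣ d₁ ∧ r ∣ d₂) = e.divisors := by
    ext r
    simp only [Finset.mem_filter, Finset.mem_Ico, Nat.mem_divisors]
    rw [← Nat.dvd_gcd_iff]
    constructor
    · rintro ⟨_, h⟩; exact ⟨h, he.ne'⟩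
    · rintro ⟨h, _⟩
      refine ⟨⟨Nat.pos_of_dvd_of_pos h he, lt_of_le_of_lt (Nat.le_of_dvd
        (Nat.pos_of_ne_zero h₁.ne_zero) (h.trans ⟨x, hx⟩)) hM⟩, h⟩
  rw [hset, hlcm, sqf_mul_of_coprime g (hex.mul_right hey), sqf_mul_of_coprime g hxy,
    ← Nat.sum_divisorsAntidiagonal (f := fun r _ =>
      sqf (fun p => g p * (1 - g p)) r * (sqf g (d₁ / r) * sqf g (d₂ / r)))]
  have h3 : ∀ z ∈ e.divisorsAntidiagonal,
      sqf (fun p => g p * (1 - g p)) z.1 * (sqf g (d₁ / z.1) * sqf g (d₂ / z.1))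
        = sqf (fun p => g p * (1 - g p)) z.1 * sqf (fun p => g p * g p) z.2
          * (sqf g x * sqf g y) := by
    intro z hz
    obtain ⟨hz1, _⟩ := Nat.mem_divisorsAntidiagonal.1 hz
    have hz0 : 0 < z.1 := Nat.pos_of_ne_zero fun h => he.ne' (by rw [← hz1, h, zero_mul])
    have hz2 : z.2 ∣ e := ⟨z.1, by rw [mul_comm]; exact hz1.symm⟩
    have e1 : d₁ / z.1 = z.2 * x := by
      refine Nat.div_eq_of_eq_mul_right hz0 ?_
      rw [hx, ← hz1]; ring
    have e2 : d₂ / z.1 = z.2 * y := by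
      refine Nat.div_eq_of_eq_mul_right hz0 ?_
      rw [hy, ← hz1]; ring
    rw [e1, e2, sqf_mul_of_coprime g (Nat.Coprime.coprime_dvd_left hz2 hex),
      sqf_mul_of_coprime g (Nat.Coprime.coprime_dvd_left hz2 hey), ← sqf_mul_sqf g g]
    ring
  rw [Finset.sum_congr rfl h3, ← Finset.sum_mul, ← sqf_add _ _ hesq]
  congr 1
  exact sqf_congr fun p _ _ => by ring

theorem awayFrom_mul (r : ℕ) (w v : ℕ → ℝ) (p : ℕ) :
    awayFrom r w p * v p = awayFrom r (fun p => w p * v p) p := by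
  unfold awayFrom; split_ifs <;> simp

theorem awayFrom_add (r : ℕ) (w v : ℕ → ℝ) (p : ℕ) :
    awayFrom r w p + awayFrom r v p = awayFrom r (fun p => w p + v p) p := by
  unfold awayFrom; split_ifs <;> simp

theorem sqf_awayFrom_mul (r e : ℕ) (w : ℕ → ℝ) (t : ℕ) :
    sqf (awayFrom (r * e) w) t = sqf (awayFrom e (awayFrom r w)) t := by
  refine sqf_congr fun p hp _ => ?_
  unfold awayFrom
  by_cases h1 : p ∣ r <;> by_cases h2 : p ∣ e <;> simp [hp.dvd_mul, h1, h2]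

/-- Write d = r e. The factor e of the coefficient and the variable t of its inner sum combine to n
= e t, and by `sum_sqf_add` their weights -F g and q add up. -/
theorem sum_selbergCoeff_multiples (M : ℕ) (F q g Φ : ℕ → ℝ) (hΦ : ∀ n, M ≤ n → Φ n = 0)
    {r : ℕ} (hr : 0 < r) :
    ∑ d ∈ (Finset.Ico 1 M).filter (fun d => r ∣ d), selbergCoeff M F q Φ d * sqf g (d / r)
      = sqf (fun p => -F p) r
        * ∑ n ∈ Finset.Ico 1 M, sqf (awayFrom r (fun p => q p - F p * g p)) n * Φ (r * n) := by
  rw [sum_multiples M r hr (fun d => selbergCoeff M F q Φ d * sqf g (d / r))]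
  swap
  · intro n hn
    unfold selbergCoeff
    rw [Finset.sum_eq_zero, mul_zero, zero_mul]
    intro t ht
    rw [hΦ, mul_zero]
    exact hn.trans (Nat.le_mul_of_pos_right n (Finset.mem_Ico.1 ht).1)
  have h1 := sum_sqf_add M (awayFrom r (fun p => -F p * g p)) (awayFrom r q) (fun n => Φ (r * n))
    (fun n hn => hΦ _ (hn.trans (Nat.le_mul_of_pos_left n hr)))
  have h2 : (fun p => awayFrom r (fun p => -F p * g p) p + awayFrom r q p)
      = awayFrom r (fun p => q p - F p * g p) := by
    funext p
    rw [awayFrom_add]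
    congr 1
    funext p
    ring
  rw [h2] at h1
  rw [h1, Finset.mul_sum]
  refine Finset.sum_congr rfl fun e _ => ?_
  rw [Nat.mul_div_cancel_left _ hr]
  unfold selbergCoeff
  rw [sqf_mul, Finset.mul_sum, Finset.mul_sum, Finset.sum_mul]
  refine Finset.sum_congr rfl fun t _ => ?_
  have h3 : sqf (awayFrom r (fun p => -F p * g p)) e
      = sqf (awayFrom r (fun p => -F p)) e * sqf g e := by
    rw [sqf_mul_sqf]
    exact sqf_congr fun p _ _ => (awayFrom_mul _ _ _ _).symm
  rw [h3, sqf_awayFrom_mul, mul_assoc r e t]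
  ring

theorem sqf_eq_zero_of_selbergCoeff (M : ℕ) (F q Φ : ℕ → ℝ) {d : ℕ} (hd : ¬ Squarefree d) :
    selbergCoeff M F q Φ d = 0 := by
  rw [selbergCoeff, sqf_of_not_squarefree _ hd, zero_mul]

/-- Diagonalisation of the quadratic form of the sieve. -/
theorem sum_selbergCoeff_lcm (M : ℕ) (F q g a h Φ Ψ : ℕ → ℝ) (hΦ : ∀ n, M ≤ n → Φ n = 0)
    (hΨ : ∀ n, M ≤ n → Ψ n = 0)
    (ha : ∀ p, p.Prime → a p = (1 - g p) * F p)
    (hb : ∀ p, p.Prime → a p - 1 = q p - F p * g p)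
    (hh : ∀ p, p.Prime → g p = h p * (1 - g p)) :
    ∑ d₁ ∈ Finset.Ico 1 M, ∑ d₂ ∈ Finset.Ico 1 M,
      selbergCoeff M F q Φ d₁ * selbergCoeff M F q Ψ d₂ * sqf g (d₁.lcm d₂)
    = ∑ r ∈ Finset.Ico 1 M, sqf h r *
      ((sqf a r * ∑ n ∈ Finset.Ico 1 M, sqf (awayFrom r (fun p => a p - 1)) n * Φ (r * n))
      * (sqf a r * ∑ n ∈ Finset.Ico 1 M, sqf (awayFrom r (fun p => a p - 1)) n * Ψ (r * n))) := by
  set G := fun p => g p * (1 - g p)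
  have e1 : ∀ d₁ ∈ Finset.Ico 1 M, ∀ d₂ ∈ Finset.Ico 1 M,
      selbergCoeff M F q Φ d₁ * selbergCoeff M F q Ψ d₂ * sqf g (d₁.lcm d₂)
      = ∑ r ∈ Finset.Ico 1 M, if r ∣ d₁ ∧ r ∣ d₂ then sqf G r
        * ((selbergCoeff M F q Φ d₁ * sqf g (d₁ / r))
          * (selbergCoeff M F q Ψ d₂ * sqf g (d₂ / r))) else 0 := by
    intro d₁ hd₁ d₂ hd₂
    by_cases h1 : Squarefree d₁
    swap
    · simp [sqf_eq_zero_of_selbergCoeff _ _ _ _ h1]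
    by_cases h2 : Squarefree d₂
    swap
    · simp [sqf_eq_zero_of_selbergCoeff _ _ _ _ h2]
    rw [sqf_lcm g M h1 h2 (Finset.mem_Ico.1 hd₁).2, ← Finset.sum_filter, Finset.mul_sum]
    exact Finset.sum_congr rfl fun r _ => by ring
  rw [Finset.sum_congr rfl fun d₁ hd₁ => Finset.sum_congr rfl fun d₂ hd₂ => e1 d₁ hd₁ d₂ hd₂]
  rw [Finset.sum_congr rfl fun d₁ _ => Finset.sum_comm, Finset.sum_comm]
  refine Finset.sum_congr rfl fun r hr => ?_
  have hr0 : 0 < r := (Finset.mem_Ico.1 hr).1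
  have e2 : ∑ d₁ ∈ Finset.Ico 1 M, ∑ d₂ ∈ Finset.Ico 1 M, (if r ∣ d₁ ∧ r ∣ d₂ then sqf G r
        * ((selbergCoeff M F q Φ d₁ * sqf g (d₁ / r))
          * (selbergCoeff M F q Ψ d₂ * sqf g (d₂ / r))) else 0)
      = sqf G r * ((∑ d ∈ (Finset.Ico 1 M).filter (fun d => r ∣ d),
          selbergCoeff M F q Φ d * sqf g (d / r))
        * (∑ d ∈ (Finset.Ico 1 M).filter (fun d => r ∣ d),
          selbergCoeff M F q Ψ d * sqf g (d / r))) := by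
    rw [Finset.sum_mul_sum, Finset.sum_filter, Finset.mul_sum]
    refine Finset.sum_congr rfl fun d₁ _ => ?_
    by_cases h1 : r ∣ d₁
    · rw [if_pos h1, Finset.sum_filter, Finset.mul_sum]
      refine Finset.sum_congr rfl fun d₂ _ => ?_
      by_cases h2 : r ∣ d₂ <;> simp [h1, h2]
    · simp [h1]
  rw [e2, sum_selbergCoeff_multiples M F q g Φ hΦ hr0,
    sum_selbergCoeff_multiples M F q g Ψ hΨ hr0]
  have e3 : ∀ n, sqf (awayFrom r (fun p => q p - F p * g p)) n
      = sqf (awayFrom r (fun p => a p - 1)) n := fun n =>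
    sqf_congr fun p hp _ => by
      simp only [awayFrom, hb p hp]
  simp only [e3]
  -- Prime by prime, g(1 - g) F² = h ((1 - g) F)² because g = h(1 - g).
  have e4 : sqf G r * (sqf (fun p => -F p) r * sqf (fun p => -F p) r)
      = sqf h r * (sqf a r * sqf a r) := by
    rw [sqf_mul_sqf, sqf_mul_sqf, sqf_mul_sqf, sqf_mul_sqf]
    refine sqf_congr fun p hp _ => ?_
    simp only [G]
    rw [ha p hp]
    linear_combination (1 - g p) * F p ^ 2 * hh p hp
  calc _ = sqf G r * (sqf (fun p => -F p) r * sqf (fun p => -F p) r)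
        * ((∑ n ∈ Finset.Ico 1 M, sqf (awayFrom r (fun p => a p - 1)) n * Φ (r * n))
        * ∑ n ∈ Finset.Ico 1 M, sqf (awayFrom r (fun p => a p - 1)) n * Ψ (r * n)) := by ring
    _ = _ := by rw [e4]; ring

/-! ### The weights λ as Selberg coefficients. -/

section Weights

variable (H : Finset ℤ) (h₀ : ℤ)

/-- `p / (p - ν_p)`. -/
def ratioWeight (p : ℕ) : ℝ := (p : ℝ) / ((p : ℝ) - nuPrime H p)

/-- `ν_p / (p - ν_p)`. -/
def dualWeight (p : ℕ) : ℝ := (nuPrime H p : ℝ) / ((p : ℝ) - nuPrime H p)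

/-- The density `(ν_p(H ∪ {h₀}) - 1) / (p - 1)` of the sieved primes. -/
def primeDensity (p : ℕ) : ℝ := ((nuPrime (insert h₀ H) p : ℝ) - 1) / ((p : ℝ) - 1)

/-- `p (p - ν_p(H ∪ {h₀})) / ((p - 1) (p - ν_p(H)))`. -/
def transferWeight (p : ℕ) : ℝ :=
  (p : ℝ) * ((p : ℝ) - nuPrime (insert h₀ H) p) / (((p : ℝ) - 1) * ((p : ℝ) - nuPrime H p))

variable {H h₀}

theorem sieveF_squarefree {d : ℕ} (hd : Squarefree d) :
    sieveF H d = sqf (fun p => (p : ℝ) / nuPrime H p) d := by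
  rw [sieveF, nu_squarefree H hd, sqf_of_squarefree _ hd, Finset.prod_div_distrib,
    ← Nat.cast_prod, Nat.prod_primeFactors_of_squarefree hd, Nat.cast_prod]

theorem moebius_eq_sqf (d : ℕ) : (ArithmeticFunction.moebius d : ℝ) = sqf (fun _ => -1) d := by
  by_cases hd : Squarefree d
  · rw [sqf_of_squarefree _ hd, ArithmeticFunction.moebius_apply_of_squarefree hd,
      Finset.prod_const]
    push_cast
    rw [(ArithmeticFunction.cardDistinctFactors_eq_cardFactors_iff_squarefree hd.ne_zero).2 hd |>.symm,
      ArithmeticFunction.cardDistinctFactors_apply, ← List.card_toFinset]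
    rfl
  · rw [sqf_of_not_squarefree _ hd, ArithmeticFunction.moebius_eq_zero_of_not_squarefree hd]
    simp

theorem sieveF1_squarefree {d : ℕ} (hd : Squarefree d) :
    sieveF1 H d = sqf (fun p => (p : ℝ) / nuPrime H p - 1) d := by
  have h1 := sqf_add (fun p => (p : ℝ) / nuPrime H p) (fun _ => -1) hd
  simp only [← sub_eq_add_neg] at h1
  rw [h1, sieveF1]
  refine Finset.sum_congr rfl fun x hx => ?_
  obtain ⟨hx1, _⟩ := Nat.mem_divisorsAntidiagonal.1 hx
  rw [sieveF_squarefree (hd.squarefree_of_dvd ⟨x.2, hx1.symm⟩), moebius_eq_sqf]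

/-- On squarefree d, f/f₁ and 1/f₁ are the products of p/(p - ν_p) and ν_p/(p - ν_p). The factor
1/ℓ! sits in `logCut`, which also encodes the vanishing for d ≥ R. -/
theorem sieveLambda_eq (hH : Admissible H) (hne : H.Nonempty) (R : ℝ) (ℓ : ℕ) {d : ℕ}
    (hd : 1 ≤ d) :
    sieveLambda H R ℓ d = singularSeries H
      * selbergCoeff ⌈R⌉₊ (ratioWeight H) (dualWeight H) (logCut R ℓ) d := by
  have hd0 : (0 : ℝ) < d := by exact_mod_cast hd
  by_cases hdR : (d : ℝ) < R
  swap
  · rw [sieveLambda, if_neg hdR, selbergCoeff, Finset.sum_eq_zero, mul_zero, mul_zero]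
    intro t ht
    rw [logCut_of_le, mul_zero]
    push_cast
    have : (1 : ℝ) ≤ t := by exact_mod_cast (Finset.mem_Ico.1 ht).1
    nlinarith [not_lt.1 hdR]
  by_cases hsq : Squarefree d
  swap
  · rw [sieveLambda, if_pos hdR, sqf_eq_zero_of_selbergCoeff _ _ _ _ hsq,
      ArithmeticFunction.moebius_eq_zero_of_not_squarefree hsq]
    simp
  have hν : ∀ p : ℕ, (nuPrime H p : ℝ) ≠ 0 := fun p => by
    have := one_le_nuPrime hne p
    positivity
  have hpν : ∀ p : ℕ, p.Prime → (p : ℝ) - nuPrime H p ≠ 0 := fun p hp => by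
    have := hH.add_one_le hp
    linarith
  have e1 : ∀ n, Squarefree n → (sieveF1 H n)⁻¹ = sqf (dualWeight H) n := by
    intro n hn
    rw [sieveF1_squarefree hn, sqf_of_squarefree _ hn, sqf_of_squarefree _ hn, ← Finset.prod_inv_distrib]
    refine Finset.prod_congr rfl fun p hp => ?_
    have h1 := hpν p (Nat.prime_of_mem_primeFactors hp)
    have h2 := hν p
    rw [dualWeight, div_sub_one h2, inv_div]
  have e2 : (ArithmeticFunction.moebius d : ℝ) * (sieveF H d / sieveF1 H d)
      = sqf (fun p => -ratioWeight H p) d := by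
    rw [div_eq_mul_inv, e1 d hsq, moebius_eq_sqf, sieveF_squarefree hsq, sqf_mul_sqf, sqf_mul_sqf]
    refine sqf_congr fun p hp _ => ?_
    have h1 := hpν p hp
    have h2 := hν p
    rw [dualWeight, ratioWeight]
    field_simp
  rw [sieveLambda, if_pos hdR, e2, selbergCoeff]
  have e3 : ∑ r ∈ (Finset.Ico 1 ⌈R / (d : ℝ)⌉₊).filter (fun r : ℕ => Nat.Coprime r d),
          (ArithmeticFunction.moebius r : ℝ) ^ 2 / sieveF1 H r
            * (Real.log (R / ((r : ℝ) * (d : ℝ)))) ^ ℓ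
      = ℓ.factorial * ∑ t ∈ Finset.Ico 1 ⌈R⌉₊,
          sqf (awayFrom d (dualWeight H)) t * logCut R ℓ (d * t) := by
    rw [Finset.mul_sum]
    have hsub : (Finset.Ico 1 ⌈R / (d : ℝ)⌉₊).filter (fun r : ℕ => Nat.Coprime r d)
        ⊆ Finset.Ico 1 ⌈R⌉₊ := by
      intro r hr
      simp only [Finset.mem_filter, Finset.mem_Ico, Nat.lt_ceil] at hr ⊢
      exact ⟨hr.1.1, hr.1.2.trans_le (div_le_self (hd0.trans hdR).le (by exact_mod_cast hd))⟩
    rw [← Finset.sum_subset hsub]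
    · refine Finset.sum_congr rfl fun r hr => ?_
      simp only [Finset.mem_filter, Finset.mem_Ico, Nat.lt_ceil] at hr
      have hlt : ((d * r : ℕ) : ℝ) < R := by
        push_cast
        have := hr.1.2
        rw [lt_div_iff₀ hd0] at this
        linarith
      rw [logCut_of_lt hlt, sqf_awayFrom, if_pos hr.2]
      have hf : (ℓ.factorial : ℝ) ≠ 0 := by positivity
      by_cases hrs : Squarefree r
      · have : (ArithmeticFunction.moebius r : ℝ) ^ 2 = 1 := by
          rw [← Int.cast_pow, ArithmeticFunction.moebius_sq_eq_one_of_squarefree hrs, Int.cast_one]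
        rw [this, one_div, e1 r hrs]
        push_cast
        rw [mul_comm (d : ℝ) r]
        field_simp
      · rw [sqf_of_not_squarefree _ hrs, ArithmeticFunction.moebius_eq_zero_of_not_squarefree hrs]
        simp
    · intro t ht ht'
      simp only [Finset.mem_filter, Finset.mem_Ico, Nat.lt_ceil, not_and] at ht ht'
      rw [sqf_awayFrom]
      split_ifs with hc
      · rw [logCut_of_le]
        · simp
        · by_contra hlt
          push Not at hlt
          push_cast at hlt
          refine ht' ⟨ht.1, ?_⟩ hc
          rw [lt_div_iff₀ hd0]; linarith
      · simp
  rw [e3]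
  have hf : (ℓ.factorial : ℝ) ≠ 0 := by positivity
  field_simp

/-- These are the three identities required by `sum_selbergCoeff_lcm`; the first rests on 1 - g = (p
- ν⁰_p)/(p - 1), with ν⁰ counting `insert h₀ H`. -/
theorem weights_relations (hH₀ : Admissible (insert h₀ H)) {p : ℕ} (hp : p.Prime) :
    transferWeight H h₀ p = (1 - primeDensity H h₀ p) * ratioWeight H p ∧
    transferWeight H h₀ p - 1 = dualWeight H p - ratioWeight H p * primeDensity H h₀ p ∧
    primeDensity H h₀ p = densityWeight (insert h₀ H) p * (1 - primeDensity H h₀ p) := by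
  have h1 := hH₀.add_one_le hp
  have h2 := hH₀.of_insert.add_one_le hp
  have hp1 : (1 : ℝ) < p := by exact_mod_cast hp.one_lt
  have d1 : (p : ℝ) - nuPrime (insert h₀ H) p ≠ 0 := by linarith
  have d2 : (p : ℝ) - nuPrime H p ≠ 0 := by linarith
  have d3 : (p : ℝ) - 1 ≠ 0 := by linarith
  unfold transferWeight primeDensity ratioWeight dualWeight densityWeight
  refine ⟨?_, ?_, ?_⟩
  · field_simp
    ring
  · field_simp
    ring
  · field_simp
    ring

end Weights

/-! ### The linear forms when h₀ ∈ H. -/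

/-- The diagonalised linear form of the sieve. -/
def diagonalForm (H : Finset ℤ) (h₀ : ℤ) (R : ℝ) (ℓ r : ℕ) : ℝ :=
  sqf (transferWeight H h₀) r * ∑ n ∈ Finset.Ico 1 ⌈R⌉₊,
    sqf (awayFrom r (fun p => transferWeight H h₀ p - 1)) n * logCut R ℓ (r * n)

theorem IsSieveWeight.mono {κ : ℕ} {A A' L L' : ℝ} {h : ℕ → ℝ} (hh : IsSieveWeight κ A L h)
    (hA : A ≤ A') (hL : L ≤ L') : IsSieveWeight κ A' L' h where
  nonneg := hh.nonneg
  le := fun p hp => (hh.le p hp).trans (by gcongr)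
  sum_le := fun S hS => (hh.sum_le S hS).trans hL
  one_le := hh.one_le.trans hL

theorem one_add_sum_le_prod (S : Finset ℕ) {w : ℕ → ℝ} (hw : ∀ p ∈ S, 0 ≤ w p) :
    1 + ∑ p ∈ S, w p ≤ ∏ p ∈ S, (1 + w p) := by
  classical
  induction S using Finset.induction_on with
  | empty => simp
  | insert a S ha ih =>
    rw [Finset.sum_insert ha, Finset.prod_insert ha]
    have h1 := ih fun p hp => hw p (Finset.mem_insert_of_mem hp)
    have h2 := hw a (Finset.mem_insert_self _ _)
    have h3 : 0 ≤ ∑ p ∈ S, w p := Finset.sum_nonneg fun p hp => hw p (Finset.mem_insert_of_mem hp)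
    nlinarith

/-- Away from r this is a weight of dimension one; deleting the primes of r adds the sum of log p/p
over them to the discrepancy. -/
theorem isSieveWeight_awayFrom {Z : ℝ}
    (hZ : ∀ S : Finset ℕ, ∑ n ∈ S, Real.log n / (n : ℝ) ^ 2 ≤ Z) {r : ℕ} (hr : r ≠ 0) :
    IsSieveWeight 1 2 (1 + 2 * Z + ∑ p ∈ r.primeFactors, Real.log p / p)
      (awayFrom r fun p => 1 / ((p : ℝ) - 1)) := by
  have hb : ∀ p : ℕ, p.Prime → 0 ≤ 1 / ((p : ℝ) - 1) - 1 / p ∧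
      1 / ((p : ℝ) - 1) - 1 / p ≤ 2 * (1 / (p : ℝ) ^ 2) := by
    intro p hp
    have hp2 : (2 : ℝ) ≤ p := by exact_mod_cast hp.two_le
    have h1 : 1 / ((p : ℝ) - 1) - 1 / p = 1 / (p * (p - 1)) := by
      have : (p : ℝ) - 1 ≠ 0 := by linarith
      field_simp
      ring
    rw [h1]
    have h2 : 0 < (p : ℝ) - 1 := by linarith
    refine ⟨by positivity, ?_⟩
    rw [mul_one_div, div_le_div_iff₀ (by positivity) (by positivity)]
    nlinarith
  have hZ0 : 0 ≤ Z := by simpa using hZ ∅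
  have hs0 : 0 ≤ ∑ p ∈ r.primeFactors, Real.log p / p :=
    Finset.sum_nonneg fun p _ => div_nonneg (Real.log_natCast_nonneg p) (Nat.cast_nonneg _)
  have hw0 : ∀ p : ℕ, p.Prime → 0 ≤ 1 / ((p : ℝ) - 1) := fun p hp => by
    have hp2 : (2 : ℝ) ≤ p := by exact_mod_cast hp.two_le
    have : 0 < (p : ℝ) - 1 := by linarith
    positivity
  refine ⟨fun p hp => awayFrom_nonneg (hw0 p hp), ?_, ?_, by linarith⟩
  · intro p hp
    refine (awayFrom_le (hw0 p hp)).trans ?_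
    have h1 := (hb p hp).2
    have h2 := inv_sq_le_rpow hp.one_le
    push_cast
    linarith
  · intro S hS
    have h1 : ∀ p ∈ S, |awayFrom r (fun p => 1 / ((p : ℝ) - 1)) p - ((1 : ℕ) : ℝ) / p| * Real.log p
        ≤ 2 * (Real.log p / (p : ℝ) ^ 2) + if p ∈ r.primeFactors then Real.log p / p else 0 := by
      intro p hp
      have hpp := hS p hp
      have hl := Real.log_natCast_nonneg p
      have h3 : 0 ≤ Real.log p / p := div_nonneg hl (Nat.cast_nonneg _)
      have h4 : 0 ≤ Real.log p / (p : ℝ) ^ 2 := div_nonneg hl (by positivity)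
      rw [Nat.cast_one]
      by_cases hpr : p ∣ r
      · have h2 : awayFrom r (fun p => 1 / ((p : ℝ) - 1)) p = 0 := by simp [awayFrom, hpr]
        rw [h2, zero_sub, abs_neg, abs_of_nonneg (by positivity)]
        rw [if_pos (Nat.mem_primeFactors.2 ⟨hpp, hpr, hr⟩)]
        have : 1 / (p : ℝ) * Real.log p = Real.log p / p := by ring
        linarith
      · have h2 : awayFrom r (fun p => 1 / ((p : ℝ) - 1)) p = 1 / ((p : ℝ) - 1) := by
          simp [awayFrom, hpr]
        rw [h2, abs_of_nonneg (hb p hpp).1]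
        have h5 := mul_le_mul_of_nonneg_right (hb p hpp).2 hl
        have h6 : 2 * (1 / (p : ℝ) ^ 2) * Real.log p = 2 * (Real.log p / (p : ℝ) ^ 2) := by ring
        split_ifs <;> linarith
    refine (Finset.sum_le_sum h1).trans ?_
    rw [Finset.sum_add_distrib, ← Finset.mul_sum, ← Finset.sum_filter]
    have h2 : ∑ p ∈ S.filter (· ∈ r.primeFactors), Real.log p / p
        ≤ ∑ p ∈ r.primeFactors, Real.log p / p := by
      refine Finset.sum_le_sum_of_subset_of_nonneg (fun p hp => (Finset.mem_filter.1 hp).2) ?_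
      intro p _ _
      exact div_nonneg (Real.log_natCast_nonneg p) (Nat.cast_nonneg _)
    have h3 := hZ S
    linarith

/-- For p ∤ r the factor is (1 + 1/(p-1))(1 - 1/p) = 1, so only the primes of r remain and the
product is φ(r)/r. -/
theorem eulerConst_awayFrom {r : ℕ} (hr : Squarefree r) :
    eulerConst 1 (awayFrom r fun p => 1 / ((p : ℝ) - 1)) = sqf (fun p => 1 - 1 / (p : ℝ)) r := by
  unfold eulerConst
  rw [tprod_eq_prod (β := Nat.Primes) (s := r.primeFactors.subtype Nat.Prime), sqf_of_squarefree _ hr]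
  · have h1 : ∀ p ∈ r.primeFactors,
        (1 + awayFrom r (fun p => 1 / ((p : ℝ) - 1)) p) * (1 - 1 / (p : ℝ)) ^ 1 = 1 - 1 / (p : ℝ) := by
      intro p hp
      simp [awayFrom, Nat.dvd_of_mem_primeFactors hp]
    rw [← Finset.prod_congr rfl h1]
    exact Finset.prod_subtype_of_mem (p := Nat.Prime)
      (fun p : ℕ => (1 + awayFrom r (fun p => 1 / ((p : ℝ) - 1)) p) * (1 - 1 / (p : ℝ)) ^ 1)
      fun p hp => Nat.prime_of_mem_primeFactors hp
  · intro p hp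
    have hpr : ¬ (p : ℕ) ∣ r := fun h => hp
      (Finset.mem_subtype.2 (Nat.mem_primeFactors.2 ⟨p.2, h, hr.ne_zero⟩))
    have hp1 : (1 : ℝ) < (p : ℕ) := by exact_mod_cast p.2.one_lt
    have h1 : ((p : ℕ) : ℝ) - 1 ≠ 0 := by linarith
    have h2 : ((p : ℕ) : ℝ) ≠ 0 := by linarith
    simp only [awayFrom, if_neg hpr, pow_one]
    field_simp
    ring

theorem one_add_log_le {R : ℝ} (hR : 2 ≤ R) : 1 + Real.log R ≤ 3 * Real.log R := by
  have h1 := Real.log_two_gt_d9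
  have h2 : Real.log 2 ≤ Real.log R := Real.log_le_log (by norm_num) hR
  linarith

section Mem

variable {H : Finset ℤ} {h₀ : ℤ}

theorem transferWeight_of_mem (hH : Admissible H) (h₀H : h₀ ∈ H) {p : ℕ} (hp : p.Prime) :
    transferWeight H h₀ p = 1 + 1 / ((p : ℝ) - 1) := by
  have h1 := hH.add_one_le hp
  have hp1 : (1 : ℝ) < p := by exact_mod_cast hp.one_lt
  have d2 : (p : ℝ) - nuPrime H p ≠ 0 := by linarith
  have d3 : (p : ℝ) - 1 ≠ 0 := by linarith
  rw [transferWeight, Finset.insert_eq_of_mem h₀H]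
  field_simp
  ring

/-- The size `1 + 8 / √p` of the error terms in the linear forms. -/
def errorWeight (p : ℕ) : ℝ := 1 + 8 * (p : ℝ) ^ (-(1 / 2) : ℝ)

theorem one_le_errorWeight (p : ℕ) : 1 ≤ errorWeight p := by
  have : (0 : ℝ) ≤ (p : ℝ) ^ (-(1 / 2) : ℝ) := by positivity
  unfold errorWeight
  linarith

theorem rpow_half_facts {p : ℕ} (hp : p.Prime) : ∃ s : ℝ, s = (p : ℝ) ^ (-(1 / 2) : ℝ) ∧ 0 < s ∧
    s ≤ 1 ∧ 1 / (p : ℝ) = s ^ 2 ∧ (p : ℝ) ^ (-(3 / 2) : ℝ) = s ^ 3 ∧ Real.log p / p ≤ 2 * s := by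
  have hp0 : (0 : ℝ) < p := by exact_mod_cast hp.pos
  have hp1 : (1 : ℝ) ≤ p := by exact_mod_cast hp.one_le
  have e1 : 1 / (p : ℝ) = ((p : ℝ) ^ (-(1 / 2) : ℝ)) ^ 2 := by
    rw [← Real.rpow_natCast, ← Real.rpow_mul hp0.le, one_div, ← Real.rpow_neg_one]
    norm_num
  refine ⟨_, rfl, by positivity, Real.rpow_le_one_of_one_le_of_nonpos hp1 (by norm_num), e1, ?_, ?_⟩
  · rw [← Real.rpow_natCast, ← Real.rpow_mul hp0.le]
    norm_num
  · have h := Real.log_le_rpow_div hp0.le (ε := 1 / 2) (by norm_num)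
    have h2 : (p : ℝ) ^ (1 / 2 : ℝ) * (1 / p) = (p : ℝ) ^ (-(1 / 2) : ℝ) := by
      rw [one_div (p : ℝ), ← Real.rpow_neg_one, ← Real.rpow_add hp0]
      norm_num
    have h3 := mul_le_mul_of_nonneg_right h (by positivity : 0 ≤ 1 / (p : ℝ))
    rw [div_eq_mul_one_div (Real.log p)]
    calc _ ≤ _ := h3
      _ = 2 * ((p : ℝ) ^ (1 / 2 : ℝ) * (1 / p)) := by ring
      _ = _ := by rw [h2]

/-- As h is O(1/p) and the square of the error weight is 1 + O(p^(-1/2)), the change is O(p^(-3/2)).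
This is what the exponent 3/2 in `IsSieveWeight` allows for. -/
theorem mul_errorWeight_sq_le {κ : ℕ} {A L : ℝ} {h : ℕ → ℝ} (hh : IsSieveWeight κ A L h)
    (hA : 0 ≤ A) {p : ℕ} (hp : p.Prime) :
    h p * errorWeight p ^ 2 ≤ κ / p + (A + 80 * (κ + A)) * (p : ℝ) ^ (-(3 / 2) : ℝ) := by
  obtain ⟨s, hs, hs0, hs1, e1, e2, -⟩ := rpow_half_facts hp
  have h1 := hh.le p hp
  have h2 := hh.le_div hA hp
  have h0 := hh.nonneg p hp
  rw [div_eq_mul_one_div, e1] at h2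
  rw [e2] at h1 ⊢
  unfold errorWeight
  rw [← hs]
  -- Since s ≤ 1, the terms 16 s + 64 s² are at most 80 s.
  have h3 : (1 + 8 * s) ^ 2 ≤ 1 + 80 * s := by nlinarith
  have h4 := mul_le_mul_of_nonneg_left h3 h0
  have h5 : h p * (80 * s) ≤ (κ + A) * s ^ 2 * (80 * s) :=
    mul_le_mul_of_nonneg_right h2 (by positivity)
  nlinarith

/-- The inner sum has dimension one and constant φ(r)/r, which the outer factor a(r) = r/φ(r)
cancels. The error involves ∑_{p ∣ r} log p/p, majorised by ∏_{p ∣ r} (1 + log p/p) so that it stays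
multiplicative in r. -/
theorem exists_diagonalForm_mem (ℓ : ℕ) : ∃ D : ℝ, 1 ≤ D ∧ ∀ (H : Finset ℤ) (h₀ : ℤ),
    Admissible H → h₀ ∈ H → ∀ (R : ℝ), 1 < R → ∀ r : ℕ, Squarefree r → (r : ℝ) < R →
      |diagonalForm H h₀ R ℓ r - logCut R (ℓ + 1) r|
        ≤ D * sqf errorWeight r * (1 + Real.log R) ^ ℓ := by
  obtain ⟨C, hC, hT⟩ := exists_sum_sqf_logCut 1 le_rfl 2 (by norm_num)
  set Z : ℝ := 2 * ∑' n : ℕ, (n : ℝ) ^ (-(3 / 2) : ℝ)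
  have hZ : 0 ≤ Z := mul_nonneg (by norm_num) (tsum_nonneg fun n => by positivity)
  refine ⟨C * (1 + 2 * Z), one_le_mul_of_one_le_of_one_le hC (by linarith), ?_⟩
  intro H h₀ hH h₀H R hR r hr hrR
  have hr1 : 1 ≤ r := Nat.one_le_iff_ne_zero.2 hr.ne_zero
  have hr0 : (1 : ℝ) ≤ r := by exact_mod_cast hr1
  set s := ∑ p ∈ r.primeFactors, Real.log p / p
  have hw0 : ∀ p ∈ r.primeFactors, 0 ≤ Real.log p / p := fun p _ =>
    div_nonneg (Real.log_natCast_nonneg p) (Nat.cast_nonneg _)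
  have hs0 : 0 ≤ s := Finset.sum_nonneg hw0
  have h1 := hT _ _ (isSieveWeight_awayFrom sum_log_div_sq_le hr.ne_zero) ℓ R r hr1 hrR
  rw [eulerConst_awayFrom hr] at h1
  set u := Real.log (R / r)
  have hu : 0 ≤ u := Real.log_nonneg (by rw [one_le_div (by linarith)]; exact hrR.le)
  have hu2 : u ≤ Real.log R :=
    Real.log_le_log (by positivity) (div_le_self (by linarith) hr0)
  have ha : ∀ p : ℕ, p.Prime → 1 ≤ transferWeight H h₀ p := fun p hp => by
    rw [transferWeight_of_mem hH h₀H hp]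
    have hp1 : (1 : ℝ) < p := by exact_mod_cast hp.one_lt
    have : 0 < (p : ℝ) - 1 := by linarith
    have : 0 ≤ 1 / ((p : ℝ) - 1) := by positivity
    linarith
  have hsa : 0 ≤ sqf (transferWeight H h₀) r := sqf_nonneg (fun p hp => by linarith [ha p hp]) r
  have e1 : sqf (transferWeight H h₀) r * sqf (fun p => 1 - 1 / (p : ℝ)) r = 1 := by
    rw [sqf_mul_sqf, sqf_of_squarefree _ hr]
    refine Finset.prod_eq_one fun p hp => ?_
    have hpp := Nat.prime_of_mem_primeFactors hp
    rw [transferWeight_of_mem hH h₀H hpp]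
    have hp1 : (1 : ℝ) < p := by exact_mod_cast hpp.one_lt
    have h2 : (p : ℝ) - 1 ≠ 0 := by linarith
    have h3 : (p : ℝ) ≠ 0 := by linarith
    field_simp
    ring
  have e2 : ∀ n, sqf (awayFrom r (fun p => transferWeight H h₀ p - 1)) n
      = sqf (awayFrom r fun p => 1 / ((p : ℝ) - 1)) n := fun n =>
    sqf_congr fun p hp _ => by
      simp only [awayFrom, transferWeight_of_mem hH h₀H hp, add_sub_cancel_left]
  have e3 : diagonalForm H h₀ R ℓ r - logCut R (ℓ + 1) r
      = sqf (transferWeight H h₀) r * (∑ n ∈ Finset.Ico 1 ⌈R⌉₊,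
        sqf (awayFrom r fun p => 1 / ((p : ℝ) - 1)) n * logCut R ℓ (r * n)
        - sqf (fun p => 1 - 1 / (p : ℝ)) r * (u ^ (1 + ℓ) / ((1 + ℓ).factorial : ℝ))) := by
    rw [mul_sub, ← mul_assoc, e1, one_mul, logCut_of_lt hrR, add_comm 1 ℓ]
    unfold diagonalForm
    simp only [e2, u]
  rw [e3, abs_mul, abs_of_nonneg hsa]
  have h2 : 1 + 2 * Z + s ≤ (1 + 2 * Z) * sqf (fun p => 1 + Real.log p / p) r := by
    rw [sqf_of_squarefree _ hr]
    have h3 := one_add_sum_le_prod r.primeFactors hw0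
    have h4 : 1 + 2 * Z + s ≤ (1 + 2 * Z) * (1 + s) := by nlinarith
    exact h4.trans (mul_le_mul_of_nonneg_left h3 (by linarith))
  have h3 : sqf (transferWeight H h₀) r * sqf (fun p => 1 + Real.log p / p) r
      ≤ sqf errorWeight r := by
    rw [sqf_mul_sqf]
    refine sqf_le_sqf (fun p hp => ?_) (fun p hp => ?_) r
    · have := div_nonneg (Real.log_natCast_nonneg p) (Nat.cast_nonneg (α := ℝ) p)
      exact mul_nonneg (by linarith [ha p hp]) (by linarith)
    · obtain ⟨t, ht, ht0, ht1, f1, -, f3⟩ := rpow_half_facts hp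
      have hp2 : (2 : ℝ) ≤ p := by exact_mod_cast hp.two_le
      have hpm : 0 < (p : ℝ) - 1 := by linarith
      have h4 : 1 / ((p : ℝ) - 1) ≤ 2 * t ^ 2 := by
        rw [← f1, mul_one_div, div_le_div_iff₀ hpm (by linarith)]
        linarith
      have h5 : 0 ≤ 1 / ((p : ℝ) - 1) := by positivity
      have h6 := div_nonneg (Real.log_natCast_nonneg p) (Nat.cast_nonneg (α := ℝ) p)
      rw [transferWeight_of_mem hH h₀H hp]
      unfold errorWeight
      rw [← ht]
      calc _ ≤ (1 + 2 * t ^ 2) * (1 + 2 * t) :=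
            mul_le_mul (by linarith) (by linarith) (by linarith) (by positivity)
        _ ≤ _ := by nlinarith [mul_pos ht0 ht0]
  have hq0 : 0 ≤ sqf (fun p => 1 + Real.log p / p) r := sqf_nonneg (fun p _ => by
    have := div_nonneg (Real.log_natCast_nonneg p) (Nat.cast_nonneg (α := ℝ) p)
    linarith) r
  calc _ ≤ sqf (transferWeight H h₀) r * (C * (1 + 2 * Z + s) * (1 + u) ^ (1 + ℓ - 1)) :=
        mul_le_mul_of_nonneg_left h1 hsa
    _ ≤ sqf (transferWeight H h₀) r * (C * ((1 + 2 * Z) * sqf (fun p => 1 + Real.log p / p) r)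
        * (1 + Real.log R) ^ ℓ) := by
        rw [Nat.add_sub_cancel_left]
        gcongr
    _ = C * (1 + 2 * Z) * (sqf (transferWeight H h₀) r * sqf (fun p => 1 + Real.log p / p) r)
        * (1 + Real.log R) ^ ℓ := by ring
    _ ≤ _ := by
        have hlR : 0 ≤ Real.log R := Real.log_nonneg hR.le
        gcongr

/-- The outer sum has dimension k - 1 and each linear form gains one logarithm, whence the exponent
(k - 1) + (ℓ₁ + 1) + (ℓ₂ + 1). -/
theorem exists_main_term_mem (k : ℕ) (hk : 2 ≤ k) (ℓ₁ ℓ₂ : ℕ) : ∃ C : ℝ, 0 ≤ C ∧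
    ∀ (H : Finset ℤ) (h₀ : ℤ), H.card = k → Admissible H → h₀ ∈ H → ∀ R : ℝ, 2 ≤ R →
    |∑ r ∈ Finset.Ico 1 ⌈R⌉₊, sqf (densityWeight H) r
        * (diagonalForm H h₀ R ℓ₁ r * diagonalForm H h₀ R ℓ₂ r)
      - (ℓ₁ + ℓ₂ + 2).choose (ℓ₁ + 1) * ((singularSeries H)⁻¹
        * (Real.log R ^ (k + ℓ₁ + ℓ₂ + 1) / ((k + ℓ₁ + ℓ₂ + 1).factorial : ℝ)))|
      ≤ C * beta H * Real.log R ^ (k + ℓ₁ + ℓ₂) := by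
  obtain ⟨A, C₀, hA, hC₀, hw⟩ := exists_isSieveWeight_density k hk
  obtain ⟨D₁, hD₁, hd₁⟩ := exists_diagonalForm_mem ℓ₁
  obtain ⟨D₂, hD₂, hd₂⟩ := exists_diagonalForm_mem ℓ₂
  -- Enlarged so that the square of `errorWeight` fits inside the same majorant.
  set A' := A + 80 * ((k - 1 : ℕ) + A)
  have hA' : A ≤ A' := by
    have : (0 : ℝ) ≤ (k - 1 : ℕ) := Nat.cast_nonneg _
    simp only [A']
    linarith
  set D := D₁ + D₂ + 1
  obtain ⟨C, hC, hmain⟩ := exists_sum_sqf_mul_mul (k - 1) (by omega) A' D (by linarith)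
    (by simp only [D]; linarith) (ℓ₁ + 1) (ℓ₂ + 1) (by omega) (by omega)
  refine ⟨C * C₀ * 3 ^ (k + ℓ₁ + ℓ₂), by positivity, ?_⟩
  intro H h₀ hHk hH h₀H R hR
  have hh := hw H hHk hH
  have hL := hh.one_le
  have hlR : 0 < Real.log R := Real.log_pos (by linarith)
  have hW1 : ∀ r, Squarefree r → 1 ≤ sqf errorWeight r := fun r hr => by
    rw [sqf_of_squarefree _ hr]
    have : ∏ p ∈ r.primeFactors, (1 : ℝ) ≤ ∏ p ∈ r.primeFactors, errorWeight p :=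
      Finset.prod_le_prod (fun _ _ => zero_le_one) fun p _ => one_le_errorWeight p
    simpa using this
  have hA1 := hmain (C₀ * beta H) (densityWeight H) errorWeight (hh.mono hA' le_rfl)
    (fun p _ => one_le_errorWeight p) (fun p hp => mul_errorWeight_sq_le hh hA hp) R
    (diagonalForm H h₀ R ℓ₁) (diagonalForm H h₀ R ℓ₂) (by linarith) ?_ ?_ ?_
  · rw [show ℓ₁ + 1 + (ℓ₂ + 1) = ℓ₁ + ℓ₂ + 2 by ring,
      show k - 1 + (ℓ₁ + 1) + (ℓ₂ + 1) = k + ℓ₁ + ℓ₂ + 1 by omega] at hA1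
    have h1 : eulerConst (k - 1) (densityWeight H) = (singularSeries H)⁻¹ := by
      have := eulerConst_eq_inv hH (by omega)
      rwa [hHk] at this
    rw [h1, Nat.add_sub_cancel] at hA1
    refine hA1.trans ?_
    calc C * (C₀ * beta H) * (1 + Real.log R) ^ (k + ℓ₁ + ℓ₂)
        ≤ C * (C₀ * beta H) * (3 * Real.log R) ^ (k + ℓ₁ + ℓ₂) := by
          refine mul_le_mul_of_nonneg_left (pow_le_pow_left₀ (by linarith) (one_add_log_le hR) _) ?_
          exact mul_nonneg hC (by linarith)
      _ = _ := by rw [mul_pow]; ring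
  · intro r hr hrR
    have h1 := hd₁ H h₀ hH h₀H R (by linarith) r hr hrR
    have h2 := hW1 r hr
    refine h1.trans ?_
    rw [Nat.add_sub_cancel]
    have h3 : D₁ ≤ D * (C₀ * beta H) := by
      have : D₁ ≤ D := by simp only [D]; linarith
      nlinarith
    gcongr
  · intro r hr hrR
    have h1 := hd₂ H h₀ hH h₀H R (by linarith) r hr hrR
    have h2 := hW1 r hr
    refine h1.trans ?_
    rw [Nat.add_sub_cancel]
    have h3 : D₂ ≤ D * (C₀ * beta H) := by
      have : D₂ ≤ D := by simp only [D]; linarith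
      nlinarith
    gcongr
  · intro r hr hrR
    have h1 := hd₂ H h₀ hH h₀H R (by linarith) r hr hrR
    have h2 := hW1 r hr
    have hr1 : 1 ≤ r := Nat.one_le_iff_ne_zero.2 hr.ne_zero
    set ρ := 1 + Real.log R
    have hρ : 1 ≤ ρ := by simp only [ρ]; linarith
    have h4 : logCut R (ℓ₂ + 1) r ≤ ρ ^ (ℓ₂ + 1) :=
      (logCut_le (by linarith) hr1 _).trans (pow_le_pow_left₀ hlR.le (by simp only [ρ]; linarith) _)
    have h5 := logCut_nonneg R (ℓ₂ + 1) r
    -- The size bound is the main term plus the error just estimated.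
    have h6 : |diagonalForm H h₀ R ℓ₂ r| ≤ logCut R (ℓ₂ + 1) r
        + D₂ * sqf errorWeight r * ρ ^ ℓ₂ := by
      have := abs_le.1 h1
      rw [abs_le]
      constructor <;> linarith [this.1, this.2]
    refine h6.trans ?_
    have h7 : D₂ * sqf errorWeight r * ρ ^ ℓ₂ ≤ D₂ * sqf errorWeight r * ρ ^ (ℓ₂ + 1) := by
      gcongr
      omega
    have h8 : ρ ^ (ℓ₂ + 1) ≤ (D₁ + 1) * sqf errorWeight r * ρ ^ (ℓ₂ + 1) := by
      refine le_mul_of_one_le_left (by positivity) ?_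
      exact one_le_mul_of_one_le_of_one_le (by linarith) h2
    calc _ ≤ (D₁ + 1) * sqf errorWeight r * ρ ^ (ℓ₂ + 1)
          + D₂ * sqf errorWeight r * ρ ^ (ℓ₂ + 1) := by linarith
      _ = _ := by simp only [D]; ring

end Mem

/-! ### The linear forms when h₀ ∉ H. -/

section EulerProduct

theorem sum_sqf_le_exp {w : ℕ → ℝ} {c : ℝ} (hw : ∀ p, p.Prime → 0 ≤ w p)
    (hc : ∀ S : Finset ℕ, (∀ p ∈ S, p.Prime) → ∑ p ∈ S, w p ≤ c) (S : Finset ℕ) :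
    ∑ n ∈ S, sqf w n ≤ Real.exp c := by
  have hT : ∀ p ∈ S.biUnion fun n => n.primeFactors, p.Prime := by
    intro p hp
    obtain ⟨n, _, hn⟩ := Finset.mem_biUnion.1 hp
    exact Nat.prime_of_mem_primeFactors hn
  refine (sum_sqf_le_prod S (S.biUnion fun n => n.primeFactors) hw hT ?_).trans
    ((prod_one_add_le_exp _ fun p hp => hw p (hT p hp)).trans (Real.exp_le_exp.2 (hc _ hT)))
  intro n hn _
  exact Finset.subset_biUnion_of_mem (fun n : ℕ => n.primeFactors) hn

theorem summable_sqf {w : ℕ → ℝ} {c : ℝ} (hw : ∀ p, p.Prime → 0 ≤ w p)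
    (hc : ∀ S : Finset ℕ, (∀ p ∈ S, p.Prime) → ∑ p ∈ S, w p ≤ c) : Summable (sqf w) :=
  summable_of_sum_le (fun n => sqf_nonneg hw n) (sum_sqf_le_exp hw hc)

theorem hasProd_sqf {w : ℕ → ℝ} (hw : Summable (sqf fun p => |w p|)) :
    HasProd (fun p : Nat.Primes => 1 + w p) (∑' n : ℕ, sqf w n) := by
  have hn : Summable (fun n => ‖sqf w n‖) := by
    simpa only [Real.norm_eq_abs, abs_sqf] using hw
  have h1 := EulerProduct.eulerProduct_hasProd (f := sqf w) (sqf_one w)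
    (fun hmn => sqf_mul_of_coprime w hmn) hn (sqf_zero w)
  refine hasProd_of_eq h1 fun p => ?_
  rw [tsum_eq_sum (s := Finset.range 2)]
  · simp [Finset.sum_range_succ, sqf_one, sqf_prime w p.2]
  · intro e he
    have he2 : 2 ≤ e := not_lt.1 fun h => he (Finset.mem_range.2 h)
    refine sqf_of_not_squarefree _ fun hsq => ?_
    have : (p : ℕ) * p ∣ (p : ℕ) ^ e := by rw [← sq]; exact pow_dvd_pow _ he2
    exact p.2.one_lt.ne' (Nat.isUnit_iff.1 (hsq _ this))

/-- Distribute log n over the primes of n; dropping both the coprimality condition and the cutoff on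
the product only enlarges the sum, which then factors. -/
theorem sum_sqf_mul_log_le {w : ℕ → ℝ} {L : ℝ} (hw : ∀ p, p.Prime → 0 ≤ w p)
    (hL : ∀ S : Finset ℕ, (∀ p ∈ S, p.Prime) → ∑ p ∈ S, w p * Real.log p ≤ L)
    (hs : Summable (sqf w)) (M : ℕ) :
    ∑ n ∈ Finset.Ico 1 M, sqf w n * Real.log n ≤ L * ∑' n, sqf w n := by
  set F : ℕ → ℕ → ℝ := fun e t =>
    (if e.Prime then w e * Real.log e else 0) * sqf (awayFrom e w) t
  have hF1 : ∀ e : ℕ, 0 ≤ if e.Prime then w e * Real.log e else 0 := by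
    intro e
    split_ifs with h
    · exact mul_nonneg (hw e h) (Real.log_natCast_nonneg e)
    · exact le_rfl
  have hF2 : ∀ e t, 0 ≤ sqf (awayFrom e w) t := fun e t =>
    sqf_nonneg (fun p hp => awayFrom_nonneg (hw p hp)) t
  have hF3 : ∀ e t, sqf (awayFrom e w) t ≤ sqf w t := fun e t =>
    sqf_le_sqf (fun p hp => awayFrom_nonneg (hw p hp)) (fun p hp => awayFrom_le (hw p hp)) t
  have hW : ∑ t ∈ Finset.Ico 1 M, sqf w t ≤ ∑' n, sqf w n :=
    hs.sum_le_tsum _ fun n _ => sqf_nonneg hw n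
  have hS : ∑ e ∈ Finset.Ico 1 M, (if e.Prime then w e * Real.log e else 0) ≤ L := by
    rw [← Finset.sum_filter]
    exact hL _ fun p hp => (Finset.mem_filter.1 hp).2
  calc _ = ∑ n ∈ Finset.Ico 1 M, ∑ x ∈ n.divisorsAntidiagonal,
        (if x.1 * x.2 < M then F x.1 x.2 else 0) := by
        refine Finset.sum_congr rfl fun n hn => ?_
        rw [sqf_mul_log]
        refine Finset.sum_congr rfl fun x hx => ?_
        rw [(Nat.mem_divisorsAntidiagonal.1 hx).1, if_pos (Finset.mem_Ico.1 hn).2]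
    _ = ∑ e ∈ Finset.Ico 1 M, ∑ t ∈ Finset.Ico 1 M, (if e * t < M then F e t else 0) :=
        sum_divisorsAntidiagonal_Ico M (fun e t => if e * t < M then F e t else 0)
          fun e t h => if_neg (not_lt.2 h)
    _ ≤ ∑ e ∈ Finset.Ico 1 M, ∑ t ∈ Finset.Ico 1 M,
          (if e.Prime then w e * Real.log e else 0) * sqf w t := by
        refine Finset.sum_le_sum fun e _ => Finset.sum_le_sum fun t _ => ?_
        have h1 := mul_le_mul_of_nonneg_left (hF3 e t) (hF1 e)
        have h2 := mul_nonneg (hF1 e) (hF2 e t)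
        by_cases h : e * t < M
        · rw [if_pos h]; exact h1
        · rw [if_neg h]; exact h2.trans h1
    _ = (∑ e ∈ Finset.Ico 1 M, (if e.Prime then w e * Real.log e else 0))
          * ∑ t ∈ Finset.Ico 1 M, sqf w t := by rw [Finset.sum_mul_sum]
    _ ≤ _ := mul_le_mul hS hW (Finset.sum_nonneg fun n _ => sqf_nonneg hw n)
        ((Finset.sum_nonneg fun e _ => hF1 e).trans hS)

end EulerProduct

/-- The function u^ℓ/ℓ! has slope at most (log R)^(ℓ-1) on [0, log R], and its argument moves by at
most log n. For ℓ = 0 the cutoff jumps at R and this fails, hence the requirement ℓ₁, ℓ₂ ≥ 1 in this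
case. -/
theorem abs_logCut_mul_sub_le {R : ℝ} {r n ℓ : ℕ} (hr : 1 ≤ r) (hrR : (r : ℝ) < R) (hn : 1 ≤ n)
    (hℓ : 1 ≤ ℓ) : |logCut R ℓ (r * n) - logCut R ℓ r| ≤ Real.log n * Real.log R ^ (ℓ - 1) := by
  have hr1 : (1 : ℝ) ≤ r := by exact_mod_cast hr
  have hn1 : (1 : ℝ) ≤ n := by exact_mod_cast hn
  have hR0 : 0 < R := by linarith
  set u := Real.log (R / r)
  have hu : 0 ≤ u := Real.log_nonneg (by rw [one_le_div (by linarith)]; exact hrR.le)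
  have huR : u ≤ Real.log R :=
    Real.log_le_log (by positivity) (div_le_self (by linarith) hr1)
  have hln : 0 ≤ Real.log n := Real.log_nonneg hn1
  have hf : (0 : ℝ) < ℓ.factorial := by positivity
  -- Here v is log(R/(rn)) when rn < R and 0 otherwise; in the second case rn ≥ R gives u ≤ log n.
  obtain ⟨v, hv0, hvu, hvn, hv⟩ : ∃ v : ℝ, 0 ≤ v ∧ v ≤ u ∧ u - v ≤ Real.log n ∧
      logCut R ℓ (r * n) = v ^ ℓ / (ℓ.factorial : ℝ) := by
    rcases lt_or_ge ((r * n : ℕ) : ℝ) R with h | h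
    · have h1 : Real.log (R / (r * n : ℕ)) = u - Real.log n := by
        rw [Nat.cast_mul, ← div_div, Real.log_div (by positivity) (by positivity)]
      refine ⟨u - Real.log n, ?_, by linarith, by linarith, by rw [logCut_of_lt h, h1]⟩
      rw [← h1]
      refine Real.log_nonneg ?_
      rw [one_le_div (by push_cast; positivity)]
      exact h.le
    · refine ⟨0, le_rfl, hu, ?_, by rw [logCut_of_le h, zero_pow (by omega), zero_div]⟩
      rw [sub_zero]
      refine Real.log_le_log (by positivity) ?_
      rw [div_le_iff₀ (by linarith)]
      push_cast at h
      linarith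
  rw [hv, logCut_of_lt hrR, ← sub_div, abs_div, abs_of_pos hf, div_le_iff₀ hf]
  refine (abs_pow_sub_pow_le v u ℓ).trans ?_
  rw [abs_of_nonneg hv0, abs_of_nonneg hu, max_eq_right hvu, abs_sub_comm,
    abs_of_nonneg (by linarith)]
  have h1 : (ℓ : ℝ) ≤ ℓ.factorial := by exact_mod_cast Nat.self_le_factorial ℓ
  calc (u - v) * ℓ * u ^ (ℓ - 1) ≤ Real.log n * ℓ.factorial * Real.log R ^ (ℓ - 1) := by gcongr
    _ = _ := by ring

section NotMem

variable {H : Finset ℤ} {h₀ : ℤ}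

/-- Adding h₀ either leaves ν_p unchanged, so that a = 1 + 1/(p-1) and p is charged to β(H⁰), or
raises it by one, so that a = 1 - ν_p/((p-1)(p-ν_p)) = 1 - O(1/p²). The second bound lets products
of 1 + |a - 1| be compared with products of a itself, at a cost depending only on k. -/
theorem transferWeight_sub_one_bounds (hH₀ : Admissible (insert h₀ H)) {k : ℕ} (hk : H.card = k)
    {p : ℕ} (hp : p.Prime) :
    |transferWeight H h₀ p - 1| ≤ ((k : ℝ) + 1 - nuPrime (insert h₀ H) p) / p
        + 4 * (k + 1) ^ 3 * (1 / (p : ℝ) ^ 2) ∧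
    1 + |transferWeight H h₀ p - 1|
      ≤ transferWeight H h₀ p * (1 + 4 * (k + 2) ^ 3 * (1 / (p : ℝ) ^ 2)) ∧
    0 < transferWeight H h₀ p := by
  have h1 := hH₀.add_one_le hp
  have h2 := hH₀.of_insert.add_one_le hp
  have h3 : (nuPrime H p : ℝ) ≤ k := by
    rw [← hk]; exact_mod_cast nuPrime_le_card H p
  have h0 : (0 : ℝ) ≤ nuPrime H p := Nat.cast_nonneg _
  have hp2 : (2 : ℝ) ≤ p := by exact_mod_cast hp.two_le
  have hk0 : (0 : ℝ) ≤ k := Nat.cast_nonneg _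
  have hP := le_mul_sub_of_lt h3 h2 h0
  have hcase : nuPrime (insert h₀ H) p = nuPrime H p ∨
      nuPrime (insert h₀ H) p = nuPrime H p + 1 := by
    have := nuPrime_le_insert H h₀ p
    have := nuPrime_insert_le H h₀ p
    omega
  set ν : ℝ := (nuPrime H p : ℝ)
  set P : ℝ := (p : ℝ)
  set K : ℝ := (k : ℝ)
  have d1 : 0 < P - 1 := by linarith
  have d2 : 0 < P - ν := by linarith
  have hc : 0 ≤ 4 * (K + 1) ^ 3 * (1 / P ^ 2) := by positivity
  have hc2 : 0 ≤ 4 * (K + 2) ^ 3 * (1 / P ^ 2) := by positivity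
  rcases hcase with h | h
  · have e : transferWeight H h₀ p = 1 + 1 / (P - 1) := by
      unfold transferWeight
      rw [h]
      change P * (P - ν) / ((P - 1) * (P - ν)) = _
      field_simp
      ring
    have hpos : 0 ≤ 1 / (P - 1) := by positivity
    rw [e, add_sub_cancel_left, abs_of_nonneg hpos, h]
    refine ⟨?_, le_mul_of_one_le_right (by linarith) (by linarith), by linarith⟩
    have h4 : 1 / (P - 1) ≤ 1 / P + 4 * (1 / P ^ 2) := by
      rw [show 1 / P + 4 * (1 / P ^ 2) = (P + 4) / P ^ 2 by field_simp,
        div_le_div_iff₀ d1 (by positivity)]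
      nlinarith
    have h5 : 1 / P ≤ (K + 1 - ν) / P := by gcongr; linarith
    have h6 : 4 * (1 / P ^ 2) ≤ 4 * (K + 1) ^ 3 * (1 / P ^ 2) := by
      have : 1 ≤ (K + 1) ^ 3 := one_le_pow₀ (by linarith)
      gcongr
      linarith
    exact h4.trans (add_le_add h5 h6)
  · have hν : (nuPrime (insert h₀ H) p : ℝ) = ν + 1 := by rw [h]; push_cast; rfl
    rw [hν] at h1
    set b := ν / ((P - 1) * (P - ν))
    have e : transferWeight H h₀ p = 1 - b := by
      unfold transferWeight
      rw [hν]
      change P * (P - (ν + 1)) / ((P - 1) * (P - ν)) = _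
      simp only [b]
      field_simp
      ring
    have hb0 : 0 ≤ b := by positivity
    have hb : b ≤ 2 * (K + 1) ^ 2 * (1 / P ^ 2) := by
      simp only [b]
      rw [mul_one_div, div_le_div_iff₀ (by positivity) (by positivity)]
      have h7 : P * P ≤ 2 * (P - 1) * ((P - ν) * (K + 1)) :=
        mul_le_mul (by linarith) hP (by linarith) (by linarith)
      have h8 : ν * (P * P) ≤ (K + 1) * (2 * (P - 1) * ((P - ν) * (K + 1))) :=
        mul_le_mul (by linarith) h7 (by positivity) (by linarith)
      nlinarith
    -- With this lower bound, 1 + b = (1 - b) + 2b is at most 1 - b times 1 + O(1/p²).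
    have ha : 1 / (K + 2) ≤ 1 - b := by
      rw [← e]
      unfold transferWeight
      rw [hν]
      change 1 / (K + 2) ≤ P * (P - (ν + 1)) / ((P - 1) * (P - ν))
      have h9 := le_mul_sub_of_lt (k := K + 1) (by linarith : ν + 1 ≤ K + 1) h1 (by linarith)
      rw [div_le_div_iff₀ (by linarith) (by positivity)]
      have h10 : (P - 1) * (P - ν) ≤ P * P := mul_le_mul (by linarith) (by linarith) d2.le (by linarith)
      have h11 : P * P ≤ P * ((P - (ν + 1)) * (K + 1 + 1)) :=
        mul_le_mul_of_nonneg_left h9 (by linarith)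
      nlinarith
    have ha0 : 0 < 1 / (K + 2) := by positivity
    rw [e, sub_sub_cancel_left, abs_neg, abs_of_nonneg hb0, hν]
    refine ⟨?_, ?_, by linarith⟩
    · have h4 : 0 ≤ (K + 1 - (ν + 1)) / P := div_nonneg (by linarith) (by linarith)
      have h5 : 2 * (K + 1) ^ 2 * (1 / P ^ 2) ≤ 4 * (K + 1) ^ 3 * (1 / P ^ 2) := by
        have : (K + 1) ^ 2 ≤ (K + 1) ^ 3 := pow_le_pow_right₀ (by linarith) (by norm_num)
        have h0 : 0 ≤ (K + 1) ^ 2 := by positivity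
        gcongr
        linarith
      linarith
    · have h4 : 1 / (K + 2) * (4 * (K + 2) ^ 3 * (1 / P ^ 2))
          ≤ (1 - b) * (4 * (K + 2) ^ 3 * (1 / P ^ 2)) := mul_le_mul_of_nonneg_right ha hc2
      have h5 : 1 / (K + 2) * (4 * (K + 2) ^ 3 * (1 / P ^ 2)) = 4 * (K + 2) ^ 2 * (1 / P ^ 2) := by
        field_simp
      have h6 : 2 * (K + 1) ^ 2 * (1 / P ^ 2) ≤ 2 * (K + 2) ^ 2 * (1 / P ^ 2) := by
        gcongr
        linarith
      linarith

theorem sum_abs_transferWeight_sub_one_mul_log_le (hH₀ : Admissible (insert h₀ H)) {k : ℕ}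
    (hk : H.card = k) (h₀H : h₀ ∉ H) (S : Finset ℕ) (hS : ∀ p ∈ S, p.Prime) :
    ∑ p ∈ S, |transferWeight H h₀ p - 1| * Real.log p
      ≤ beta (insert h₀ H) + 4 * (k + 1) ^ 3 * (2 * ∑' n : ℕ, (n : ℝ) ^ (-(3 / 2) : ℝ)) := by
  have h1 : ∀ p ∈ S, |transferWeight H h₀ p - 1| * Real.log p
      ≤ (((insert h₀ H).card : ℝ) - (nuPrime (insert h₀ H) p : ℝ)) * Real.log p / p
        + 4 * (k + 1) ^ 3 * (Real.log p / (p : ℝ) ^ 2) := by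
    intro p hp
    have h2 := (transferWeight_sub_one_bounds hH₀ hk (hS p hp)).1
    refine (mul_le_mul_of_nonneg_right h2 (Real.log_natCast_nonneg p)).trans (le_of_eq ?_)
    rw [Finset.card_insert_of_notMem h₀H, hk]
    push_cast
    ring
  refine (Finset.sum_le_sum h1).trans ?_
  rw [Finset.sum_add_distrib, ← Finset.mul_sum]
  exact add_le_add (sum_le_beta _ S hS)
    (mul_le_mul_of_nonneg_left (sum_log_div_sq_le S) (by positivity))

end NotMem

section NotMem

/-- The ratio `∏ p (p - ν_p(H ∪ {h₀})) / ((p - 1) (p - ν_p(H)))` of singular series. -/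
def transferConst (H : Finset ℤ) (h₀ : ℤ) : ℝ :=
  ∑' n : ℕ, sqf (fun p => transferWeight H h₀ p - 1) n

variable {H : Finset ℤ} {h₀ : ℤ}

theorem sum_abs_transferWeight_sub_one_le (hH₀ : Admissible (insert h₀ H)) (h₀H : h₀ ∉ H)
    (S : Finset ℕ) (hS : ∀ p ∈ S, p.Prime) :
    ∑ p ∈ S, |transferWeight H h₀ p - 1| ≤ (beta (insert h₀ H)
      + 4 * (H.card + 1) ^ 3 * (2 * ∑' n : ℕ, (n : ℝ) ^ (-(3 / 2) : ℝ))) / Real.log 2 := by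
  have hl : 0 < Real.log 2 := Real.log_pos (by norm_num)
  rw [le_div_iff₀ hl, Finset.sum_mul]
  refine (Finset.sum_le_sum fun p hp => ?_).trans
    (sum_abs_transferWeight_sub_one_mul_log_le hH₀ rfl h₀H S hS)
  refine mul_le_mul_of_nonneg_left ?_ (abs_nonneg _)
  exact Real.log_le_log (by norm_num) (by exact_mod_cast (hS p hp).two_le)

theorem abs_awayFrom (r : ℕ) (w : ℕ → ℝ) (p : ℕ) :
    |awayFrom r w p| = awayFrom r (fun p => |w p|) p := by
  unfold awayFrom; split_ifs <;> simp

theorem summable_sqf_abs_awayFrom (hH₀ : Admissible (insert h₀ H)) (h₀H : h₀ ∉ H) (r : ℕ) :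
    Summable (sqf fun p => |awayFrom r (fun p => transferWeight H h₀ p - 1) p|) := by
  refine summable_sqf (fun _ _ => abs_nonneg _) fun S hS =>
    (Finset.sum_le_sum fun p hp => ?_).trans (sum_abs_transferWeight_sub_one_le hH₀ h₀H S hS)
  rw [abs_awayFrom]
  exact awayFrom_le (abs_nonneg _)

theorem summable_sqf_abs_transferWeight (hH₀ : Admissible (insert h₀ H)) (h₀H : h₀ ∉ H) :
    Summable (sqf fun p => |transferWeight H h₀ p - 1|) :=
  summable_sqf (fun _ _ => abs_nonneg _) (sum_abs_transferWeight_sub_one_le hH₀ h₀H)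

theorem hasProd_transferWeight (hH₀ : Admissible (insert h₀ H)) (h₀H : h₀ ∉ H) :
    HasProd (fun p : Nat.Primes => transferWeight H h₀ p) (transferConst H h₀) :=
  hasProd_of_eq (hasProd_sqf (summable_sqf_abs_transferWeight hH₀ h₀H)) fun p => by ring

/-- The outer factor restores the Euler factors at p ∣ r missing from the inner sum, so the main
term is the same for all r. -/
theorem sqf_mul_tsum_awayFrom (hH₀ : Admissible (insert h₀ H)) (h₀H : h₀ ∉ H) {r : ℕ}
    (hr : Squarefree r) :
    sqf (transferWeight H h₀) r
      * ∑' n : ℕ, sqf (awayFrom r fun p => transferWeight H h₀ p - 1) n = transferConst H h₀ := by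
  have h1 := hasProd_sqf (summable_sqf_abs_awayFrom hH₀ h₀H r)
  have h2 : HasProd (fun p : Nat.Primes => if (p : ℕ) ∣ r then transferWeight H h₀ p else 1)
      (sqf (transferWeight H h₀) r) := by
    have h3 := hasProd_prod_of_ne_finset_one (L := .unconditional Nat.Primes)
      (f := fun p : Nat.Primes => if (p : ℕ) ∣ r then transferWeight H h₀ p else 1)
      (s := r.primeFactors.subtype Nat.Prime) (fun p hp => if_neg fun h => hp
        (Finset.mem_subtype.2 (Nat.mem_primeFactors.2 ⟨p.2, h, hr.ne_zero⟩)))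
    have h4 : ∏ p ∈ r.primeFactors.subtype Nat.Prime,
        (if (p : ℕ) ∣ r then transferWeight H h₀ p else 1) = sqf (transferWeight H h₀) r := by
      rw [sqf_of_squarefree _ hr, Finset.prod_subtype_of_mem (p := Nat.Prime)
        (fun p : ℕ => if p ∣ r then transferWeight H h₀ p else 1)
        fun p hp => Nat.prime_of_mem_primeFactors hp]
      exact Finset.prod_congr rfl fun p hp => if_pos (Nat.dvd_of_mem_primeFactors hp)
    rw [← h4]
    exact h3
  refine HasProd.unique ?_ (hasProd_transferWeight hH₀ h₀H)
  refine hasProd_of_eq (h2.mul h1) fun p => ?_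
  unfold awayFrom
  split_ifs <;> ring

/-- Compare Euler products factor by factor using the second bound of
`transferWeight_sub_one_bounds`. Taking absolute values thus costs only a constant depending on |H|,
uniformly in r. -/
theorem sqf_mul_tsum_abs_le (hH₀ : Admissible (insert h₀ H)) (h₀H : h₀ ∉ H) {r : ℕ}
    (hr : Squarefree r) :
    sqf (transferWeight H h₀) r
      * ∑' n : ℕ, sqf (fun p => |awayFrom r (fun p => transferWeight H h₀ p - 1) p|) n
      ≤ transferConst H h₀
        * Real.exp (4 * (H.card + 2) ^ 3 * ∑' n : ℕ, (n : ℝ) ^ (-(3 / 2) : ℝ)) := by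
  set E := Real.exp (4 * (H.card + 2) ^ 3 * ∑' n : ℕ, (n : ℝ) ^ (-(3 / 2) : ℝ))
  have hb := fun p hp => transferWeight_sub_one_bounds (p := p) hH₀ rfl hp
  have h1 := hasProd_sqf (summable_sqf_abs_awayFrom hH₀ h₀H r)
  have h2 := hasProd_sqf (w := fun p => |awayFrom r (fun p => transferWeight H h₀ p - 1) p|)
    (by simpa only [abs_abs] using summable_sqf_abs_awayFrom hH₀ h₀H r)
  rw [← sqf_mul_tsum_awayFrom hH₀ h₀H hr, mul_assoc]
  refine mul_le_mul_of_nonneg_left ?_ (sqf_nonneg (fun p hp => (hb p hp).2.2.le) r)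
  refine le_of_tendsto_of_tendsto' h2 (Tendsto.mul_const E h1) fun s => ?_
  have hpos : ∀ p : Nat.Primes, 0 ≤ 1 + awayFrom r (fun p => transferWeight H h₀ p - 1) p := by
    intro p
    have := (hb p p.2).2.2
    unfold awayFrom
    split_ifs <;> linarith
  calc _ ≤ ∏ p ∈ s, (1 + awayFrom r (fun p => transferWeight H h₀ p - 1) p)
        * Real.exp (4 * (H.card + 2) ^ 3 * ((p : ℕ) : ℝ) ^ (-(3 / 2) : ℝ)) := by
        refine Finset.prod_le_prod (fun p _ => by positivity) fun p _ => ?_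
        have h3 := (hb p p.2).2.1
        have h4 := inv_sq_le_rpow p.2.one_le
        have h5 : 1 + 4 * ((H.card : ℝ) + 2) ^ 3 * (1 / ((p : ℕ) : ℝ) ^ 2)
            ≤ Real.exp (4 * (H.card + 2) ^ 3 * ((p : ℕ) : ℝ) ^ (-(3 / 2) : ℝ)) := by
          have h6 := mul_le_mul_of_nonneg_left h4
            (by positivity : 0 ≤ 4 * ((H.card : ℝ) + 2) ^ 3)
          linarith [Real.add_one_le_exp (4 * (H.card + 2) ^ 3 * ((p : ℕ) : ℝ) ^ (-(3 / 2) : ℝ))]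
        have h7 := (hb p p.2).2.2
        unfold awayFrom
        split_ifs
        · have : 0 ≤ 4 * ((H.card : ℝ) + 2) ^ 3 * (1 / ((p : ℕ) : ℝ) ^ 2) := by positivity
          rw [abs_zero, add_zero, one_mul]
          linarith
        · rw [add_sub_cancel]
          exact h3.trans (mul_le_mul_of_nonneg_left h5 h7.le)
    _ = (∏ p ∈ s, (1 + awayFrom r (fun p => transferWeight H h₀ p - 1) p))
        * Real.exp (∑ p ∈ s, 4 * (H.card + 2) ^ 3 * ((p : ℕ) : ℝ) ^ (-(3 / 2) : ℝ)) := by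
        rw [Finset.prod_mul_distrib, Real.exp_sum]
    _ ≤ _ := by
        refine mul_le_mul_of_nonneg_left (Real.exp_le_exp.2 ?_)
          (Finset.prod_nonneg fun p _ => hpos p)
        rw [← Finset.mul_sum]
        refine mul_le_mul_of_nonneg_left ?_ (by positivity)
        have hs : Summable (fun p : Nat.Primes => ((p : ℕ) : ℝ) ^ (-(3 / 2) : ℝ)) :=
          summable_three_halves.comp_injective Subtype.val_injective
        refine (hs.sum_le_tsum s fun p _ => by positivity).trans ?_
        exact tsum_comp_le_tsum_of_inj summable_three_halves (fun n => by positivity)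
          Subtype.val_injective

/-- The term n = 1 of the absolute sum is already 1. This bounds 𝔖(H⁰)/𝔖(H) from below. -/
theorem one_le_transferConst_mul (hH₀ : Admissible (insert h₀ H)) (h₀H : h₀ ∉ H) :
    1 ≤ transferConst H h₀
      * Real.exp (4 * (H.card + 2) ^ 3 * ∑' n : ℕ, (n : ℝ) ^ (-(3 / 2) : ℝ)) := by
  refine le_trans ?_ (sqf_mul_tsum_abs_le hH₀ h₀H squarefree_one)
  rw [sqf_one, one_mul]
  have h1 := (summable_sqf_abs_awayFrom hH₀ h₀H 1).le_tsum 1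
    fun n _ => sqf_nonneg (fun _ _ => abs_nonneg _) n
  rwa [sqf_one] at h1

theorem transferConst_pos (hH₀ : Admissible (insert h₀ H)) (h₀H : h₀ ∉ H) :
    0 < transferConst H h₀ :=
  pos_of_mul_pos_left (zero_lt_one.trans_le (one_le_transferConst_mul hH₀ h₀H)) (Real.exp_pos _).le

/-- The ratio of the Euler factors of the two singular series is a(p), including the extra factor (1
- 1/p)⁻¹ from the larger tuple. -/
theorem singularSeries_insert (hH₀ : Admissible (insert h₀ H)) (h₀H : h₀ ∉ H) (hk : 2 ≤ H.card) :
    singularSeries (insert h₀ H) = transferConst H h₀ * singularSeries H := by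
  have hc := Finset.card_insert_of_notMem h₀H
  have h1 := (multipliable_singularFactor hH₀ (by omega)).hasProd
  have h2 := (multipliable_singularFactor hH₀.of_insert hk).hasProd
  refine h1.unique (hasProd_of_eq ((hasProd_transferWeight hH₀ h₀H).mul h2) fun p => ?_)
  have hd := hH₀.of_insert.add_one_le p.2
  have hp1 : (1 : ℝ) < (p : ℕ) := by exact_mod_cast p.2.one_lt
  have d1 : ((p : ℕ) : ℝ) - 1 ≠ 0 := by linarith
  have d2 : ((p : ℕ) : ℝ) - nuPrime H p ≠ 0 := by linarith
  have d3 : ((p : ℕ) : ℝ) ≠ 0 := by linarith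
  have hx : (1 - 1 / ((p : ℕ) : ℝ)) = (((p : ℕ) : ℝ) - 1) / (p : ℕ) := by field_simp
  unfold singularFactor transferWeight
  rw [hc, pow_succ, mul_inv, hx, inv_div]
  field_simp

/-- Replace the cutoff at rn by the cutoff at r and complete the sum over n, which then gives B
times the cutoff. By `abs_logCut_mul_sub_le` the replacement costs ∑ |(a-1)(n)| log n, controlled
through `sum_sqf_mul_log_le` by the discrepancy of a. -/
theorem abs_diagonalForm_sub_le (hH₀ : Admissible (insert h₀ H)) (h₀H : h₀ ∉ H) {ℓ : ℕ}
    (hℓ : 1 ≤ ℓ) {R : ℝ} (hR : 1 < R) {r : ℕ} (hr : Squarefree r) (hrR : (r : ℝ) < R) :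
    |diagonalForm H h₀ R ℓ r - transferConst H h₀ * logCut R ℓ r|
      ≤ transferConst H h₀
        * Real.exp (4 * (H.card + 2) ^ 3 * ∑' n : ℕ, (n : ℝ) ^ (-(3 / 2) : ℝ))
        * (beta (insert h₀ H) + 4 * (H.card + 1) ^ 3 * (2 * ∑' n : ℕ, (n : ℝ) ^ (-(3 / 2) : ℝ)))
        * Real.log R ^ (ℓ - 1) := by
  set E := Real.exp (4 * (H.card + 2) ^ 3 * ∑' n : ℕ, (n : ℝ) ^ (-(3 / 2) : ℝ))
  set L := beta (insert h₀ H) + 4 * (H.card + 1) ^ 3 * (2 * ∑' n : ℕ, (n : ℝ) ^ (-(3 / 2) : ℝ))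
  have hr1 : 1 ≤ r := Nat.one_le_iff_ne_zero.2 hr.ne_zero
  have hlR : 0 ≤ Real.log R := Real.log_nonneg hR.le
  set f := sqf (awayFrom r fun p => transferWeight H h₀ p - 1)
  set w : ℕ → ℝ := fun p => |awayFrom r (fun p => transferWeight H h₀ p - 1) p|
  have hw0 : ∀ p : ℕ, p.Prime → 0 ≤ w p := fun _ _ => abs_nonneg _
  have hws : Summable (sqf w) := summable_sqf_abs_awayFrom hH₀ h₀H r
  have hfw : ∀ n, |f n| = sqf w n := fun n => abs_sqf _ n
  have hfs : Summable f := Summable.of_norm (by simpa only [Real.norm_eq_abs, hfw] using hws)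
  have hL : ∀ S : Finset ℕ, (∀ p ∈ S, p.Prime) → ∑ p ∈ S, w p * Real.log p ≤ L := fun S hS => by
    refine (Finset.sum_le_sum fun p _ => ?_).trans
      (sum_abs_transferWeight_sub_one_mul_log_le hH₀ rfl h₀H S hS)
    refine mul_le_mul_of_nonneg_right ?_ (Real.log_natCast_nonneg p)
    simp only [w]
    rw [abs_awayFrom]
    exact awayFrom_le (abs_nonneg _)
  set g : ℕ → ℝ := fun n => logCut R ℓ (r * n) - logCut R ℓ r
  have ha0 : 0 ≤ sqf (transferWeight H h₀) r :=
    sqf_nonneg (fun p hp => (transferWeight_sub_one_bounds hH₀ rfl hp).2.2.le) r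
  have hfin : ∀ n, ∑ i ∈ Finset.range n, |f i * g i| ≤ L * (∑' n, sqf w n) * Real.log R ^ (ℓ - 1) := by
    intro n
    have h1 : ∀ i ∈ Finset.range n, |f i * g i|
        ≤ (if 1 ≤ i then sqf w i * Real.log i else 0) * Real.log R ^ (ℓ - 1) := by
      intro i _
      rcases Nat.eq_zero_or_pos i with rfl | hi
      · simp [f, sqf_zero]
      · rw [if_pos (show 1 ≤ i from hi), abs_mul, hfw, mul_assoc]
        exact mul_le_mul_of_nonneg_left (abs_logCut_mul_sub_le hr1 hrR hi hℓ) (sqf_nonneg hw0 i)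
    refine (Finset.sum_le_sum h1).trans ?_
    rw [← Finset.sum_mul, ← Finset.sum_filter]
    refine mul_le_mul_of_nonneg_right ?_ (by positivity)
    have h2 : (Finset.range n).filter (fun i => 1 ≤ i) = Finset.Ico 1 n := by
      ext i; simp [and_comm]
    rw [h2]
    exact sum_sqf_mul_log_le hw0 hL hws n
  have hsum : Summable (fun n => |f n * g n|) :=
    summable_of_sum_range_le (fun n => abs_nonneg _) hfin
  have htsum : |∑' n, f n * g n| ≤ L * (∑' n, sqf w n) * Real.log R ^ (ℓ - 1) := by
    have h1 := norm_tsum_le_tsum_norm (f := fun n => f n * g n)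
      (by simpa only [Real.norm_eq_abs] using hsum)
    simp only [Real.norm_eq_abs] at h1
    exact h1.trans (Real.tsum_le_of_sum_range_le (fun n => abs_nonneg _) hfin)
  have hcut : HasSum (fun n => f n * logCut R ℓ (r * n))
      (∑ n ∈ Finset.Ico 1 ⌈R⌉₊, f n * logCut R ℓ (r * n)) := by
    refine hasSum_sum_of_ne_finset_zero fun n hn => ?_
    rcases Nat.eq_zero_or_pos n with rfl | hn0
    · simp [f, sqf_zero]
    · rw [logCut_of_ceil_le, mul_zero]
      have : ⌈R⌉₊ ≤ n := by
        by_contra h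
        exact hn (Finset.mem_Ico.2 ⟨hn0, not_le.1 h⟩)
      exact this.trans (Nat.le_mul_of_pos_left n hr1)
  have heq : diagonalForm H h₀ R ℓ r - transferConst H h₀ * logCut R ℓ r
      = sqf (transferWeight H h₀) r * ∑' n, f n * g n := by
    have h1 := (hcut.sub (hfs.hasSum.mul_right (logCut R ℓ r))).tsum_eq
    have h2 : ∑' n, f n * g n = ∑' n, (f n * logCut R ℓ (r * n) - f n * logCut R ℓ r) :=
      tsum_congr fun n => by simp only [g]; ring
    rw [h2, h1, ← sqf_mul_tsum_awayFrom hH₀ h₀H hr, mul_sub, diagonalForm, mul_assoc]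
  have hL0 : 0 ≤ L := by simpa using hL ∅ (by simp)
  rw [heq, abs_mul, abs_of_nonneg ha0]
  calc _ ≤ sqf (transferWeight H h₀) r * (L * (∑' n, sqf w n) * Real.log R ^ (ℓ - 1)) :=
        mul_le_mul_of_nonneg_left htsum ha0
    _ = (sqf (transferWeight H h₀) r * ∑' n, sqf w n) * (L * Real.log R ^ (ℓ - 1)) := by ring
    _ ≤ (transferConst H h₀ * E) * (L * Real.log R ^ (ℓ - 1)) :=
        mul_le_mul_of_nonneg_right (sqf_mul_tsum_abs_le hH₀ h₀H hr) (by positivity)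
    _ = _ := by ring

theorem abs_diagonalForm_le (hH₀ : Admissible (insert h₀ H)) (h₀H : h₀ ∉ H) (ℓ : ℕ)
    {R : ℝ} (hR : 1 < R) {r : ℕ} (hr : Squarefree r) :
    |diagonalForm H h₀ R ℓ r| ≤ transferConst H h₀
        * Real.exp (4 * (H.card + 2) ^ 3 * ∑' n : ℕ, (n : ℝ) ^ (-(3 / 2) : ℝ))
        * Real.log R ^ ℓ := by
  have hr1 : 1 ≤ r := Nat.one_le_iff_ne_zero.2 hr.ne_zero
  have hlR : 0 ≤ Real.log R := Real.log_nonneg hR.le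
  have ha0 : 0 ≤ sqf (transferWeight H h₀) r :=
    sqf_nonneg (fun p hp => (transferWeight_sub_one_bounds hH₀ rfl hp).2.2.le) r
  set w : ℕ → ℝ := fun p => |awayFrom r (fun p => transferWeight H h₀ p - 1) p|
  have hw0 : ∀ n, 0 ≤ sqf w n := fun n => sqf_nonneg (fun _ _ => abs_nonneg _) n
  have h1 : |∑ n ∈ Finset.Ico 1 ⌈R⌉₊, sqf (awayFrom r fun p => transferWeight H h₀ p - 1) n
      * logCut R ℓ (r * n)| ≤ (∑' n, sqf w n) * Real.log R ^ ℓ := by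
    refine (Finset.abs_sum_le_sum_abs _ _).trans ?_
    calc _ ≤ ∑ n ∈ Finset.Ico 1 ⌈R⌉₊, sqf w n * Real.log R ^ ℓ := by
          refine Finset.sum_le_sum fun n hn => ?_
          rw [abs_mul, abs_sqf, abs_of_nonneg (logCut_nonneg _ _ _)]
          exact mul_le_mul_of_nonneg_left
            (logCut_le hR.le (Nat.mul_pos hr1 (Finset.mem_Ico.1 hn).1) ℓ) (hw0 n)
      _ ≤ _ := by
          rw [← Finset.sum_mul]
          exact mul_le_mul_of_nonneg_right ((summable_sqf_abs_awayFrom hH₀ h₀H r).sum_le_tsum _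
            fun n _ => hw0 n) (by positivity)
  rw [diagonalForm, abs_mul, abs_of_nonneg ha0]
  refine (mul_le_mul_of_nonneg_left h1 ha0).trans ?_
  rw [← mul_assoc]
  exact mul_le_mul_of_nonneg_right (sqf_mul_tsum_abs_le hH₀ h₀H hr) (by positivity)

end NotMem

/-- After division by B the linear forms satisfy the hypotheses of `exists_sum_sqf_mul_mul` with
error weight identically 1, since their errors are uniform in r. The dimension is k, because the
enlarged tuple has k + 1 elements. -/
theorem exists_main_term_notMem (k : ℕ) (hk : 2 ≤ k) (ℓ₁ ℓ₂ : ℕ) (hℓ₁ : 1 ≤ ℓ₁) (hℓ₂ : 1 ≤ ℓ₂) :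
    ∃ C : ℝ, 0 ≤ C ∧ ∀ (H : Finset ℤ) (h₀ : ℤ), H.card = k → Admissible (insert h₀ H) →
    h₀ ∉ H → ∀ R : ℝ, 2 ≤ R →
    |∑ r ∈ Finset.Ico 1 ⌈R⌉₊, sqf (densityWeight (insert h₀ H)) r
        * (diagonalForm H h₀ R ℓ₁ r * diagonalForm H h₀ R ℓ₂ r)
      - transferConst H h₀ ^ 2 * ((ℓ₁ + ℓ₂).choose ℓ₁ * ((singularSeries (insert h₀ H))⁻¹
        * (Real.log R ^ (k + ℓ₁ + ℓ₂) / ((k + ℓ₁ + ℓ₂).factorial : ℝ))))|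
      ≤ transferConst H h₀ ^ 2
        * (C * beta (insert h₀ H) * Real.log R ^ (k + ℓ₁ + ℓ₂ - 1)) := by
  obtain ⟨A, C₀, hA, hC₀, hw⟩ := exists_isSieveWeight_density (k + 1) (by omega)
  set Z : ℝ := ∑' n : ℕ, (n : ℝ) ^ (-(3 / 2) : ℝ)
  have hZ : 0 ≤ Z := tsum_nonneg fun n => by positivity
  set E := Real.exp (4 * (k + 2) ^ 3 * Z)
  have hE : 1 ≤ E := Real.one_le_exp (by positivity)
  have hl : 0 < Real.log 2 := Real.log_pos (by norm_num)
  set c : ℝ := 4 * (k + 1) ^ 3 * (2 * Z)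
  have hc : 0 ≤ c := by positivity
  set D := E * (1 + c * (2 / Real.log 2))
  have hD1 : E ≤ D := by
    have : 0 ≤ c * (2 / Real.log 2) := by positivity
    exact le_mul_of_one_le_right (by linarith) (by linarith)
  obtain ⟨C, hC, hmain⟩ := exists_sum_sqf_mul_mul k (by omega) A D hA (by linarith) ℓ₁ ℓ₂ hℓ₁ hℓ₂
  refine ⟨C * C₀ * 3 ^ (k + ℓ₁ + ℓ₂ - 1), by positivity, ?_⟩
  intro H h₀ hHk hH₀ h₀H R hR
  have hcard : (insert h₀ H).card = k + 1 := by rw [Finset.card_insert_of_notMem h₀H, hHk]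
  have hh := hw _ hcard hH₀
  rw [Nat.add_sub_cancel] at hh
  set B := transferConst H h₀
  have hB : 0 < B := transferConst_pos hH₀ h₀H
  have hβ := le_beta _ hH₀ (by omega)
  set β := beta (insert h₀ H)
  have hβ0 : 0 < β := lt_of_lt_of_le (by positivity) hβ
  have hlR : 0 < Real.log R := Real.log_pos (by linarith)
  have hDL : E * (β + c) ≤ D * (C₀ * β) := by
    have h1 : 1 ≤ 2 / Real.log 2 * β := by
      rw [div_mul_eq_mul_div, one_le_div hl]; linarith
    have h2 : c ≤ c * (2 / Real.log 2 * β) := le_mul_of_one_le_right hc h1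
    have h3 : E * (β + c) ≤ D * β := by
      simp only [D]
      rw [mul_assoc]
      refine mul_le_mul_of_nonneg_left ?_ (by linarith)
      linarith
    refine h3.trans (mul_le_mul_of_nonneg_left ?_ (by linarith))
    exact le_mul_of_one_le_left hβ0.le hC₀
  have hone : ∀ r, Squarefree r → sqf (fun _ => (1 : ℝ)) r = 1 := fun r hr => by
    rw [sqf_of_squarefree _ hr, Finset.prod_const_one]
  have hZ₁ : ∀ ℓ, 1 ≤ ℓ → ∀ r : ℕ, Squarefree r → (r : ℝ) < R →
      |diagonalForm H h₀ R ℓ r / B - logCut R ℓ r|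
        ≤ D * (C₀ * β) * sqf (fun _ => (1 : ℝ)) r * (1 + Real.log R) ^ (ℓ - 1) := by
    intro ℓ hℓ r hr hrR
    have h1 := abs_diagonalForm_sub_le hH₀ h₀H hℓ (by linarith) hr hrR
    rw [hHk] at h1
    rw [hone r hr, mul_one, div_sub' hB.ne', abs_div, abs_of_pos hB, div_le_iff₀ hB]
    refine h1.trans ?_
    calc _ = E * (β + c) * Real.log R ^ (ℓ - 1) * B := by ring
      _ ≤ D * (C₀ * β) * (1 + Real.log R) ^ (ℓ - 1) * B := by
        have : 0 ≤ E * (β + c) := by positivity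
        gcongr
        linarith
  have hZ₂ : ∀ r : ℕ, Squarefree r → (r : ℝ) < R →
      |diagonalForm H h₀ R ℓ₂ r / B|
        ≤ D * sqf (fun _ => (1 : ℝ)) r * (1 + Real.log R) ^ ℓ₂ := by
    intro r hr _
    have h1 := abs_diagonalForm_le hH₀ h₀H ℓ₂ (by linarith) hr (R := R)
    rw [hHk] at h1
    rw [hone r hr, mul_one, abs_div, abs_of_pos hB, div_le_iff₀ hB]
    refine h1.trans ?_
    calc _ = E * Real.log R ^ ℓ₂ * B := by ring
      _ ≤ D * (1 + Real.log R) ^ ℓ₂ * B := by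
        gcongr
        linarith
  have hfin := hmain (C₀ * β) (densityWeight (insert h₀ H)) (fun _ => 1) hh (fun _ _ => le_rfl)
    (fun p hp => by rw [one_pow, mul_one]; exact hh.le p hp) R
    (fun r => diagonalForm H h₀ R ℓ₁ r / B) (fun r => diagonalForm H h₀ R ℓ₂ r / B) (by linarith)
    (hZ₁ ℓ₁ hℓ₁) (hZ₁ ℓ₂ hℓ₂) hZ₂
  have h1 : eulerConst k (densityWeight (insert h₀ H)) = (singularSeries (insert h₀ H))⁻¹ := by
    have := eulerConst_eq_inv hH₀ (by omega)
    rwa [hcard, Nat.add_sub_cancel] at this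
  rw [h1] at hfin
  have h2 : ∑ r ∈ Finset.Ico 1 ⌈R⌉₊, sqf (densityWeight (insert h₀ H)) r
        * (diagonalForm H h₀ R ℓ₁ r * diagonalForm H h₀ R ℓ₂ r)
      = B ^ 2 * ∑ r ∈ Finset.Ico 1 ⌈R⌉₊, sqf (densityWeight (insert h₀ H)) r
        * (diagonalForm H h₀ R ℓ₁ r / B * (diagonalForm H h₀ R ℓ₂ r / B)) := by
    rw [Finset.mul_sum]
    refine Finset.sum_congr rfl fun r _ => ?_
    field_simp
  rw [h2, ← mul_sub, abs_mul, abs_of_pos (by positivity : 0 < B ^ 2)]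
  refine mul_le_mul_of_nonneg_left (hfin.trans ?_) (by positivity)
  calc C * (C₀ * β) * (1 + Real.log R) ^ (k + ℓ₁ + ℓ₂ - 1)
      ≤ C * (C₀ * β) * (3 * Real.log R) ^ (k + ℓ₁ + ℓ₂ - 1) := by
        refine mul_le_mul_of_nonneg_left (pow_le_pow_left₀ (by linarith) (one_add_log_le hR) _) ?_
        positivity
    _ = _ := by rw [mul_pow]; ring

/-! ### Primes n + h₀ in residue classes. -/

theorem varpi_nonneg (n : ℕ) : 0 ≤ varpi n := by
  unfold varpi
  split_ifs
  · exact Real.log_natCast_nonneg n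
  · exact le_rfl

theorem varpi_le_log (n : ℕ) : varpi n ≤ Real.log n := by
  unfold varpi
  split_ifs
  · exact le_rfl
  · exact Real.log_natCast_nonneg n

theorem varpiInt_natCast (n : ℕ) : varpiInt (n : ℤ) = varpi n := by
  rw [varpiInt, Int.toNat_natCast]

theorem card_filter_residue_le {x N : ℝ} {q : ℕ} (hx : 0 < x) (hxN : x ≤ N) (hq : 1 ≤ q)
    (hqN : (q : ℝ) ≤ N) (a : ZMod q) :
    (((Finset.Ioc ⌊x⌋₊ ⌊2 * x⌋₊).filter (fun n : ℕ => (n : ZMod q) = a)).card : ℝ)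
      ≤ 3 * (N / q) := by
  have : NeZero q := ⟨by omega⟩
  have hq0 : (0 : ℝ) < q := by exact_mod_cast hq
  have h1 : (Finset.Ioc ⌊x⌋₊ ⌊2 * x⌋₊).filter (fun n : ℕ => (n : ZMod q) = a)
      = (Finset.Ioc ⌊x⌋₊ ⌊2 * x⌋₊).filter (fun n : ℕ => n ≡ a.val [MOD q]) := by
    refine Finset.filter_congr fun n _ => ?_
    rw [← ZMod.natCast_eq_natCast_iff, ZMod.natCast_zmod_val]
  have h2 := Nat.Ioc_filter_modEq_card ⌊x⌋₊ ⌊2 * x⌋₊ hq a.val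
  rw [h1]
  have h3 : (((Finset.Ioc ⌊x⌋₊ ⌊2 * x⌋₊).filter (fun n : ℕ => n ≡ a.val [MOD q])).card : ℝ)
      = ((max (⌊((⌊2 * x⌋₊ : ℚ) - a.val) / q⌋ - ⌊((⌊x⌋₊ : ℚ) - a.val) / q⌋) 0 : ℤ) : ℝ) := by
    exact_mod_cast congrArg (fun z : ℤ => (z : ℝ)) h2
  rw [h3]
  push_cast
  have hNq : 1 ≤ N / q := by rw [one_le_div hq0]; exact hqN
  refine max_le ?_ (by positivity)
  have h4 : (⌊((⌊2 * x⌋₊ : ℚ) - a.val) / q⌋ : ℝ) ≤ ((⌊2 * x⌋₊ : ℝ) - a.val) / q := by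
    have := Int.floor_le (((⌊2 * x⌋₊ : ℚ) - a.val) / q)
    exact_mod_cast (Rat.cast_le (K := ℝ)).2 this
  have h5 : ((⌊x⌋₊ : ℝ) - a.val) / q - 1 ≤ (⌊((⌊x⌋₊ : ℚ) - a.val) / q⌋ : ℝ) := by
    have := (Int.sub_one_lt_floor (((⌊x⌋₊ : ℚ) - a.val) / q)).le
    exact_mod_cast (Rat.cast_le (K := ℝ)).2 this
  have h6 : (⌊2 * x⌋₊ : ℝ) ≤ 2 * x := Nat.floor_le (by linarith)
  have h7 : x - 1 ≤ (⌊x⌋₊ : ℝ) := (Nat.sub_one_lt_floor x).le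
  have hq1 : (1 : ℝ) ≤ q := by exact_mod_cast hq
  have h8 : ((⌊2 * x⌋₊ : ℝ) - a.val) / q - ((⌊x⌋₊ : ℝ) - a.val) / q ≤ (N + q) / q := by
    rw [← sub_div]
    gcongr
    linarith
  have h9 : (N + q) / q = N / q + 1 := by field_simp
  linarith

/-- The trivial bound serves twice: it makes the supremum in `primeErrorStar` one of a bounded set
(an unbounded set would give the default value 0), and it feeds the weighted sum over moduli. -/
theorem abs_primeError_le {x N : ℝ} {q : ℕ} (hx : 0 < x) (hxN : x ≤ N) (hq : 1 ≤ q)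
    (hqN : (q : ℝ) ≤ N) (hN : 1 ≤ Real.log (2 * N)) (a : ZMod q) :
    |primeError x q a| ≤ 4 * Real.log (2 * N) * (N / q.totient) := by
  have hq0 : (0 : ℝ) < q := by exact_mod_cast hq
  have hφ : (0 : ℝ) < q.totient := by exact_mod_cast Nat.totient_pos.2 hq
  have hφq : (q.totient : ℝ) ≤ q := by exact_mod_cast Nat.totient_le q
  have h1 : N / q ≤ N / q.totient := div_le_div_of_nonneg_left (by linarith) hφ hφq
  have h2 : ∑ n ∈ (Finset.Ioc ⌊x⌋₊ ⌊2 * x⌋₊).filter (fun n : ℕ => (n : ZMod q) = a), varpi n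
      ≤ 3 * (N / q) * Real.log (2 * N) := by
    refine (Finset.sum_le_card_nsmul _ _ (Real.log (2 * N)) fun n hn => ?_).trans ?_
    · refine (varpi_le_log n).trans ?_
      have hn1 := Finset.mem_Ioc.1 (Finset.mem_filter.1 hn).1
      have hn0 : (0 : ℝ) < n := by exact_mod_cast (Nat.zero_le _).trans_lt hn1.1
      refine Real.log_le_log hn0 ?_
      have : (n : ℝ) ≤ 2 * x := (Nat.le_floor_iff (by linarith)).1 hn1.2
      linarith
    · rw [nsmul_eq_mul]
      exact mul_le_mul_of_nonneg_right (card_filter_residue_le hx hxN hq hqN a) (by linarith)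
  have h3 : 0 ≤ ∑ n ∈ (Finset.Ioc ⌊x⌋₊ ⌊2 * x⌋₊).filter (fun n : ℕ => (n : ZMod q) = a), varpi n :=
    Finset.sum_nonneg fun n _ => varpi_nonneg n
  have h4 : x / q.totient ≤ N / q.totient := by gcongr
  have h5 : 0 ≤ x / q.totient := by positivity
  have hφN : 0 ≤ N / q.totient := h5.trans h4
  have h6 : 3 * (N / q) * Real.log (2 * N) ≤ 3 * (N / q.totient) * Real.log (2 * N) := by gcongr
  have h7 : N / q.totient ≤ N / q.totient * Real.log (2 * N) := le_mul_of_one_le_right hφN hN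
  unfold primeError
  rw [abs_le]
  constructor <;> nlinarith

theorem abs_primeError_le_primeErrorMax (x : ℝ) {q : ℕ} (a : (ZMod q)ˣ) :
    |primeError x q (a : ZMod q)| ≤ primeErrorMax x q := by
  have hfin : Finite (ZMod q)ˣ := by
    rcases Nat.eq_zero_or_pos q with rfl | hq
    · exact inferInstanceAs (Finite ℤˣ)
    · have : NeZero q := ⟨hq.ne'⟩
      infer_instance
  exact le_ciSup (f := fun a : (ZMod q)ˣ => |primeError x q (a : ZMod q)|)
    (Set.finite_range _).bddAbove a

section Star

variable {N : ℝ} {q : ℕ}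

theorem primeErrorMax_le {x : ℝ} (hx : 0 < x) (hxN : x ≤ N) (hq : 1 ≤ q)
    (hqN : (q : ℝ) ≤ N) (hN : 1 ≤ Real.log (2 * N)) :
    primeErrorMax x q ≤ 4 * Real.log (2 * N) * (N / q.totient) :=
  ciSup_le fun a => abs_primeError_le hx hxN hq hqN hN a

theorem primeErrorStar_le (hq : 1 ≤ q) (hqN : (q : ℝ) ≤ N) (hN : 1 ≤ Real.log (2 * N)) :
    primeErrorStar N q ≤ 4 * Real.log (2 * N) * (N / q.totient) := by
  have hq0 : (1 : ℝ) ≤ q := by exact_mod_cast hq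
  refine csSup_le ⟨_, Set.mem_image_of_mem _ (Set.mem_Ioc.2 ⟨by linarith, le_refl N⟩)⟩ ?_
  rintro _ ⟨x, hx, rfl⟩
  exact primeErrorMax_le hx.1 hx.2 hq hqN hN

theorem abs_primeError_le_primeErrorStar (hq : 1 ≤ q) (hqN : (q : ℝ) ≤ N)
    (hN : 1 ≤ Real.log (2 * N)) {a : ZMod q} (ha : IsUnit a) :
    |primeError N q a| ≤ primeErrorStar N q := by
  obtain ⟨u, rfl⟩ := ha
  have hq0 : (1 : ℝ) ≤ q := by exact_mod_cast hq
  refine (abs_primeError_le_primeErrorMax N u).trans (le_csSup ?_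
    (Set.mem_image_of_mem _ (Set.mem_Ioc.2 ⟨by linarith, le_refl N⟩)))
  refine ⟨4 * Real.log (2 * N) * (N / q.totient), ?_⟩
  rintro _ ⟨x, hx, rfl⟩
  exact primeErrorMax_le hx.1 hx.2 hq hqN hN

theorem primeErrorStar_nonneg (hq : 1 ≤ q) (hqN : (q : ℝ) ≤ N) (hN : 1 ≤ Real.log (2 * N)) :
    0 ≤ primeErrorStar N q :=
  (abs_nonneg _).trans (abs_primeError_le_primeErrorStar hq hqN hN isUnit_one)

end Star

/-- A shift by one telescopes to two boundary values in [0, G]; induct on the shift. -/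
theorem abs_sum_shift_sub_le (g : ℤ → ℝ) {G : ℝ} (h0 : ∀ n, 0 ≤ g n) (hG : ∀ n, g n ≤ G)
    (a b : ℕ) (h : ℤ) :
    |∑ n ∈ Finset.Ioc a b, g (n + h) - ∑ n ∈ Finset.Ioc a b, g n| ≤ |(h : ℝ)| * G := by
  have hG0 : 0 ≤ G := (h0 0).trans (hG 0)
  rcases le_or_gt b a with hab | hab
  · rw [Finset.Ioc_eq_empty_of_le hab]
    simp only [Finset.sum_empty, sub_zero, abs_zero]
    positivity
  have step : ∀ j : ℤ, |∑ n ∈ Finset.Ioc a b, g (n + (j + 1)) - ∑ n ∈ Finset.Ioc a b, g (n + j)|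
      ≤ G := by
    intro j
    have e : ∑ n ∈ Finset.Ioc a b, g (n + (j + 1)) - ∑ n ∈ Finset.Ioc a b, g (n + j)
        = g (b + (j + 1)) - g (a + (j + 1)) := by
      rw [← Finset.sum_sub_distrib]
      have h1 := Finset.sum_Ico_sub (fun n : ℕ => g (n + j)) (show a + 1 ≤ b + 1 by omega)
      rw [Finset.Ico_add_one_add_one_eq_Ioc] at h1
      push_cast at h1
      have h2 : ∀ n : ℤ, n + (j + 1) = n + 1 + j := fun n => by ring
      simp only [h2]
      exact h1
    rw [e, abs_le]
    constructor <;> linarith [h0 (b + (j + 1)), hG (b + (j + 1)), h0 (a + (j + 1)), hG (a + (j + 1))]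
  induction h using Int.induction_on with
  | zero => simp
  | succ i ih =>
    have h1 := step i
    have e1 : |((i : ℤ) : ℝ)| = i := by simp
    have e2 : |(((i : ℤ) + 1 : ℤ) : ℝ)| = i + 1 := by
      push_cast
      exact abs_of_nonneg (by positivity)
    rw [e1] at ih
    rw [e2]
    rw [abs_le] at *
    constructor <;> linarith [h1.1, h1.2, ih.1, ih.2]
  | pred i ih =>
    have h1 := step (-i - 1)
    rw [sub_add_cancel] at h1
    have e1 : |((-(i : ℤ) : ℤ) : ℝ)| = i := by simp
    have e2 : |((-(i : ℤ) - 1 : ℤ) : ℝ)| = i + 1 := by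
      push_cast
      rw [abs_of_nonpos (by linarith [Nat.cast_nonneg (α := ℝ) i])]
      ring
    rw [e1] at ih
    rw [e2]
    rw [abs_le] at *
    constructor <;> linarith [h1.1, h1.2, ih.1, ih.2]

section PrimeSum

variable {H : Finset ℤ} {h₀ : ℤ} {N : ℝ} {q : ℕ}

theorem abs_sum_varpi_residue_sub_le (hN : 1 ≤ N) (hh₀ : |(h₀ : ℝ)| ≤ Real.log N)
    (hq : 1 ≤ q) (hqN : (q : ℝ) ≤ N) (hN2 : 1 ≤ Real.log (2 * N)) {a : ℕ} (haq : a < q)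
    (hcop : IsCoprime ((a : ℤ) + h₀) (q : ℤ)) :
    |∑ n ∈ (Finset.Ioc ⌊N⌋₊ ⌊2 * N⌋₊).filter (fun n => n % q = a), varpiInt ((n : ℤ) + h₀)
      - N / q.totient| ≤ primeErrorStar N q + Real.log N * Real.log (3 * N) := by
  classical
  set c : ZMod q := (((a : ℤ) + h₀ : ℤ) : ZMod q)
  have hc : IsUnit c := (ZMod.coe_int_isUnit_iff_isCoprime _ _).2 hcop.symm
  -- The truncation at 3N makes g bounded on all integers. It is invisible on both ranges, as |h₀| ≤
  -- log N ≤ N.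
  set g : ℤ → ℝ := fun m => if (m : ℝ) ≤ 3 * N ∧ (m : ZMod q) = c then varpiInt m else 0
  have hlog3 : 0 ≤ Real.log (3 * N) := Real.log_nonneg (by linarith)
  have hg0 : ∀ m, 0 ≤ g m := fun m => by
    simp only [g]
    split_ifs
    · exact varpi_nonneg _
    · exact le_rfl
  have hgG : ∀ m, g m ≤ Real.log (3 * N) := fun m => by
    simp only [g]
    split_ifs with h
    · refine (varpi_le_log _).trans ?_
      rcases Nat.eq_zero_or_pos m.toNat with h0 | h0
      · rw [h0]; simpa using hlog3
      · refine Real.log_le_log (by exact_mod_cast h0) ?_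
        have : ((m.toNat : ℤ) : ℝ) = m := by rw [Int.toNat_of_nonneg (by omega)]
        rw [Int.cast_natCast] at this
        rw [this]
        exact h.1
    · exact hlog3
  have hlogN : Real.log N ≤ N - 1 := Real.log_le_sub_one_of_pos (by linarith)
  have e1 : ∑ n ∈ (Finset.Ioc ⌊N⌋₊ ⌊2 * N⌋₊).filter (fun n => n % q = a), varpiInt ((n : ℤ) + h₀)
      = ∑ n ∈ Finset.Ioc ⌊N⌋₊ ⌊2 * N⌋₊, g (n + h₀) := by
    rw [Finset.sum_filter]
    refine Finset.sum_congr rfl fun n hn => ?_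
    have h1 : (n : ℝ) ≤ 2 * N := (Nat.le_floor_iff (by linarith)).1 (Finset.mem_Ioc.1 hn).2
    have h2 : (((n : ℤ) + h₀ : ℤ) : ℝ) ≤ 3 * N := by
      push_cast
      linarith [(abs_le.1 hh₀).2]
    have h3 : ((((n : ℤ) + h₀ : ℤ) : ZMod q) = c) ↔ n % q = a := by
      simp only [c]
      push_cast
      rw [add_left_inj, ZMod.natCast_eq_natCast_iff', Nat.mod_eq_of_lt haq]
    simp only [g, h2, h3, true_and]
  have e2 : ∑ n ∈ Finset.Ioc ⌊N⌋₊ ⌊2 * N⌋₊, g n - N / q.totient = primeError N q c := by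
    rw [primeError, Finset.sum_filter]
    congr 1
    refine Finset.sum_congr rfl fun n hn => ?_
    have h1 : (n : ℝ) ≤ 2 * N := (Nat.le_floor_iff (by linarith)).1 (Finset.mem_Ioc.1 hn).2
    have h2 : (n : ℝ) ≤ 3 * N := by linarith
    simp only [g, varpiInt_natCast, Int.cast_natCast, h2, true_and]
  have h1 := abs_sum_shift_sub_le g hg0 hgG ⌊N⌋₊ ⌊2 * N⌋₊ h₀
  have h2 := abs_primeError_le_primeErrorStar hq hqN hN2 hc
  rw [← e2] at h2
  rw [e1]
  have h3 : |(h₀ : ℝ)| * Real.log (3 * N) ≤ Real.log N * Real.log (3 * N) :=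
    mul_le_mul_of_nonneg_right hh₀ hlog3
  have h4 := abs_add_le (∑ n ∈ Finset.Ioc ⌊N⌋₊ ⌊2 * N⌋₊, g n - N / q.totient)
    (∑ n ∈ Finset.Ioc ⌊N⌋₊ ⌊2 * N⌋₊, g (n + h₀) - ∑ n ∈ Finset.Ioc ⌊N⌋₊ ⌊2 * N⌋₊, g n)
  have h5 : ∑ n ∈ Finset.Ioc ⌊N⌋₊ ⌊2 * N⌋₊, g n - N / q.totient
    + (∑ n ∈ Finset.Ioc ⌊N⌋₊ ⌊2 * N⌋₊, g (n + h₀) - ∑ n ∈ Finset.Ioc ⌊N⌋₊ ⌊2 * N⌋₊, g n)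
    = ∑ n ∈ Finset.Ioc ⌊N⌋₊ ⌊2 * N⌋₊, g (n + h₀) - N / q.totient := by ring
  rw [h5] at h4
  linarith

/-- Since n + h₀ > q, a prime value of n + h₀ would be coprime to q. -/
theorem sum_varpi_residue_eq_zero (hN : 1 ≤ N) (hh₀ : |(h₀ : ℝ)| ≤ Real.log N)
    (hq : 1 ≤ q) (hqN : (q : ℝ) ≤ N - Real.log N) {a : ℕ} (haq : a < q)
    (hcop : ¬ IsCoprime ((a : ℤ) + h₀) (q : ℤ)) :
    ∑ n ∈ (Finset.Ioc ⌊N⌋₊ ⌊2 * N⌋₊).filter (fun n => n % q = a), varpiInt ((n : ℤ) + h₀) = 0 := by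
  refine Finset.sum_eq_zero fun n hn => ?_
  obtain ⟨hn1, hn2⟩ := Finset.mem_filter.1 hn
  have h1 : N < n := (Nat.floor_lt (by linarith)).1 (Finset.mem_Ioc.1 hn1).1
  have h2 : (q : ℝ) < (((n : ℤ) + h₀ : ℤ) : ℝ) := by
    push_cast
    linarith [(abs_le.1 hh₀).1]
  have h3 : (q : ℤ) < (n : ℤ) + h₀ := by exact_mod_cast h2
  rw [varpiInt, varpi, if_neg]
  intro hp
  set m := ((n : ℤ) + h₀).toNat
  have hm : (m : ℤ) = (n : ℤ) + h₀ := Int.toNat_of_nonneg (by omega)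
  refine hcop ?_
  have h4 : IsCoprime (m : ℤ) (q : ℤ) := by
    rw [Nat.isCoprime_iff_coprime]
    refine (Nat.Prime.coprime_iff_not_dvd hp).2 fun hd => ?_
    have := Nat.le_of_dvd hq hd
    omega
  rw [hm] at h4
  have h5 : (a : ℤ) + h₀ = (n : ℤ) + h₀ + q * (-((n / q : ℕ) : ℤ)) := by
    have := Nat.mod_add_div n q
    rw [hn2] at this
    have h6 : (a : ℤ) + q * ((n / q : ℕ) : ℤ) = n := by exact_mod_cast this
    linear_combination h6
  rw [h5]
  exact IsCoprime.add_mul_left_left h4 _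

theorem totient_squarefree (hq : Squarefree q) :
    (q.totient : ℝ) = sqf (fun p => (p : ℝ) - 1) q := by
  rw [sqf_of_squarefree _ hq, Nat.totient_eq_prod_factorization hq.ne_zero,
    Finsupp.prod, Nat.support_factorization, Nat.cast_prod]
  refine Finset.prod_congr rfl fun p hp => ?_
  have hpp := Nat.prime_of_mem_primeFactors hp
  have h1 : q.factorization p = 1 := by
    have h2 := (Nat.squarefree_iff_factorization_le_one hq.ne_zero).1 hq p
    have h3 := hpp.factorization_pos_of_dvd hq.ne_zero (Nat.dvd_of_mem_primeFactors hp)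
    omega
  rw [h1, Nat.sub_self, pow_zero, one_mul, Nat.cast_sub hpp.one_le, Nat.cast_one]

theorem coprimeCount_div_totient (H : Finset ℤ) (h₀ : ℤ) (hq : Squarefree q) :
    (coprimeCount H h₀ q : ℝ) / q.totient = sqf (primeDensity H h₀) q := by
  rw [coprimeCount_squarefree H h₀ hq, totient_squarefree hq, sqf_of_squarefree _ hq,
    sqf_of_squarefree _ hq, sqf_of_squarefree _ hq, ← Finset.prod_div_distrib]
  rfl

/-- Primes `n + h₀` with `q ∣ P(n; H)` are counted up to the error of the prime number theorem in
progressions. -/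
theorem abs_sum_varpi_dvd_sub_le (hN : 1 ≤ N) (hh₀ : |(h₀ : ℝ)| ≤ Real.log N)
    (hq : Squarefree q) (hqN : (q : ℝ) ≤ N - Real.log N) (hN2 : 1 ≤ Real.log (2 * N)) :
    |∑ n ∈ (Finset.Ioc ⌊N⌋₊ ⌊2 * N⌋₊).filter (fun n : ℕ => (q : ℤ) ∣ tuplePoly H n),
        varpiInt ((n : ℤ) + h₀) - N * sqf (primeDensity H h₀) q|
      ≤ coprimeCount H h₀ q * (primeErrorStar N q + Real.log N * Real.log (3 * N)) := by
  classical
  have hq1 : 1 ≤ q := Nat.one_le_iff_ne_zero.2 hq.ne_zero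
  have hlN : 0 ≤ Real.log N := Real.log_nonneg hN
  have hdvd : ∀ n : ℕ, (q : ℤ) ∣ tuplePoly H n ↔ (q : ℤ) ∣ tuplePoly H ((n % q : ℕ) : ℤ) := by
    intro n
    have h1 : (q : ℤ) ∣ (n : ℤ) - ((n % q : ℕ) : ℤ) := by
      push_cast
      exact Int.dvd_self_sub_emod
    exact Int.dvd_iff_dvd_of_dvd_sub (tuplePoly_sub_dvd H q _ _ h1)
  set A := (Finset.range q).filter (fun a : ℕ => (q : ℤ) ∣ tuplePoly H a)
  set I := Finset.Ioc ⌊N⌋₊ ⌊2 * N⌋₊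
  have e1 : ∑ n ∈ I.filter (fun n : ℕ => (q : ℤ) ∣ tuplePoly H n), varpiInt ((n : ℤ) + h₀)
      = ∑ a ∈ A, ∑ n ∈ I.filter (fun n => n % q = a), varpiInt ((n : ℤ) + h₀) := by
    rw [← Finset.sum_fiberwise_of_maps_to (g := fun n => n % q) (t := A)]
    · refine Finset.sum_congr rfl fun a ha => Finset.sum_congr ?_ fun _ _ => rfl
      ext n
      simp only [Finset.mem_filter]
      constructor
      · rintro ⟨⟨h1, _⟩, h3⟩
        exact ⟨h1, h3⟩
      · rintro ⟨h1, h3⟩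
        refine ⟨⟨h1, ?_⟩, h3⟩
        rw [hdvd, h3]
        exact (Finset.mem_filter.1 ha).2
    · intro n hn
      refine Finset.mem_filter.2 ⟨Finset.mem_range.2 (Nat.mod_lt _ hq1), ?_⟩
      rw [← hdvd]
      exact (Finset.mem_filter.1 hn).2
  set A' := A.filter (fun a : ℕ => IsCoprime ((a : ℤ) + h₀) (q : ℤ))
  have hA' : (coprimeCount H h₀ q : ℝ) = A'.card := by
    unfold coprimeCount residueCount
    simp only [A', A, Finset.filter_filter]
  have e2 : ∑ a ∈ A, ∑ n ∈ I.filter (fun n => n % q = a), varpiInt ((n : ℤ) + h₀)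
      = ∑ a ∈ A', ∑ n ∈ I.filter (fun n => n % q = a), varpiInt ((n : ℤ) + h₀) := by
    symm
    refine Finset.sum_subset (Finset.filter_subset _ _) fun a ha ha' => ?_
    have haq := Finset.mem_range.1 (Finset.mem_filter.1 ha).1
    refine sum_varpi_residue_eq_zero hN hh₀ hq1 hqN haq fun hc => ?_
    exact ha' (Finset.mem_filter.2 ⟨ha, hc⟩)
  have e3 : N * sqf (primeDensity H h₀) q = ∑ a ∈ A', N / q.totient := by
    rw [← coprimeCount_div_totient H h₀ hq, Finset.sum_const, nsmul_eq_mul, hA']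
    ring
  rw [e1, e2, e3, ← Finset.sum_sub_distrib, hA', ← nsmul_eq_mul]
  refine (Finset.abs_sum_le_sum_abs _ _).trans (Finset.sum_le_card_nsmul _ _ _ fun a ha => ?_)
  obtain ⟨ha1, ha2⟩ := Finset.mem_filter.1 ha
  exact abs_sum_varpi_residue_sub_le hN hh₀ hq1 (by linarith) hN2
    (Finset.mem_range.1 (Finset.mem_filter.1 ha1).1) ha2

end PrimeSum

/-! ### The error term through BV(θ). -/

theorem squarefree_lcm {a b : ℕ} (ha : Squarefree a) (hb : Squarefree b) :
    Squarefree (a.lcm b) := by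
  rw [Nat.squarefree_iff_factorization_le_one (Nat.lcm_ne_zero ha.ne_zero hb.ne_zero)]
  intro p
  rw [Nat.factorization_lcm ha.ne_zero hb.ne_zero, Finsupp.sup_apply]
  exact sup_le ((Nat.squarefree_iff_factorization_le_one ha.ne_zero).1 ha p)
    ((Nat.squarefree_iff_factorization_le_one hb.ne_zero).1 hb p)

theorem sum_divisors_sqf (m : ℕ → ℝ) {q : ℕ} (hq : Squarefree q) :
    ∑ d ∈ q.divisors, sqf m d = sqf (fun p => 1 + m p) q := by
  have h1 := sqf_add m (fun _ => 1) hq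
  rw [show (fun p => 1 + m p) = fun p => m p + 1 by funext p; ring, h1,
    ← Nat.sum_divisorsAntidiagonal (f := fun d _ => sqf m d)]
  refine Finset.sum_congr rfl fun x hx => ?_
  obtain ⟨hx1, hx2⟩ := Nat.mem_divisorsAntidiagonal.1 hx
  rw [sqf_of_squarefree (fun _ => (1 : ℝ)) (hq.squarefree_of_dvd ⟨x.1, by rw [mul_comm, hx1]⟩),
    Finset.prod_const_one, mul_one]

/-- Pairs with least common multiple q are pairs of divisors of q, so their total weight is at most
the square of ∑_{d ∣ q} m(d) = ∏_{p ∣ q} (1 + m p). -/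
theorem sum_sum_sqf_lcm_le {m : ℕ → ℝ} (hm : ∀ p, p.Prime → 0 ≤ m p) {M Q : ℕ}
    (hMQ : ∀ d₁ ∈ Finset.Ico 1 M, ∀ d₂ ∈ Finset.Ico 1 M, d₁.lcm d₂ ≤ Q) {G : ℕ → ℝ}
    (hG : ∀ q ∈ Finset.Icc 1 Q, 0 ≤ G q) :
    ∑ d₁ ∈ Finset.Ico 1 M, ∑ d₂ ∈ Finset.Ico 1 M, sqf m d₁ * sqf m d₂ * G (d₁.lcm d₂)
      ≤ ∑ q ∈ Finset.Icc 1 Q, sqf (fun p => (1 + m p) ^ 2) q * G q := by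
  have hmem : ∀ x ∈ Finset.Ico 1 M ×ˢ Finset.Ico 1 M, x.1.lcm x.2 ∈ Finset.Icc 1 Q := by
    intro x hx
    obtain ⟨h1, h2⟩ := Finset.mem_product.1 hx
    refine Finset.mem_Icc.2 ⟨Nat.lcm_pos (Finset.mem_Ico.1 h1).1 (Finset.mem_Ico.1 h2).1, ?_⟩
    exact hMQ _ h1 _ h2
  rw [← Finset.sum_product' (f := fun d₁ d₂ => sqf m d₁ * sqf m d₂ * G (d₁.lcm d₂)),
    ← Finset.sum_fiberwise_of_maps_to hmem]
  refine Finset.sum_le_sum fun q hq => ?_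
  have hq1 : 1 ≤ q := (Finset.mem_Icc.1 hq).1
  have e1 : ∑ x ∈ (Finset.Ico 1 M ×ˢ Finset.Ico 1 M).filter (fun x => x.1.lcm x.2 = q),
      sqf m x.1 * sqf m x.2 * G (x.1.lcm x.2)
      = (∑ x ∈ (Finset.Ico 1 M ×ˢ Finset.Ico 1 M).filter (fun x => x.1.lcm x.2 = q),
        sqf m x.1 * sqf m x.2) * G q := by
    rw [Finset.sum_mul]
    exact Finset.sum_congr rfl fun x hx => by rw [(Finset.mem_filter.1 hx).2]
  rw [e1]
  refine mul_le_mul_of_nonneg_right ?_ (hG q hq)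
  by_cases hsq : Squarefree q
  · calc _ ≤ ∑ x ∈ q.divisors ×ˢ q.divisors, sqf m x.1 * sqf m x.2 := by
          refine Finset.sum_le_sum_of_subset_of_nonneg (fun x hx => ?_) fun x _ _ =>
            mul_nonneg (sqf_nonneg hm _) (sqf_nonneg hm _)
          have h := (Finset.mem_filter.1 hx).2
          rw [Finset.mem_product, Nat.mem_divisors, Nat.mem_divisors]
          exact ⟨⟨h ▸ Nat.dvd_lcm_left _ _, by omega⟩, h ▸ Nat.dvd_lcm_right _ _, by omega⟩
      _ = (∑ d ∈ q.divisors, sqf m d) * ∑ d ∈ q.divisors, sqf m d := by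
          rw [Finset.sum_mul_sum, Finset.sum_product]
      _ = _ := by
          rw [sum_divisors_sqf m hsq, sqf_mul_sqf]
          exact sqf_congr fun p _ _ => by ring
  · rw [sqf_of_not_squarefree _ hsq]
    refine le_of_eq (Finset.sum_eq_zero fun x hx => ?_)
    have h := (Finset.mem_filter.1 hx).2
    by_cases h1 : Squarefree x.1
    · by_cases h2 : Squarefree x.2
      · exact absurd (h ▸ squarefree_lcm h1 h2) hsq
      · rw [sqf_of_not_squarefree _ h2, mul_zero]
    · rw [sqf_of_not_squarefree _ h1, zero_mul]

theorem exists_sum_sqf_const_le (w : ℕ) : ∃ C : ℝ, 1 ≤ C ∧ ∀ x : ℝ, 1 ≤ x →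
    ∑ q ∈ Finset.Icc 1 ⌊x⌋₊, sqf (fun _ => (w : ℝ)) q ≤ C * x * (1 + Real.log x) ^ w := by
  obtain ⟨C, hC, hS⟩ := sum_sqf_le w 0 le_rfl
  refine ⟨C, hC, fun x hx => ?_⟩
  have hmem : ∀ n ∈ Finset.Icc 1 ⌊x⌋₊, 1 ≤ n ∧ (n : ℝ) ≤ x := fun n hn =>
    ⟨(Finset.mem_Icc.1 hn).1, (Nat.le_floor_iff (by linarith)).1 (Finset.mem_Icc.1 hn).2⟩
  have h1 := hS (fun p => (w : ℝ) / p) (fun p _ => by positivity) (fun p _ => by simp) x hx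
    (Finset.Icc 1 ⌊x⌋₊) hmem
  calc _ ≤ ∑ q ∈ Finset.Icc 1 ⌊x⌋₊, x * sqf (fun p => (w : ℝ) / p) q := by
        refine Finset.sum_le_sum fun q hq => ?_
        have h0 : 0 ≤ sqf (fun p => (w : ℝ) / p) q := sqf_nonneg (fun p _ => by positivity) q
        have e : sqf (fun _ => (w : ℝ)) q = q * sqf (fun p => (w : ℝ) / p) q := by
          by_cases hsq : Squarefree q
          · have e1 : (q : ℝ) = ∏ p ∈ q.primeFactors, (p : ℝ) := by
              rw [← Nat.cast_prod, Nat.prod_primeFactors_of_squarefree hsq]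
            rw [sqf_of_squarefree _ hsq, sqf_of_squarefree _ hsq]
            rw [e1]
            rw [← Finset.prod_mul_distrib]
            refine Finset.prod_congr rfl fun p hp => ?_
            have : (p : ℝ) ≠ 0 := by exact_mod_cast (Nat.prime_of_mem_primeFactors hp).ne_zero
            field_simp
          · rw [sqf_of_not_squarefree _ hsq, sqf_of_not_squarefree _ hsq, mul_zero]
        rw [e]
        exact mul_le_mul_of_nonneg_right (hmem q hq).2 h0
    _ = x * ∑ q ∈ Finset.Icc 1 ⌊x⌋₊, sqf (fun p => (w : ℝ) / p) q := by rw [Finset.mul_sum]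
    _ ≤ x * (C * (1 + Real.log x) ^ w) := mul_le_mul_of_nonneg_left h1 (by linarith)
    _ = _ := by ring

theorem exists_sum_sqf_div_totient_le (w : ℕ) : ∃ C : ℝ, 1 ≤ C ∧ ∀ x : ℝ, 1 ≤ x →
    ∑ q ∈ Finset.Icc 1 ⌊x⌋₊, sqf (fun _ => (w : ℝ)) q * (1 / (q.totient : ℝ))
      ≤ C * (1 + Real.log x) ^ (2 * w) := by
  obtain ⟨C, hC, hS⟩ := sum_sqf_le (2 * w) 0 le_rfl
  refine ⟨C, hC, fun x hx => ?_⟩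
  have hmem : ∀ n ∈ Finset.Icc 1 ⌊x⌋₊, 1 ≤ n ∧ (n : ℝ) ≤ x := fun n hn =>
    ⟨(Finset.mem_Icc.1 hn).1, (Nat.le_floor_iff (by linarith)).1 (Finset.mem_Icc.1 hn).2⟩
  refine (Finset.sum_le_sum fun q _ => ?_).trans (hS (fun p => ((2 * w : ℕ) : ℝ) / p)
    (fun p _ => by positivity) (fun p _ => by simp) x hx (Finset.Icc 1 ⌊x⌋₊) hmem)
  by_cases hsq : Squarefree q
  · rw [totient_squarefree hsq, sqf_of_squarefree _ hsq, sqf_of_squarefree _ hsq,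
      sqf_of_squarefree _ hsq, one_div, ← Finset.prod_inv_distrib, ← Finset.prod_mul_distrib]
    refine Finset.prod_le_prod (fun p hp => ?_) fun p hp => ?_
    · have : (1 : ℝ) < p := by exact_mod_cast (Nat.prime_of_mem_primeFactors hp).one_lt
      have : 0 < (p : ℝ) - 1 := by linarith
      positivity
    · have hp2 : (2 : ℝ) ≤ p := by exact_mod_cast (Nat.prime_of_mem_primeFactors hp).two_le
      rw [← div_eq_mul_inv, div_le_div_iff₀ (by linarith) (by linarith)]
      push_cast
      have : (w : ℝ) * p ≤ w * (2 * (p - 1)) :=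
        mul_le_mul_of_nonneg_left (by linarith) (Nat.cast_nonneg _)
      linarith
  · rw [sqf_of_not_squarefree _ hsq, sqf_of_not_squarefree _ hsq, zero_mul]

/-- No cancellation is used: p/(p - ν_p) ≤ k + 1 and ν_p/(p - ν_p) ≤ k(k+1)/p, so the inner sum has
dimension at most k(k+1). -/
theorem exists_abs_selbergCoeff_le (k : ℕ) : ∃ C : ℝ, 1 ≤ C ∧ ∀ H : Finset ℤ,
    H.card = k → Admissible H → ∀ R : ℝ, 2 ≤ R → ∀ ℓ : ℕ, ℓ ≤ k → ∀ d : ℕ, 1 ≤ d →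
    |selbergCoeff ⌈R⌉₊ (ratioWeight H) (dualWeight H) (logCut R ℓ) d|
      ≤ C * (1 + Real.log R) ^ (k * (k + 1) + k) * sqf (fun _ => (k : ℝ) + 1) d := by
  obtain ⟨C, hC, hS⟩ := sum_sqf_le (k * (k + 1)) 0 le_rfl
  refine ⟨C, hC, ?_⟩
  intro H hHk hH R hR ℓ hℓ d hd
  have hlR : 0 ≤ Real.log R := Real.log_nonneg (by linarith)
  have hb : ∀ p : ℕ, p.Prime → 0 ≤ dualWeight H p ∧ dualWeight H p ≤ ((k * (k + 1) : ℕ) : ℝ) / p ∧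
      0 ≤ ratioWeight H p ∧ ratioWeight H p ≤ k + 1 := by
    intro p hp
    have h1 := hH.add_one_le hp
    have h2 : (nuPrime H p : ℝ) ≤ k := by rw [← hHk]; exact_mod_cast nuPrime_le_card H p
    have h0 : (0 : ℝ) ≤ nuPrime H p := Nat.cast_nonneg _
    have h3 := le_mul_sub_of_lt h2 h1 h0
    have hd : 0 < (p : ℝ) - nuPrime H p := by linarith
    have hp0 : (0 : ℝ) < p := by exact_mod_cast hp.pos
    refine ⟨div_nonneg h0 hd.le, ?_, div_nonneg hp0.le hd.le, ?_⟩
    · unfold dualWeight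
      rw [div_le_div_iff₀ hd hp0]
      push_cast
      calc _ ≤ (k : ℝ) * ((p - nuPrime H p) * (k + 1)) := mul_le_mul h2 h3 hp0.le (by positivity)
        _ = _ := by ring
    · unfold ratioWeight
      rw [div_le_iff₀ hd]
      linarith
  have hmem : ∀ n ∈ Finset.Ico 1 ⌈R⌉₊, 1 ≤ n ∧ (n : ℝ) ≤ R := fun n hn =>
    ⟨(Finset.mem_Ico.1 hn).1, (Nat.lt_ceil.1 (Finset.mem_Ico.1 hn).2).le⟩
  have h1 : |∑ t ∈ Finset.Ico 1 ⌈R⌉₊, sqf (awayFrom d (dualWeight H)) t * logCut R ℓ (d * t)|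
      ≤ C * (1 + Real.log R) ^ (k * (k + 1)) * (1 + Real.log R) ^ k := by
    refine (Finset.abs_sum_le_sum_abs _ _).trans ?_
    calc _ ≤ ∑ t ∈ Finset.Ico 1 ⌈R⌉₊, sqf (dualWeight H) t * (1 + Real.log R) ^ k := by
          refine Finset.sum_le_sum fun t ht => ?_
          have h2 : sqf (awayFrom d (dualWeight H)) t ≤ sqf (dualWeight H) t :=
            sqf_le_sqf (fun p hp => awayFrom_nonneg (hb p hp).1)
              (fun p hp => awayFrom_le (hb p hp).1) t
          have h3 : 0 ≤ sqf (awayFrom d (dualWeight H)) t :=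
            sqf_nonneg (fun p hp => awayFrom_nonneg (hb p hp).1) t
          have h4 : logCut R ℓ (d * t) ≤ (1 + Real.log R) ^ k :=
            (logCut_le (by linarith) (Nat.mul_pos hd (hmem t ht).1) ℓ).trans
              ((pow_le_pow_left₀ hlR (by linarith) ℓ).trans
                (pow_le_pow_right₀ (by linarith) hℓ))
          rw [abs_mul, abs_of_nonneg h3, abs_of_nonneg (logCut_nonneg _ _ _)]
          exact mul_le_mul h2 h4 (logCut_nonneg _ _ _) (h3.trans h2)
      _ ≤ _ := by
          rw [← Finset.sum_mul]
          refine mul_le_mul_of_nonneg_right (hS _ (fun p hp => (hb p hp).1) (fun p hp => ?_) R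
            (by linarith) _ hmem) (by positivity)
          rw [zero_mul, add_zero]
          exact (hb p hp).2.1
  have h2 : |sqf (fun p => -ratioWeight H p) d| ≤ sqf (fun _ => (k : ℝ) + 1) d := by
    rw [abs_sqf]
    refine sqf_le_sqf (fun _ _ => abs_nonneg _) (fun p hp => ?_) d
    rw [abs_neg, abs_of_nonneg (hb p hp).2.2.1]
    exact (hb p hp).2.2.2
  rw [selbergCoeff, abs_mul]
  calc _ ≤ sqf (fun _ => (k : ℝ) + 1) d
        * (C * (1 + Real.log R) ^ (k * (k + 1)) * (1 + Real.log R) ^ k) :=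
        mul_le_mul h2 h1 (abs_nonneg _) ((abs_nonneg _).trans h2)
    _ = _ := by rw [pow_add]; ring

theorem weightedPrimeSum_eq {H : Finset ℤ} (hH : Admissible H) (hne : H.Nonempty) (h₀ : ℤ)
    (N R : ℝ) (ℓ₁ ℓ₂ : ℕ) :
    weightedPrimeSum H h₀ N R ℓ₁ ℓ₂ = singularSeries H ^ 2
      * ∑ d₁ ∈ Finset.Ico 1 ⌈R⌉₊, ∑ d₂ ∈ Finset.Ico 1 ⌈R⌉₊,
        selbergCoeff ⌈R⌉₊ (ratioWeight H) (dualWeight H) (logCut R ℓ₁) d₁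
        * selbergCoeff ⌈R⌉₊ (ratioWeight H) (dualWeight H) (logCut R ℓ₂) d₂
        * ∑ n ∈ (Finset.Ioc ⌊N⌋₊ ⌊2 * N⌋₊).filter
            (fun n : ℕ => ((d₁.lcm d₂ : ℕ) : ℤ) ∣ tuplePoly H n), varpiInt ((n : ℤ) + h₀) := by
  classical
  unfold weightedPrimeSum
  have hL : ∀ (ℓ : ℕ) (n : ℕ), LambdaR H R ℓ n = singularSeries H * ∑ d ∈ Finset.Ico 1 ⌈R⌉₊,
      if (d : ℤ) ∣ tuplePoly H n then
        selbergCoeff ⌈R⌉₊ (ratioWeight H) (dualWeight H) (logCut R ℓ) d else 0 := by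
    intro ℓ n
    rw [LambdaR, ← Finset.sum_filter, Finset.mul_sum]
    exact Finset.sum_congr rfl fun d hd =>
      sieveLambda_eq hH hne R ℓ (Finset.mem_Ico.1 (Finset.mem_filter.1 hd).1).1
  have h1 : ∀ n ∈ Finset.Ioc ⌊N⌋₊ ⌊2 * N⌋₊,
      varpiInt ((n : ℤ) + h₀) * LambdaR H R ℓ₁ (n : ℤ) * LambdaR H R ℓ₂ (n : ℤ)
      = singularSeries H ^ 2 * ∑ d₁ ∈ Finset.Ico 1 ⌈R⌉₊, ∑ d₂ ∈ Finset.Ico 1 ⌈R⌉₊,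
        selbergCoeff ⌈R⌉₊ (ratioWeight H) (dualWeight H) (logCut R ℓ₁) d₁
        * selbergCoeff ⌈R⌉₊ (ratioWeight H) (dualWeight H) (logCut R ℓ₂) d₂
        * if ((d₁.lcm d₂ : ℕ) : ℤ) ∣ tuplePoly H n then varpiInt ((n : ℤ) + h₀) else 0 := by
    intro n _
    rw [hL, hL]
    calc _ = singularSeries H ^ 2 * ((∑ d ∈ Finset.Ico 1 ⌈R⌉₊,
          if (d : ℤ) ∣ tuplePoly H n then
            selbergCoeff ⌈R⌉₊ (ratioWeight H) (dualWeight H) (logCut R ℓ₁) d else 0)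
          * (∑ d ∈ Finset.Ico 1 ⌈R⌉₊, if (d : ℤ) ∣ tuplePoly H n then
            selbergCoeff ⌈R⌉₊ (ratioWeight H) (dualWeight H) (logCut R ℓ₂) d else 0)
          * varpiInt ((n : ℤ) + h₀)) := by ring
      _ = _ := by
        congr 1
        rw [Finset.sum_mul_sum, Finset.sum_mul]
        refine Finset.sum_congr rfl fun d₁ _ => ?_
        rw [Finset.sum_mul]
        refine Finset.sum_congr rfl fun d₂ _ => ?_
        have h2 : ((d₁.lcm d₂ : ℕ) : ℤ) ∣ tuplePoly H n
            ↔ (d₁ : ℤ) ∣ tuplePoly H n ∧ (d₂ : ℤ) ∣ tuplePoly H n := by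
          rw [Int.natCast_dvd, Int.natCast_dvd, Int.natCast_dvd, Nat.lcm_dvd_iff]
        simp only [h2]
        by_cases h3 : (d₁ : ℤ) ∣ tuplePoly H n <;> by_cases h4 : (d₂ : ℤ) ∣ tuplePoly H n <;>
          simp [h3, h4]
  rw [Finset.sum_congr rfl h1, ← Finset.mul_sum, Finset.sum_comm]
  congr 1
  refine Finset.sum_congr rfl fun d₁ _ => ?_
  rw [Finset.sum_comm]
  refine Finset.sum_congr rfl fun d₂ _ => ?_
  rw [← Finset.mul_sum, Finset.sum_filter]

/-- The divisor-type weight s is removed by s ≤ T + s²/T, in place of Cauchy–Schwarz. The first part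
meets the bare sum of E*, the second the trivial bound E* ≪ N log N/φ(q), with 1/T to spare. -/
theorem exists_sum_primeErrorStar_le (w : ℕ) : ∃ C : ℝ, 1 ≤ C ∧ ∀ N x T : ℝ, 0 < N →
    1 ≤ Real.log N → 1 ≤ x → x ≤ N → 0 < T →
    ∑ q ∈ Finset.Icc 1 ⌊x⌋₊,
        sqf (fun _ => (w : ℝ)) q * (primeErrorStar N q + Real.log N * Real.log (3 * N))
      ≤ T * ∑ q ∈ Finset.Icc 1 ⌊x⌋₊, primeErrorStar N q
        + C * (N * Real.log N ^ (2 * w ^ 2 + 1) / T) + C * (x * Real.log N ^ (w + 2)) := by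
  obtain ⟨C₁, hC₁, h₁⟩ := exists_sum_sqf_const_le w
  obtain ⟨C₂, hC₂, h₂⟩ := exists_sum_sqf_div_totient_le (w ^ 2)
  refine ⟨C₁ * 3 * 2 ^ w + C₂ * 8 * 2 ^ (2 * w ^ 2), ?_, ?_⟩
  · have h3 : (1 : ℝ) ≤ 2 ^ w := one_le_pow₀ (by norm_num)
    have h4 : 0 ≤ C₂ * 8 * 2 ^ (2 * w ^ 2) := by positivity
    nlinarith
  intro N x T hN hL hx hxN hT
  have h1 := h₁ x hx
  have h2 := h₂ x hx
  set L := Real.log N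
  have hlog2 : Real.log (2 * N) ≤ 2 * L := by
    rw [Real.log_mul (by norm_num) hN.ne']
    have := Real.log_two_lt_d9
    linarith
  have hlog2' : 1 ≤ Real.log (2 * N) := by
    rw [Real.log_mul (by norm_num) hN.ne']
    have := Real.log_two_gt_d9
    linarith
  have hlog3 : Real.log (3 * N) ≤ 3 * L := by
    rw [Real.log_mul (by norm_num) hN.ne']
    have := Real.log_le_sub_one_of_pos (show (0 : ℝ) < 3 by norm_num)
    linarith
  have hlog3' : 0 ≤ Real.log (3 * N) := Real.log_nonneg (by linarith)
  have hlx : Real.log x ≤ L := Real.log_le_log (by linarith) hxN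
  have hlx0 : 0 ≤ Real.log x := Real.log_nonneg hx
  have hq : ∀ q ∈ Finset.Icc 1 ⌊x⌋₊, 1 ≤ q ∧ (q : ℝ) ≤ N := fun q hq =>
    ⟨(Finset.mem_Icc.1 hq).1,
      ((Nat.le_floor_iff (by linarith)).1 (Finset.mem_Icc.1 hq).2).trans hxN⟩
  set s : ℕ → ℝ := sqf (fun _ => (w : ℝ))
  have hs0 : ∀ q, 0 ≤ s q := fun q => sqf_nonneg (fun _ _ => Nat.cast_nonneg _) q
  have hss : ∀ q, s q * s q = sqf (fun _ => ((w ^ 2 : ℕ) : ℝ)) q := fun q => by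
    rw [sqf_mul_sqf]
    exact sqf_congr fun p _ _ => by push_cast; ring
  have hterm : ∀ q ∈ Finset.Icc 1 ⌊x⌋₊, s q * (primeErrorStar N q + L * Real.log (3 * N))
      ≤ T * primeErrorStar N q
        + 8 * L * N / T * (sqf (fun _ => ((w ^ 2 : ℕ) : ℝ)) q * (1 / (q.totient : ℝ)))
        + 3 * L ^ 2 * s q := by
    intro q hqm
    obtain ⟨hq1, hqN⟩ := hq q hqm
    have h3 := primeErrorStar_nonneg hq1 hqN hlog2'
    have h4 := primeErrorStar_le hq1 hqN hlog2'
    have hφ : (0 : ℝ) < q.totient := by exact_mod_cast Nat.totient_pos.2 hq1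
    have h5 : s q ≤ T + s q * s q / T := by
      have : T + s q * s q / T = (T * T + s q * s q) / T := by field_simp
      rw [this, le_div_iff₀ hT]
      nlinarith [sq_nonneg (s q - T), mul_nonneg (hs0 q) hT.le]
    have h6 : primeErrorStar N q ≤ 8 * L * N * (1 / q.totient) := by
      refine h4.trans ?_
      calc 4 * Real.log (2 * N) * (N / q.totient) ≤ 4 * (2 * L) * (N / q.totient) := by gcongr
        _ = _ := by ring
    have h7 : s q * primeErrorStar N q ≤ T * primeErrorStar N q
        + s q * s q / T * (8 * L * N * (1 / q.totient)) :=
      calc s q * primeErrorStar N q ≤ (T + s q * s q / T) * primeErrorStar N q :=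
            mul_le_mul_of_nonneg_right h5 h3
        _ = T * primeErrorStar N q + s q * s q / T * primeErrorStar N q := by ring
        _ ≤ _ := by
            have : 0 ≤ s q * s q / T := div_nonneg (mul_nonneg (hs0 q) (hs0 q)) hT.le
            gcongr
    have h8 : s q * (L * Real.log (3 * N)) ≤ s q * (L * (3 * L)) := by
      have := hs0 q
      gcongr
    rw [← hss q]
    calc _ = s q * primeErrorStar N q + s q * (L * Real.log (3 * N)) := by ring
      _ ≤ _ := add_le_add h7 h8
      _ = _ := by ring
  refine (Finset.sum_le_sum hterm).trans ?_
  rw [Finset.sum_add_distrib, Finset.sum_add_distrib, ← Finset.mul_sum, ← Finset.mul_sum,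
    ← Finset.mul_sum]
  have h3 : 8 * L * N / T * ∑ q ∈ Finset.Icc 1 ⌊x⌋₊,
      sqf (fun _ => ((w ^ 2 : ℕ) : ℝ)) q * (1 / (q.totient : ℝ))
      ≤ C₂ * 8 * 2 ^ (2 * w ^ 2) * (N * L ^ (2 * w ^ 2 + 1) / T) := by
    calc _ ≤ 8 * L * N / T * (C₂ * (2 * L) ^ (2 * w ^ 2)) := by
          refine mul_le_mul_of_nonneg_left (h2.trans ?_) (by positivity)
          gcongr
          linarith
      _ = _ := by rw [mul_pow]; ring
  have h4 : 3 * L ^ 2 * ∑ q ∈ Finset.Icc 1 ⌊x⌋₊, s q ≤ C₁ * 3 * 2 ^ w * (x * L ^ (w + 2)) := by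
    calc _ ≤ 3 * L ^ 2 * (C₁ * x * (2 * L) ^ w) := by
          refine mul_le_mul_of_nonneg_left (h1.trans ?_) (by positivity)
          gcongr
          linarith
      _ = _ := by rw [mul_pow]; ring
  have h5 : 0 ≤ C₁ * 3 * 2 ^ w * (N * L ^ (2 * w ^ 2 + 1) / T) := by positivity
  have h6 : 0 ≤ C₂ * 8 * 2 ^ (2 * w ^ 2) * (x * L ^ (w + 2)) := by positivity
  linarith

theorem exists_abs_weightedPrimeSum_sub_le (k : ℕ) (hk : 1 ≤ k) : ∃ (C : ℝ) (w K : ℕ), 1 ≤ C ∧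
    ∀ N x R T : ℝ, 0 < N → 1 ≤ Real.log N → x ≤ N - Real.log N → 2 ≤ R → R ^ 2 ≤ x → 0 < T →
    ∀ (H : Finset ℤ) (h₀ : ℤ), H.card = k → |(h₀ : ℝ)| ≤ Real.log N → Admissible (insert h₀ H) →
    ∀ ℓ₁ ℓ₂ : ℕ, ℓ₁ ≤ k → ℓ₂ ≤ k →
    |weightedPrimeSum H h₀ N R ℓ₁ ℓ₂ - N * (singularSeries H ^ 2
      * ∑ d₁ ∈ Finset.Ico 1 ⌈R⌉₊, ∑ d₂ ∈ Finset.Ico 1 ⌈R⌉₊,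
        selbergCoeff ⌈R⌉₊ (ratioWeight H) (dualWeight H) (logCut R ℓ₁) d₁
        * selbergCoeff ⌈R⌉₊ (ratioWeight H) (dualWeight H) (logCut R ℓ₂) d₂
        * sqf (primeDensity H h₀) (d₁.lcm d₂))|
      ≤ singularSeries H ^ 2 * (C * Real.log N ^ K * (T * ∑ q ∈ Finset.Icc 1 ⌊x⌋₊, primeErrorStar N q
        + C * (N * Real.log N ^ (2 * w ^ 2 + 1) / T) + C * (x * Real.log N ^ (w + 2)))) := by
  -- Each coefficient carries k + 1 per prime; pairs with given lcm turn this into (k + 2)², and at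
  -- most k coprime classes per prime give the last factor.
  set w := (k + 2) ^ 2 * k
  set K₁ := k * (k + 1) + k
  obtain ⟨C₁, hC₁, hcoef⟩ := exists_abs_selbergCoeff_le k
  obtain ⟨C₂, hC₂, hsum⟩ := exists_sum_primeErrorStar_le w
  set C := C₁ ^ 2 * 2 ^ (2 * K₁) * C₂
  have h21 : (1 : ℝ) ≤ 2 ^ (2 * K₁) := one_le_pow₀ (by norm_num)
  have hC₁2 : 1 ≤ C₁ ^ 2 := one_le_pow₀ hC₁
  have hC12 : 1 ≤ C₁ ^ 2 * 2 ^ (2 * K₁) := one_le_mul_of_one_le_of_one_le hC₁2 h21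
  have hCC₂ : C₂ ≤ C := le_mul_of_one_le_left (by linarith) hC12
  have hCC₁ : C₁ ^ 2 * 2 ^ (2 * K₁) ≤ C := le_mul_of_one_le_right (by linarith) hC₂
  refine ⟨C, w, 2 * K₁, hC₂.trans hCC₂, ?_⟩
  intro N x R T hN hL hxN hR hRx hT H h₀ hHk hh₀ hH₀ ℓ₁ ℓ₂ hℓ₁ hℓ₂
  have hH := hH₀.of_insert
  have hne : H.Nonempty := Finset.card_pos.1 (by omega)
  have hx1 : 1 ≤ x := by nlinarith
  have hxN' : x ≤ N := by linarith
  have hsum' := hsum N x T hN hL hx1 hxN' hT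
  have hlog2 : 1 ≤ Real.log (2 * N) := by
    rw [Real.log_mul (by norm_num) hN.ne']
    have := Real.log_two_gt_d9
    linarith
  have hlog3 : 0 ≤ Real.log (3 * N) := Real.log_nonneg (by linarith)
  have hlR0 : 0 ≤ Real.log R := Real.log_nonneg (by linarith)
  have hlR : Real.log R ≤ Real.log N := Real.log_le_log (by linarith) (by nlinarith)
  set L := Real.log N
  rw [weightedPrimeSum_eq hH hne]
  set c₁ := selbergCoeff ⌈R⌉₊ (ratioWeight H) (dualWeight H) (logCut R ℓ₁)
  set c₂ := selbergCoeff ⌈R⌉₊ (ratioWeight H) (dualWeight H) (logCut R ℓ₂)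
  set P : ℕ → ℝ := fun q => ∑ n ∈ (Finset.Ioc ⌊N⌋₊ ⌊2 * N⌋₊).filter
            (fun n : ℕ => (q : ℤ) ∣ tuplePoly H n), varpiInt ((n : ℤ) + h₀)
  set m : ℕ → ℝ := fun _ => (k : ℝ) + 1
  have hm : ∀ p, p.Prime → 0 ≤ m p := fun p _ => by simp only [m]; positivity
  set G : ℕ → ℝ := fun q => sqf (fun _ => (k : ℝ)) q * (primeErrorStar N q + L * Real.log (3 * N))
  have hcb : ∀ ℓ, ℓ ≤ k → ∀ d, 1 ≤ d →
      |selbergCoeff ⌈R⌉₊ (ratioWeight H) (dualWeight H) (logCut R ℓ) d|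
        ≤ C₁ * (2 * L) ^ K₁ * sqf m d := by
    intro ℓ hℓ d hd
    refine (hcoef H hHk hH R hR ℓ hℓ d hd).trans ?_
    have := sqf_nonneg hm d
    gcongr
    linarith
  have hlt : ∀ d ∈ Finset.Ico 1 ⌈R⌉₊, 1 ≤ d ∧ (d : ℝ) < R := fun d hd =>
    ⟨(Finset.mem_Ico.1 hd).1, Nat.lt_ceil.1 (Finset.mem_Ico.1 hd).2⟩
  have hlcm : ∀ d₁ ∈ Finset.Ico 1 ⌈R⌉₊, ∀ d₂ ∈ Finset.Ico 1 ⌈R⌉₊, d₁.lcm d₂ ≤ ⌊x⌋₊ := by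
    intro d₁ hd₁ d₂ hd₂
    obtain ⟨h1, h2⟩ := hlt d₁ hd₁
    obtain ⟨h3, h4⟩ := hlt d₂ hd₂
    refine Nat.le_floor ?_
    have h5 : d₁.lcm d₂ ≤ d₁ * d₂ :=
      Nat.le_of_dvd (Nat.mul_pos h1 h3) (Nat.lcm_dvd (dvd_mul_right _ _) (dvd_mul_left _ _))
    have h6 : ((d₁.lcm d₂ : ℕ) : ℝ) ≤ d₁ * d₂ := by exact_mod_cast h5
    have h7 : (d₁ : ℝ) * d₂ ≤ R * R := by gcongr
    rw [← sq] at h7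
    linarith
  have hqx : ∀ q ∈ Finset.Icc 1 ⌊x⌋₊, 1 ≤ q ∧ (q : ℝ) ≤ N - L := fun q hq =>
    ⟨(Finset.mem_Icc.1 hq).1,
      ((Nat.le_floor_iff (by linarith)).1 (Finset.mem_Icc.1 hq).2).trans hxN⟩
  have hE0 : ∀ q ∈ Finset.Icc 1 ⌊x⌋₊, 0 ≤ primeErrorStar N q + L * Real.log (3 * N) := fun q hq => by
    have := primeErrorStar_nonneg (hqx q hq).1 (by linarith [(hqx q hq).2]) hlog2
    have : 0 ≤ L * Real.log (3 * N) := mul_nonneg (by linarith) hlog3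
    linarith
  have hG : ∀ q ∈ Finset.Icc 1 ⌊x⌋₊, 0 ≤ G q := fun q hq =>
    mul_nonneg (sqf_nonneg (fun _ _ => Nat.cast_nonneg _) q) (hE0 q hq)
  have hP : ∀ q ∈ Finset.Icc 1 ⌊x⌋₊, Squarefree q → |P q - N * sqf (primeDensity H h₀) q| ≤ G q := by
    intro q hq hsq
    refine (abs_sum_varpi_dvd_sub_le (by linarith) hh₀ hsq (hqx q hq).2 hlog2).trans ?_
    refine mul_le_mul_of_nonneg_right ?_ (hE0 q hq)
    rw [coprimeCount_squarefree H h₀ hsq]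
    refine sqf_le_sqf (fun p hp => ?_) (fun p hp => ?_) q
    · have : (1 : ℝ) ≤ nuPrime (insert h₀ H) p := by
        exact_mod_cast one_le_nuPrime (Finset.insert_nonempty h₀ H) p
      linarith
    · have h1 : nuPrime (insert h₀ H) p ≤ k + 1 :=
        (nuPrime_le_card _ p).trans (hHk ▸ Finset.card_insert_le h₀ H)
      have h2 : (nuPrime (insert h₀ H) p : ℝ) ≤ k + 1 := by exact_mod_cast h1
      linarith
  have e : singularSeries H ^ 2 * ∑ d₁ ∈ Finset.Ico 1 ⌈R⌉₊, ∑ d₂ ∈ Finset.Ico 1 ⌈R⌉₊,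
        c₁ d₁ * c₂ d₂ * P (d₁.lcm d₂)
      - N * (singularSeries H ^ 2 * ∑ d₁ ∈ Finset.Ico 1 ⌈R⌉₊, ∑ d₂ ∈ Finset.Ico 1 ⌈R⌉₊,
        c₁ d₁ * c₂ d₂ * sqf (primeDensity H h₀) (d₁.lcm d₂))
      = singularSeries H ^ 2 * ∑ d₁ ∈ Finset.Ico 1 ⌈R⌉₊, ∑ d₂ ∈ Finset.Ico 1 ⌈R⌉₊,
        c₁ d₁ * c₂ d₂ * (P (d₁.lcm d₂) - N * sqf (primeDensity H h₀) (d₁.lcm d₂)) := by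
    rw [mul_left_comm N, ← mul_sub, Finset.mul_sum, ← Finset.sum_sub_distrib]
    congr 1
    refine Finset.sum_congr rfl fun d₁ _ => ?_
    rw [Finset.mul_sum, ← Finset.sum_sub_distrib]
    exact Finset.sum_congr rfl fun d₂ _ => by ring
  rw [e, abs_mul, abs_of_nonneg (sq_nonneg (singularSeries H))]
  refine mul_le_mul_of_nonneg_left ?_ (sq_nonneg _)
  have hterm : ∀ d₁ ∈ Finset.Ico 1 ⌈R⌉₊, ∀ d₂ ∈ Finset.Ico 1 ⌈R⌉₊,
      |c₁ d₁ * c₂ d₂ * (P (d₁.lcm d₂) - N * sqf (primeDensity H h₀) (d₁.lcm d₂))|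
      ≤ C₁ ^ 2 * 2 ^ (2 * K₁) * L ^ (2 * K₁) * (sqf m d₁ * sqf m d₂ * G (d₁.lcm d₂)) := by
    intro d₁ hd₁ d₂ hd₂
    have h1 := hcb ℓ₁ hℓ₁ d₁ (hlt d₁ hd₁).1
    have h2 := hcb ℓ₂ hℓ₂ d₂ (hlt d₂ hd₂).1
    by_cases hs1 : Squarefree d₁
    swap
    · have h3 : c₁ d₁ = 0 := sqf_eq_zero_of_selbergCoeff _ _ _ _ hs1
      rw [h3, sqf_of_not_squarefree _ hs1]
      simp
    by_cases hs2 : Squarefree d₂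
    swap
    · have h3 : c₂ d₂ = 0 := sqf_eq_zero_of_selbergCoeff _ _ _ _ hs2
      rw [h3, sqf_of_not_squarefree _ hs2]
      simp
    have hmem : d₁.lcm d₂ ∈ Finset.Icc 1 ⌊x⌋₊ :=
      Finset.mem_Icc.2 ⟨Nat.lcm_pos (hlt d₁ hd₁).1 (hlt d₂ hd₂).1, hlcm d₁ hd₁ d₂ hd₂⟩
    have h3 := hP _ hmem (squarefree_lcm hs1 hs2)
    rw [abs_mul, abs_mul]
    calc _ ≤ (C₁ * (2 * L) ^ K₁ * sqf m d₁) * (C₁ * (2 * L) ^ K₁ * sqf m d₂) * G (d₁.lcm d₂) := by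
          have h4 := sqf_nonneg hm d₁
          have h5 := sqf_nonneg hm d₂
          gcongr
      _ = _ := by rw [mul_pow, mul_comm 2 K₁, pow_mul, pow_mul]; ring
  calc _ ≤ ∑ d₁ ∈ Finset.Ico 1 ⌈R⌉₊, ∑ d₂ ∈ Finset.Ico 1 ⌈R⌉₊,
        |c₁ d₁ * c₂ d₂ * (P (d₁.lcm d₂) - N * sqf (primeDensity H h₀) (d₁.lcm d₂))| :=
        (Finset.abs_sum_le_sum_abs _ _).trans
          (Finset.sum_le_sum fun d₁ _ => Finset.abs_sum_le_sum_abs _ _)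
    _ ≤ ∑ d₁ ∈ Finset.Ico 1 ⌈R⌉₊, ∑ d₂ ∈ Finset.Ico 1 ⌈R⌉₊,
        C₁ ^ 2 * 2 ^ (2 * K₁) * L ^ (2 * K₁) * (sqf m d₁ * sqf m d₂ * G (d₁.lcm d₂)) :=
        Finset.sum_le_sum fun d₁ hd₁ => Finset.sum_le_sum fun d₂ hd₂ => hterm d₁ hd₁ d₂ hd₂
    _ = C₁ ^ 2 * 2 ^ (2 * K₁) * L ^ (2 * K₁) * ∑ d₁ ∈ Finset.Ico 1 ⌈R⌉₊,
        ∑ d₂ ∈ Finset.Ico 1 ⌈R⌉₊, sqf m d₁ * sqf m d₂ * G (d₁.lcm d₂) := by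
        simp only [Finset.mul_sum]
    _ ≤ C₁ ^ 2 * 2 ^ (2 * K₁) * L ^ (2 * K₁) * ∑ q ∈ Finset.Icc 1 ⌊x⌋₊,
        sqf (fun p => (1 + m p) ^ 2) q * G q := by
        refine mul_le_mul_of_nonneg_left (sum_sum_sqf_lcm_le hm hlcm hG) (by positivity)
    _ = C₁ ^ 2 * 2 ^ (2 * K₁) * L ^ (2 * K₁) * ∑ q ∈ Finset.Icc 1 ⌊x⌋₊,
        sqf (fun _ => (w : ℝ)) q * (primeErrorStar N q + L * Real.log (3 * N)) := by
        congr 1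
        refine Finset.sum_congr rfl fun q _ => ?_
        simp only [G]
        rw [← mul_assoc, sqf_mul_sqf]
        congr 1
        refine sqf_congr fun p _ _ => ?_
        simp only [m, w]
        push_cast
        ring
    _ ≤ C * L ^ (2 * K₁) * ∑ q ∈ Finset.Icc 1 ⌊x⌋₊,
        sqf (fun _ => (w : ℝ)) q * (primeErrorStar N q + L * Real.log (3 * N)) := by
        refine mul_le_mul_of_nonneg_right ?_ (Finset.sum_nonneg fun q hq =>
          mul_nonneg (sqf_nonneg (fun _ _ => Nat.cast_nonneg _) q) (hE0 q hq))
        exact mul_le_mul_of_nonneg_right hCC₁ (by positivity)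
    _ ≤ _ := by
        refine mul_le_mul_of_nonneg_left (hsum'.trans ?_) (by positivity)
        gcongr

theorem exists_forall_abs_weightedPrimeSum_sub_le (k : ℕ) (hk : 1 ≤ k) {θ ε : ℝ} (hθ : θ ≤ 1)
    (hBV : HypothesisBV θ) (hε : 0 < ε) : ∃ N₀ : ℝ, ∀ N : ℝ, N₀ ≤ N → 0 < N ∧ ∀ R : ℝ, 2 ≤ R →
    R ≤ N ^ ((θ - ε) / 2) →
    ∀ (H : Finset ℤ) (h₀ : ℤ), H.card = k → |(h₀ : ℝ)| ≤ Real.log N → Admissible (insert h₀ H) →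
    ∀ ℓ₁ ℓ₂ : ℕ, ℓ₁ ≤ k → ℓ₂ ≤ k →
    |weightedPrimeSum H h₀ N R ℓ₁ ℓ₂ - N * (singularSeries H ^ 2
      * ∑ d₁ ∈ Finset.Ico 1 ⌈R⌉₊, ∑ d₂ ∈ Finset.Ico 1 ⌈R⌉₊,
        selbergCoeff ⌈R⌉₊ (ratioWeight H) (dualWeight H) (logCut R ℓ₁) d₁
        * selbergCoeff ⌈R⌉₊ (ratioWeight H) (dualWeight H) (logCut R ℓ₂) d₂
        * sqf (primeDensity H h₀) (d₁.lcm d₂))| ≤ singularSeries H ^ 2 * N := by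
  obtain ⟨C, w, K, hC, hmain⟩ := exists_abs_weightedPrimeSum_sub_le k hk
  -- With T = (log N)^B the trivial-bound term is O(N/log N), and A makes the BV term O(N/log N)
  -- too. The remaining term is O(N^(θ-ε)) times a power of log N, smaller than N because θ - ε < 1.
  set B := K + 2 * w ^ 2 + 2
  set A := B + K + 1
  obtain ⟨C_A, hA⟩ := hBV (A : ℕ) (by positivity) ε hε
  set σ := θ - ε
  have hσ : 0 < 1 - σ := by simp only [σ]; linarith
  set c := C * (|C_A| + C)
  have hc0 : 0 ≤ c := by positivity
  have hev1 : ∀ᶠ N : ℝ in atTop, 2 * c + 1 ≤ Real.log N :=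
    Real.tendsto_log_atTop.eventually_ge_atTop _
  have hev2 : ∀ᶠ N : ℝ in atTop, ‖Real.log N ^ ((K + w + 2 : ℕ) : ℝ)‖
      ≤ 1 / (4 * C ^ 2) * ‖N ^ (1 - σ)‖ :=
    (isLittleO_log_rpow_rpow_atTop ((K + w + 2 : ℕ) : ℝ) hσ).bound (by positivity)
  have hev3 : ∀ᶠ N : ℝ in atTop, ‖Real.log N‖ ≤ 1 / 2 * ‖N‖ :=
    Real.isLittleO_log_id_atTop.bound (by norm_num)
  obtain ⟨N₀, hN₀⟩ := eventually_atTop.1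
    (hev1.and (hev2.and (hev3.and (eventually_ge_atTop (2 : ℝ)))))
  refine ⟨N₀, fun N hN => ?_⟩
  obtain ⟨h1, h2, h3, h4⟩ := hN₀ N hN
  have hN0 : 0 < N := by linarith
  refine ⟨hN0, fun R hR hRN H h₀ hHk hh₀ hH₀ ℓ₁ ℓ₂ hℓ₁ hℓ₂ => ?_⟩
  set L := Real.log N
  have hL : 1 ≤ L := by linarith
  set x := N ^ σ
  have hx0 : 0 < x := by positivity
  rw [Real.rpow_natCast, Real.norm_of_nonneg (by positivity), Real.norm_of_nonneg (by positivity)]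
    at h2
  rw [Real.norm_of_nonneg (by linarith), Real.norm_of_nonneg hN0.le] at h3
  have hxx : x * N ^ (1 - σ) = N := by
    simp only [x]
    rw [← Real.rpow_add hN0, add_sub_cancel, Real.rpow_one]
  have hxL : C ^ 2 * (x * L ^ (K + w + 2)) ≤ N / 4 := by
    calc C ^ 2 * (x * L ^ (K + w + 2)) ≤ C ^ 2 * (x * (1 / (4 * C ^ 2) * N ^ (1 - σ))) := by gcongr
      _ = x * N ^ (1 - σ) / 4 := by field_simp
      _ = _ := by rw [hxx]
  have hxN : x ≤ N / 4 := by
    refine le_trans ?_ hxL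
    have h5 : 1 ≤ L ^ (K + w + 2) := one_le_pow₀ hL
    have h6 : 1 ≤ C ^ 2 := one_le_pow₀ hC
    have h7 : x ≤ x * L ^ (K + w + 2) := le_mul_of_one_le_right hx0.le h5
    exact h7.trans (le_mul_of_one_le_left (by positivity) h6)
  have hRx : R ^ 2 ≤ x := by
    have h5 : R ^ 2 ≤ (N ^ (σ / 2)) ^ 2 := pow_le_pow_left₀ (by linarith) hRN 2
    refine h5.trans (le_of_eq ?_)
    rw [← Real.rpow_natCast, ← Real.rpow_mul hN0.le]
    simp only [x]
    congr 1
    push_cast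
    ring
  have hT : 0 < L ^ B := by positivity
  refine (hmain N x R (L ^ B) hN0 hL (by linarith) hR hRx hT H h₀ hHk hh₀ hH₀ ℓ₁ ℓ₂ hℓ₁ hℓ₂).trans ?_
  refine mul_le_mul_of_nonneg_left ?_ (sq_nonneg _)
  have hBVN := hA N h4
  rw [Real.rpow_neg (by linarith), Real.rpow_natCast] at hBVN
  have hS : L ^ B * ∑ q ∈ Finset.Icc 1 ⌊x⌋₊, primeErrorStar N q
      ≤ L ^ B * (|C_A| * (N * (L ^ A)⁻¹)) := by
    refine mul_le_mul_of_nonneg_left (hBVN.trans ?_) hT.le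
    exact mul_le_mul_of_nonneg_right (le_abs_self _) (by positivity)
  have hL0 : L ≠ 0 := by linarith
  calc _ ≤ C * L ^ K * (L ^ B * (|C_A| * (N * (L ^ A)⁻¹))
        + C * (N * L ^ (2 * w ^ 2 + 1) / L ^ B) + C * (x * L ^ (w + 2))) := by gcongr
    _ = c * (N / L) + C ^ 2 * (x * L ^ (K + w + 2)) := by
        have e1 : L ^ K * L ^ B * (L ^ A)⁻¹ = 1 / L := by
          have : L ^ A = L ^ K * L ^ B * L := by
            rw [← pow_add, ← pow_succ]
            congr 1
            simp only [A]
            ring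
          rw [this]
          field_simp
        have e2 : L ^ K * L ^ (2 * w ^ 2 + 1) / L ^ B = 1 / L := by
          have : L ^ B = L ^ K * L ^ (2 * w ^ 2 + 1) * L := by
            rw [← pow_add, ← pow_succ]
            congr 1
          rw [this]
          field_simp
        calc _ = C * |C_A| * N * (L ^ K * L ^ B * (L ^ A)⁻¹)
              + C ^ 2 * N * (L ^ K * L ^ (2 * w ^ 2 + 1) / L ^ B)
              + C ^ 2 * (x * (L ^ K * L ^ (w + 2))) := by ring
          _ = _ := by
              rw [e1, e2, ← pow_add, add_assoc K w 2]
              simp only [c]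
              ring
    _ ≤ N / 2 + N / 4 := by
        refine add_le_add ?_ hxL
        rw [← mul_div_assoc, div_le_div_iff₀ (by linarith) (by norm_num)]
        nlinarith
    _ ≤ N := by linarith

/-! ### Assembly. -/

/-- The sieve's quadratic form is diagonal in terms of `diagonalForm`. -/
theorem sum_selbergCoeff_eq_sum_diagonalForm {H : Finset ℤ} {h₀ : ℤ}
    (hH₀ : Admissible (insert h₀ H)) (R : ℝ) (ℓ₁ ℓ₂ : ℕ) :
    ∑ d₁ ∈ Finset.Ico 1 ⌈R⌉₊, ∑ d₂ ∈ Finset.Ico 1 ⌈R⌉₊,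
        selbergCoeff ⌈R⌉₊ (ratioWeight H) (dualWeight H) (logCut R ℓ₁) d₁
        * selbergCoeff ⌈R⌉₊ (ratioWeight H) (dualWeight H) (logCut R ℓ₂) d₂
        * sqf (primeDensity H h₀) (d₁.lcm d₂)
      = ∑ r ∈ Finset.Ico 1 ⌈R⌉₊, sqf (densityWeight (insert h₀ H)) r
        * (diagonalForm H h₀ R ℓ₁ r * diagonalForm H h₀ R ℓ₂ r) :=
  sum_selbergCoeff_lcm ⌈R⌉₊ (ratioWeight H) (dualWeight H) (primeDensity H h₀)
    (transferWeight H h₀) (densityWeight (insert h₀ H)) (logCut R ℓ₁) (logCut R ℓ₂)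
    (fun _ h => logCut_of_ceil_le h ℓ₁) (fun _ h => logCut_of_ceil_le h ℓ₂)
    (fun _ hp => (weights_relations hH₀ hp).1) (fun _ hp => (weights_relations hH₀ hp).2.1)
    fun _ hp => (weights_relations hH₀ hp).2.2

/-- The error carries S² and the main term S, so their quotient is of order βS/l. The lower bounds
on β and l let the constant `D` be absorbed into β l^n. -/
theorem exists_relative_error {W N S β l ch C D : ℝ} (n : ℕ) (hN : 0 < N) (hS : 0 < S)
    (hβ : Real.log 2 / 2 ≤ β) (hl : Real.log 2 ≤ l) (hch : 1 ≤ ch) (hC : 0 ≤ C) (hD : 0 ≤ D)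
    (hW : |W - N * S ^ 2 * (ch * (S⁻¹ * (l ^ (n + 1) / ((n + 1).factorial : ℝ))))|
      ≤ N * S ^ 2 * (D + C * β * l ^ n)) :
    ∃ δ : ℝ, |δ| ≤ (n + 1).factorial * (D * (2 / Real.log 2 ^ (n + 1)) + C) * (β * S / l) ∧
      W = ch * N * S * (l ^ (n + 1) / ((n + 1).factorial : ℝ)) * (1 + δ) := by
  have hl2 : 0 < Real.log 2 := Real.log_pos (by norm_num)
  have hl0 : 0 < l := hl2.trans_le hl
  have hβ0 : 0 < β := lt_of_lt_of_le (by positivity) hβ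
  have hch0 : 0 < ch := by linarith
  set F : ℝ := ((n + 1).factorial : ℝ)
  have hF : 0 < F := by positivity
  set X := ch * N * S * (l ^ (n + 1) / F)
  have hX : 0 < X := by positivity
  have hX' : N * S ^ 2 * (ch * (S⁻¹ * (l ^ (n + 1) / F))) = X := by
    simp only [X]
    field_simp
  rw [hX'] at hW
  refine ⟨W / X - 1, ?_, by field_simp; ring⟩
  have h1 : 1 ≤ 2 / Real.log 2 ^ (n + 1) * (β * l ^ n) := by
    have h2 : Real.log 2 ^ n ≤ l ^ n := pow_le_pow_left₀ hl2.le hl n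
    have h3 : Real.log 2 / 2 * Real.log 2 ^ n ≤ β * l ^ n := mul_le_mul hβ h2 (by positivity) hβ0.le
    rw [div_mul_eq_mul_div, one_le_div (by positivity), pow_succ]
    linarith
  have h2 : D + C * β * l ^ n ≤ (D * (2 / Real.log 2 ^ (n + 1)) + C) * (β * l ^ n) := by
    have := mul_le_mul_of_nonneg_left h1 hD
    linarith
  have h3 : |W / X - 1| = |W - X| / X := by
    rw [div_sub_one hX.ne', abs_div, abs_of_pos hX]
  rw [h3, div_le_iff₀ hX]
  set c := D * (2 / Real.log 2 ^ (n + 1)) + C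
  have hc : 0 ≤ c := by positivity
  calc |W - X| ≤ N * S ^ 2 * (c * (β * l ^ n)) :=
        hW.trans (mul_le_mul_of_nonneg_left h2 (by positivity))
    _ ≤ ch * (N * S ^ 2 * (c * (β * l ^ n))) := le_mul_of_one_le_left (by positivity) hch
    _ = _ := by
      simp only [X]
      rw [pow_succ l n]
      field_simp

theorem exists_relative_error_mem (k : ℕ) (hk : 2 ≤ k) (ℓ₁ ℓ₂ : ℕ) : ∃ C : ℝ, 0 ≤ C ∧
    ∀ (N R : ℝ) (H : Finset ℤ) (h₀ : ℤ), 0 < N → 2 ≤ R → H.card = k → h₀ ∈ H → Admissible H →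
    |weightedPrimeSum H h₀ N R ℓ₁ ℓ₂ - N * (singularSeries H ^ 2
      * ∑ r ∈ Finset.Ico 1 ⌈R⌉₊, sqf (densityWeight (insert h₀ H)) r
        * (diagonalForm H h₀ R ℓ₁ r * diagonalForm H h₀ R ℓ₂ r))| ≤ singularSeries H ^ 2 * N →
    ∃ δ : ℝ, |δ| ≤ C * (beta H * singularSeries H / Real.log R) ∧
      weightedPrimeSum H h₀ N R ℓ₁ ℓ₂ = (Nat.choose (ℓ₁ + ℓ₂ + 2) (ℓ₁ + 1) : ℝ) * N
        * singularSeries H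
        * ((Real.log R) ^ (k + ℓ₁ + ℓ₂ + 1) / (Nat.factorial (k + ℓ₁ + ℓ₂ + 1) : ℝ)) * (1 + δ) := by
  obtain ⟨C, hC, hmain⟩ := exists_main_term_mem k hk ℓ₁ ℓ₂
  have hl2 : 0 < Real.log 2 := Real.log_pos (by norm_num)
  refine ⟨(k + ℓ₁ + ℓ₂ + 1).factorial * (1 * (2 / Real.log 2 ^ (k + ℓ₁ + ℓ₂ + 1)) + C),
    by positivity, ?_⟩
  intro N R H h₀ hN hR hHk h₀H hH hW
  have h1 := hmain H h₀ hHk hH h₀H R hR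
  rw [Finset.insert_eq_of_mem h₀H] at hW
  refine exists_relative_error (k + ℓ₁ + ℓ₂) hN (singularSeries_pos hH (by omega))
    (le_beta H hH (by omega)) (Real.log_le_log (by norm_num) hR) ?_ hC zero_le_one ?_
  · exact_mod_cast Nat.choose_pos (by omega)
  set Q := ∑ r ∈ Finset.Ico 1 ⌈R⌉₊, sqf (densityWeight H) r
        * (diagonalForm H h₀ R ℓ₁ r * diagonalForm H h₀ R ℓ₂ r)
  set S := singularSeries H
  have hNS : 0 ≤ N * S ^ 2 := by positivity
  have h2 := mul_le_mul_of_nonneg_left h1 hNS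
  rw [← abs_of_nonneg hNS, ← abs_mul, abs_of_nonneg hNS, mul_sub] at h2
  have h3 := abs_sub_le (weightedPrimeSum H h₀ N R ℓ₁ ℓ₂) (N * (S ^ 2 * Q))
    (N * S ^ 2 * ((ℓ₁ + ℓ₂ + 2).choose (ℓ₁ + 1) * (S⁻¹
        * (Real.log R ^ (k + ℓ₁ + ℓ₂ + 1) / ((k + ℓ₁ + ℓ₂ + 1).factorial : ℝ)))))
  rw [← mul_assoc N] at h3 hW
  linarith

theorem exists_relative_error_notMem (k : ℕ) (hk : 2 ≤ k) (ℓ₁ ℓ₂ : ℕ) : ∃ C : ℝ, 0 ≤ C ∧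
    ∀ (N R : ℝ) (H : Finset ℤ) (h₀ : ℤ), 0 < N → 2 ≤ R → H.card = k → h₀ ∉ H →
    Admissible (insert h₀ H) → 1 ≤ ℓ₁ → 1 ≤ ℓ₂ →
    |weightedPrimeSum H h₀ N R ℓ₁ ℓ₂ - N * (singularSeries H ^ 2
      * ∑ r ∈ Finset.Ico 1 ⌈R⌉₊, sqf (densityWeight (insert h₀ H)) r
        * (diagonalForm H h₀ R ℓ₁ r * diagonalForm H h₀ R ℓ₂ r))| ≤ singularSeries H ^ 2 * N →
    ∃ δ : ℝ, |δ| ≤ C * (beta (insert h₀ H) * singularSeries (insert h₀ H) / Real.log R) ∧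
      weightedPrimeSum H h₀ N R ℓ₁ ℓ₂ = (Nat.choose (ℓ₁ + ℓ₂) ℓ₁ : ℝ) * N
        * singularSeries (insert h₀ H)
        * ((Real.log R) ^ (k + ℓ₁ + ℓ₂) / (Nat.factorial (k + ℓ₁ + ℓ₂) : ℝ)) * (1 + δ) := by
  -- The positivity conditions follow the quantifier over C so that a constant can be chosen for
  -- every pair; outside them any value will do.
  by_cases hℓ : 1 ≤ ℓ₁ ∧ 1 ≤ ℓ₂
  swap
  · exact ⟨0, le_rfl, fun N R H h₀ _ _ _ _ _ h1 h2 => absurd ⟨h1, h2⟩ hℓ⟩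
  obtain ⟨C, hC, hmain⟩ := exists_main_term_notMem k hk ℓ₁ ℓ₂ hℓ.1 hℓ.2
  have hl2 : 0 < Real.log 2 := Real.log_pos (by norm_num)
  obtain ⟨n, hn⟩ : ∃ n, k + ℓ₁ + ℓ₂ = n + 1 := ⟨k + ℓ₁ + ℓ₂ - 1, by omega⟩
  rw [hn]
  rw [hn, Nat.add_sub_cancel] at hmain
  set E := Real.exp (4 * (k + 2) ^ 3 * ∑' n : ℕ, (n : ℝ) ^ (-(3 / 2) : ℝ))
  refine ⟨(n + 1).factorial * (E ^ 2 * (2 / Real.log 2 ^ (n + 1)) + C), by positivity, ?_⟩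
  intro N R H h₀ hN hR hHk h₀H hH₀ _ _ hW
  have h1 := hmain H h₀ hHk hH₀ h₀H R hR
  have hcard : (insert h₀ H).card = k + 1 := by rw [Finset.card_insert_of_notMem h₀H, hHk]
  have hS₀ := singularSeries_insert hH₀ h₀H (by omega)
  have hSpos := singularSeries_pos hH₀.of_insert (by omega)
  have hBE := one_le_transferConst_mul hH₀ h₀H
  rw [hHk] at hBE
  refine exists_relative_error n hN (singularSeries_pos hH₀ (by omega))
    (le_beta _ hH₀ (by omega)) (Real.log_le_log (by norm_num) hR) ?_ hC (sq_nonneg E) ?_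
  · exact_mod_cast Nat.choose_pos (by omega)
  set Q := ∑ r ∈ Finset.Ico 1 ⌈R⌉₊, sqf (densityWeight (insert h₀ H)) r
        * (diagonalForm H h₀ R ℓ₁ r * diagonalForm H h₀ R ℓ₂ r)
  set S := singularSeries H
  set S₀ := singularSeries (insert h₀ H)
  set B := transferConst H h₀
  set X := (ℓ₁ + ℓ₂).choose ℓ₁ * (S₀⁻¹ * (Real.log R ^ (n + 1) / ((n + 1).factorial : ℝ)))
  have hNS : 0 ≤ N * S ^ 2 := by positivity
  have h2 := mul_le_mul_of_nonneg_left h1 hNS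
  rw [← abs_of_nonneg hNS, ← abs_mul, abs_of_nonneg hNS, mul_sub, ← mul_assoc _ (B ^ 2),
    ← mul_assoc _ (B ^ 2)] at h2
  have e : N * S ^ 2 * B ^ 2 = N * S₀ ^ 2 := by rw [hS₀]; ring
  rw [e] at h2
  have h3 := abs_sub_le (weightedPrimeSum H h₀ N R ℓ₁ ℓ₂) (N * (S ^ 2 * Q)) (N * S₀ ^ 2 * X)
  -- The arithmetic error comes with 𝔖(H)², which the lower bound for 𝔖(H⁰)/𝔖(H) turns into 𝔖(H⁰)².
  have h4 : S ^ 2 * N ≤ N * S₀ ^ 2 * E ^ 2 := by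
    have h5 : S ≤ S₀ * E := by
      rw [hS₀]
      have := mul_le_mul_of_nonneg_right hBE hSpos.le
      linarith
    have h6 := pow_le_pow_left₀ hSpos.le h5 2
    have h7 := mul_le_mul_of_nonneg_right h6 hN.le
    rw [mul_pow] at h7
    linarith
  rw [← mul_assoc N] at h3 hW
  linarith

end SmallGaps

end

theorem theorem6 (k : ℕ) (hk : 2 ≤ k) :
    ∃ C : ℝ, 0 < C ∧
      ∀ θ : ℝ, 0 < θ → θ ≤ 1 → SmallGaps.HypothesisBV θ →
      ∀ ε : ℝ, 0 < ε →
      ∃ N₀ : ℝ, ∀ N : ℝ, N₀ ≤ N →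
      ∀ R : ℝ, 2 ≤ R → R ≤ N ^ ((θ - ε) / 2) →
      ∀ H : Finset ℤ, H.card = k →
      ∀ h₀ : ℤ, (∀ h ∈ insert h₀ H, |(h : ℝ)| ≤ Real.log N) →
      ∀ ℓ₁ ℓ₂ : ℕ, ℓ₁ ≤ k → ℓ₂ ≤ k →
        (h₀ ∈ H → SmallGaps.Admissible H →
          ∃ δ : ℝ,
            |δ| ≤ C * (SmallGaps.beta H * SmallGaps.singularSeries H / Real.log R) ∧
            SmallGaps.weightedPrimeSum H h₀ N R ℓ₁ ℓ₂ =
              (Nat.choose (ℓ₁ + ℓ₂ + 2) (ℓ₁ + 1) : ℝ) * N * SmallGaps.singularSeries H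
                * ((Real.log R) ^ (k + ℓ₁ + ℓ₂ + 1) / (Nat.factorial (k + ℓ₁ + ℓ₂ + 1) : ℝ))
                * (1 + δ)) ∧
        (h₀ ∉ H → SmallGaps.Admissible (insert h₀ H) → 1 ≤ ℓ₁ → 1 ≤ ℓ₂ →
          ∃ δ : ℝ,
            |δ| ≤ C * (SmallGaps.beta (insert h₀ H) * SmallGaps.singularSeries (insert h₀ H)
              / Real.log R) ∧
            SmallGaps.weightedPrimeSum H h₀ N R ℓ₁ ℓ₂ =
              (Nat.choose (ℓ₁ + ℓ₂) ℓ₁ : ℝ) * N * SmallGaps.singularSeries (insert h₀ H)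
                * ((Real.log R) ^ (k + ℓ₁ + ℓ₂) / (Nat.factorial (k + ℓ₁ + ℓ₂) : ℝ))
                * (1 + δ)) := by
  choose C₁ hC₁ h₁ using SmallGaps.exists_relative_error_mem k hk
  choose C₂ hC₂ h₂ using SmallGaps.exists_relative_error_notMem k hk
  -- Only finitely many pairs ℓ₁, ℓ₂ ≤ k occur, so one constant depending only on k dominates all of
  -- them.
  set C := 1 + ∑ a ∈ Finset.range (k + 1), ∑ b ∈ Finset.range (k + 1), (C₁ a b + C₂ a b)
  have hle : ∀ a b, a ≤ k → b ≤ k → C₁ a b + C₂ a b ≤ C := by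
    intro a b ha hb
    have h3 : ∀ i j, 0 ≤ C₁ i j + C₂ i j := fun i j => add_nonneg (hC₁ i j) (hC₂ i j)
    have h4 : C₁ a b + C₂ a b ≤ ∑ j ∈ Finset.range (k + 1), (C₁ a j + C₂ a j) :=
      Finset.single_le_sum (f := fun j => C₁ a j + C₂ a j) (fun j _ => h3 a j)
        (Finset.mem_range.2 (by omega))
    have h5 : ∑ j ∈ Finset.range (k + 1), (C₁ a j + C₂ a j)
        ≤ ∑ i ∈ Finset.range (k + 1), ∑ j ∈ Finset.range (k + 1), (C₁ i j + C₂ i j) :=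
      Finset.single_le_sum (f := fun i => ∑ j ∈ Finset.range (k + 1), (C₁ i j + C₂ i j))
        (fun i _ => Finset.sum_nonneg fun j _ => h3 i j) (Finset.mem_range.2 (by omega))
    simp only [C]
    linarith
  refine ⟨C, ?_, ?_⟩
  · have h3 := hle 0 0 (by omega) (by omega)
    have h4 : 0 ≤ ∑ a ∈ Finset.range (k + 1), ∑ b ∈ Finset.range (k + 1), (C₁ a b + C₂ a b) :=
      Finset.sum_nonneg fun a _ => Finset.sum_nonneg fun b _ => add_nonneg (hC₁ a b) (hC₂ a b)
    simp only [C]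
    linarith
  intro θ _ hθ hBV ε hε
  obtain ⟨N₀, hN₀⟩ := SmallGaps.exists_forall_abs_weightedPrimeSum_sub_le k (by omega) hθ hBV hε
  refine ⟨N₀, fun N hN R hR hRN H hHk h₀ hh ℓ₁ ℓ₂ hℓ₁ hℓ₂ => ?_⟩
  obtain ⟨hN0, hmain⟩ := hN₀ N hN
  have herr := fun hH₀ : SmallGaps.Admissible (insert h₀ H) =>
    hmain R hR hRN H h₀ hHk (hh h₀ (Finset.mem_insert_self _ _)) hH₀ ℓ₁ ℓ₂ hℓ₁ hℓ₂
  have hlR : 0 < Real.log R := Real.log_pos (by linarith)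
  have hC := hle ℓ₁ ℓ₂ hℓ₁ hℓ₂
  have hnn : ∀ H' : Finset ℤ, SmallGaps.Admissible H' → 2 ≤ H'.card →
      0 ≤ SmallGaps.beta H' * SmallGaps.singularSeries H' / Real.log R := by
    intro H' hH' hc
    have h3 := SmallGaps.le_beta H' hH' hc
    have h4 := SmallGaps.singularSeries_pos hH' hc
    have h5 : 0 ≤ Real.log 2 / 2 := by positivity
    exact div_nonneg (mul_nonneg (h5.trans h3) h4.le) hlR.le
  constructor
  · intro h₀H hH
    have hH₀ : SmallGaps.Admissible (insert h₀ H) := by rwa [Finset.insert_eq_of_mem h₀H]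
    have h3 := herr hH₀
    rw [SmallGaps.sum_selbergCoeff_eq_sum_diagonalForm hH₀] at h3
    obtain ⟨δ, hδ, hW⟩ := h₁ ℓ₁ ℓ₂ N R H h₀ hN0 hR hHk h₀H hH h3
    refine ⟨δ, hδ.trans (mul_le_mul_of_nonneg_right ?_ (hnn H hH (by omega))), hW⟩
    linarith [hC₂ ℓ₁ ℓ₂]
  · intro h₀H hH₀ hℓ₁' hℓ₂'
    have h3 := herr hH₀
    rw [SmallGaps.sum_selbergCoeff_eq_sum_diagonalForm hH₀] at h3
    obtain ⟨δ, hδ, hW⟩ := h₂ ℓ₁ ℓ₂ N R H h₀ hN0 hR hHk h₀H hH₀ hℓ₁' hℓ₂' h3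
    have hc : 2 ≤ (insert h₀ H).card := by rw [Finset.card_insert_of_notMem h₀H]; omega
    refine ⟨δ, hδ.trans (mul_le_mul_of_nonneg_right ?_ (hnn _ hH₀ hc)), hW⟩
    linarith [hC₁ ℓ₁ ℓ₂]
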